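/- Let $\Omega\subset\mathbb R^d$ be a bounded domain (nonempty, open, connected) with smooth boundary, let $\Omega_0$ be a bounded domain with smooth boundary such that $\overline{\Omega}_0\subset\Omega$, and assume that $\Omega_1:=\Omega\setminus\overline{\Omega}_0$ is a domain. Fix $m\in(0,1/2)$. For $\varepsilon>0$ put $$a_\varepsilon(u,\varphi)=\int_{\Omega_1}\nabla u\cdot\nabla\varphi\,dx+\varepsilon^{-1}\int_{\Omega_0}\nabla u\cdot\nabla\varphi\,dx,\qquad b_\varepsilon(u,\varphi)=\int_{\Omega_1}u\varphi\,dx+\varepsilon^{-2m}\int_{\Omega_0}u\varphi\,dx ,$$ and consider the stiff Neumann transmission problem: find $\lambda\in\mathbb R$ and $u\in H^1(\Omega)\setminus\{0\}$ with $a_\varepsilon(u,\varphi)=\lambda\, b_\varepsilon(u,\varphi)$ for all $\varphi\in H^1(\Omega)$. Its eigenvalues form, for every $\varepsilon>0$, an unbounded nondecreasing sequence $$0=\lambda^\varepsilon_0<\lambda^\varepsilon_1\le\lambda^\varepsilon_2\le\cdots\to\infty ,$$ each repeated according to its (finite) multiplicity, so that $\lambda^\varepsilon_n$, $n\ge1$,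 is the $n$-th positive eigenvalue. Let $H^1_0(\Omega_1,\partial\Omega_0)$ be the space of functions in $H^1(\Omega_1)$ with zero trace on $\partial\Omega_0$. The eigenvalues of the mixed problem in $\Omega_1$ (Neumann condition on $\partial\Omega$, Dirichlet condition on $\partial\Omega_0$), namely: find $\lambda\in\mathbb R$ and $v\in H^1_0(\Omega_1,\partial\Omega_0)\setminus\{0\}$ with $\int_{\Omega_1}\nabla v\cdot\nabla\varphi\,dx=\lambda\int_{\Omega_1}v\varphi\,dx$ for all $\varphi\in H^1_0(\Omega_1,\partial\Omega_0)$, form an unbounded nondecreasing sequence $0<\lambda^0_1\le\lambda^0_2\le\cdots\to\infty$, each repeated according to its (finite) multiplicity. Then, for every $n\ge1$, $$\lambda^\varepsilon_n\to\lambda^0_n\qquad\text{as }\varepsilon\to0^+ .$$ Moreover, let $n\ge 1$ and for each $\varepsilon>0$ let $u^\varepsilon$ be any eigenfunction of the stiff problem for $\lambda^\varepsilon_n$ normalized by $b_\varepsilon(u^\varepsilon,u^\varepsilon)=1$. Then $u^\varepsilon|_{\Omega_0}\to0$ strongly in $H^1(\Omega_0)$ as $\varepsilon\to0^+$, and every sequence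 $\varepsilon_k\to0^+$ has a subsequence along which $u^{\varepsilon_k}|_{\Omega_1}$ converges strongly in $L^2(\Omega_1)$ to an eigenfunction $g$ of the mixed problem for $\lambda^0_n$ with $\|g\|_{L^2(\Omega_1)}=1$. -/

import Mathlib

open MeasureTheory Filter Topology
open scoped ContDiff

noncomputable section

namespace StiffNeumann

/-- The Euclidean space `ℝ^d`. -/
abbrev E (d : ℕ) := EuclideanSpace ℝ (Fin d)

/-- A bounded domain (nonempty connected open set) with smooth boundary: near each boundary point
`x` the set is the strict sublevel set `{ρ < 0}` of a smooth function `ρ` with `dρ(x) ≠ 0`. -/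
structure IsSmoothBoundedDomain {d : ℕ} (U : Set (E d)) : Prop where
  isOpen : IsOpen U
  isConnected : IsConnected U
  isBounded : Bornology.IsBounded U
  smooth_boundary : ∀ x ∈ frontier U, ∃ W : Set (E d), IsOpen W ∧ x ∈ W ∧
    ∃ ρ : E d → ℝ, ContDiff ℝ ∞ ρ ∧ fderiv ℝ ρ x ≠ 0 ∧ ∀ y ∈ W, (y ∈ U ↔ ρ y < 0)

/-- The geometric data: a smooth bounded domain `Ω`, a core `Ω₀` which is a smooth bounded domain
with closure inside `Ω`, and such that the annulus `Ω \ closure Ω₀` is a domain as well. -/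
structure Geometry (d : ℕ) where
  /-- the whole domain `Ω` -/
  whole : Set (E d)
  /-- the core `Ω₀` -/
  core : Set (E d)
  whole_smooth : IsSmoothBoundedDomain whole
  core_smooth : IsSmoothBoundedDomain core
  closure_core_subset : closure core ⊆ whole
  annulus_connected : IsConnected (whole \ closure core)

/-- The annulus `Ω₁ = Ω \ closure Ω₀`. -/
def Geometry.annulus {d : ℕ} (G : Geometry d) : Set (E d) := G.whole \ closure G.core

lemma Geometry.core_subset {d : ℕ} (G : Geometry d) : G.core ⊆ G.whole :=
  subset_closure.trans G.closure_core_subset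

lemma Geometry.annulus_subset {d : ℕ} (G : Geometry d) : G.annulus ⊆ G.whole :=
  Set.sdiff_subset

/-- Pairs (function, vector field) in `L²(U) × L²(U; ℝ^d)`. -/
abbrev PairL2 {d : ℕ} (U : Set (E d)) :=
  Lp ℝ 2 (volume.restrict U) × Lp (E d) 2 (volume.restrict U)

lemma integrable_mul_test {d : ℕ} {U : Set (E d)} (f : Lp ℝ 2 (volume.restrict U))
    {ψ : E d → ℝ} (hψ : Continuous ψ) (hc : HasCompactSupport ψ) :
    Integrable (fun x => f x * ψ x) (volume.restrict U) :=
  (Lp.memLp f).integrable_mul (hψ.memLp_of_hasCompactSupport (p := 2) hc)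

lemma integrable_inner_mul_test {d : ℕ} {U : Set (E d)} (g : Lp (E d) 2 (volume.restrict U))
    (v : E d) {ψ : E d → ℝ} (hψ : Continuous ψ) (hc : HasCompactSupport ψ) :
    Integrable (fun x => inner ℝ (g x) v * ψ x) (volume.restrict U) :=
  ((Lp.memLp g).inner_const v).integrable_mul (hψ.memLp_of_hasCompactSupport (p := 2) hc)

lemma continuous_fderiv_test {d : ℕ} {φ : E d → ℝ} (hφ : ContDiff ℝ ∞ φ) (v : E d) :
    Continuous (fun x => fderiv ℝ φ x v) :=
  (hφ.continuous_fderiv (by simp)).clm_apply continuous_const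

lemma hasCompactSupport_fderiv_test {d : ℕ} {φ : E d → ℝ} (hc : HasCompactSupport φ) (v : E d) :
    HasCompactSupport (fun x => fderiv ℝ φ x v) :=
  hc.fderiv_apply ℝ v

/-- The pairs `(u, g)` on `U` for which integration by parts
`∫_U u ∂_v φ = - ∫_U (g · v) φ` holds for all smooth `φ` with compact support inside `V`. -/
def partsSpace {d : ℕ} (U V : Set (E d)) : Submodule ℝ (PairL2 U) where
  carrier := {w | ∀ φ : E d → ℝ, ContDiff ℝ ∞ φ → HasCompactSupport φ → tsupport φ ⊆ V →
    ∀ v : E d, ∫ x in U, w.1 x * fderiv ℝ φ x v = - ∫ x in U, inner ℝ (w.2 x) v * φ x}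
  add_mem' := by
    intro a b ha hb φ hφ hc hV v
    have h1 : ∫ x in U, (a + b).1 x * fderiv ℝ φ x v
        = ∫ x in U, (a.1 x * fderiv ℝ φ x v + b.1 x * fderiv ℝ φ x v) := by
      apply integral_congr_ae
      filter_upwards [Lp.coeFn_add a.1 b.1] with x hx
      rw [Prod.fst_add, hx, Pi.add_apply, add_mul]
    have h2 : ∫ x in U, inner ℝ ((a + b).2 x) v * φ x
        = ∫ x in U, (inner ℝ (a.2 x) v * φ x + inner ℝ (b.2 x) v * φ x) := by
      apply integral_congr_ae
      filter_upwards [Lp.coeFn_add a.2 b.2] with x hx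
      rw [Prod.snd_add, hx, Pi.add_apply, inner_add_left, add_mul]
    have c1 := continuous_fderiv_test hφ v
    have c2 := hasCompactSupport_fderiv_test hc v
    rw [h1, h2, integral_add (integrable_mul_test _ c1 c2) (integrable_mul_test _ c1 c2),
      integral_add (integrable_inner_mul_test _ _ hφ.continuous hc)
        (integrable_inner_mul_test _ _ hφ.continuous hc),
      ha φ hφ hc hV v, hb φ hφ hc hV v]
    ring
  zero_mem' := by
    intro φ _ _ _ v
    have h1 : ∫ x in U, (0 : PairL2 U).1 x * fderiv ℝ φ x v = 0 := by
      apply integral_eq_zero_of_ae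
      filter_upwards [Lp.coeFn_zero ℝ 2 (volume.restrict U)] with x hx
      rw [Prod.fst_zero, hx, Pi.zero_apply, zero_mul]
    have h2 : ∫ x in U, inner ℝ ((0 : PairL2 U).2 x) v * φ x = 0 := by
      apply integral_eq_zero_of_ae
      filter_upwards [Lp.coeFn_zero (E d) 2 (volume.restrict U)] with x hx
      rw [Prod.snd_zero, hx, Pi.zero_apply, inner_zero_left, zero_mul]
      rfl
    rw [h1, h2, neg_zero]
  smul_mem' := by
    intro c a ha φ hφ hc hV v
    have h1 : ∫ x in U, (c • a).1 x * fderiv ℝ φ x v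
        = ∫ x in U, c * (a.1 x * fderiv ℝ φ x v) := by
      apply integral_congr_ae
      filter_upwards [Lp.coeFn_smul c a.1] with x hx
      rw [Prod.smul_fst, hx, Pi.smul_apply, smul_eq_mul, mul_assoc]
    have h2 : ∫ x in U, inner ℝ ((c • a).2 x) v * φ x
        = ∫ x in U, c * (inner ℝ (a.2 x) v * φ x) := by
      apply integral_congr_ae
      filter_upwards [Lp.coeFn_smul c a.2] with x hx
      rw [Prod.smul_snd, hx, Pi.smul_apply, real_inner_smul_left, mul_assoc]
    rw [h1, h2, integral_const_mul, integral_const_mul, ha φ hφ hc hV v]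
    ring

/-- The Sobolev space `H¹(U)`: pairs `(u, ∇u)` of an `L²` function on `U` and its weak gradient,
which is required to be in `L²`. The gradient is determined by the function. -/
def H1 {d : ℕ} (U : Set (E d)) : Submodule ℝ (PairL2 U) := partsSpace U U

/-- The space `H¹₀(Ω₁, ∂Ω₀)` of `H¹(Ω₁)` functions with zero trace on `∂Ω₀`. By the Gauss-Green
formula `∫_{Ω₁} (u ∂_v φ + φ ∂_v u) = ∫_{∂Ω₀} u φ (ν · v)` for test functions `φ` with compact
support in `Ω` (thus vanishing near `∂Ω`, but arbitrary on `∂Ω₀`), and the trace of `u` on `∂Ω₀`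
is zero exactly when this boundary term vanishes for all such `φ` and all directions `v`. -/
def mixedH1 {d : ℕ} (G : Geometry d) : Submodule ℝ (PairL2 G.annulus) :=
  H1 G.annulus ⊓ partsSpace G.annulus G.whole

lemma integrable_mul_on {d : ℕ} {A U : Set (E d)} (h : A ⊆ U)
    (f g : Lp ℝ 2 (volume.restrict U)) :
    Integrable (fun x => f x * g x) (volume.restrict A) :=
  ((Lp.memLp f).integrable_mul (Lp.memLp g)).mono_measure (Measure.restrict_mono h le_rfl)

lemma integrable_inner_on {d : ℕ} {A U : Set (E d)} (h : A ⊆ U)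
    (f g : Lp (E d) 2 (volume.restrict U)) :
    Integrable (fun x => inner ℝ (f x) (g x)) (volume.restrict A) :=
  (L2.integrable_inner (𝕜 := ℝ) f g).mono_measure (Measure.restrict_mono h le_rfl)

lemma ae_sub {d : ℕ} {A U : Set (E d)} (h : A ⊆ U) :
    ae (volume.restrict A) ≤ ae (volume.restrict U) :=
  ae_mono (Measure.restrict_mono h le_rfl)

/-- The form `(u, v)_A = ∫_A u v` on functions defined on `U ⊇ A`. -/
def massForm {d : ℕ} {A U : Set (E d)} (h : A ⊆ U) : LinearMap.BilinForm ℝ (PairL2 U) :=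
  LinearMap.mk₂ ℝ (fun w z => ∫ x in A, w.1 x * z.1 x)
    (by
      intro a b z
      rw [← integral_add (integrable_mul_on h _ _) (integrable_mul_on h _ _)]
      apply integral_congr_ae
      filter_upwards [ae_sub h (Lp.coeFn_add a.1 b.1)] with x hx
      rw [Prod.fst_add, hx, Pi.add_apply, add_mul])
    (by
      intro c a z
      rw [smul_eq_mul, ← integral_const_mul]
      apply integral_congr_ae
      filter_upwards [ae_sub h (Lp.coeFn_smul c a.1)] with x hx
      rw [Prod.smul_fst, hx, Pi.smul_apply, smul_eq_mul, mul_assoc])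
    (by
      intro z a b
      rw [← integral_add (integrable_mul_on h _ _) (integrable_mul_on h _ _)]
      apply integral_congr_ae
      filter_upwards [ae_sub h (Lp.coeFn_add a.1 b.1)] with x hx
      rw [Prod.fst_add, hx, Pi.add_apply, mul_add])
    (by
      intro c z a
      rw [smul_eq_mul, ← integral_const_mul]
      apply integral_congr_ae
      filter_upwards [ae_sub h (Lp.coeFn_smul c a.1)] with x hx
      rw [Prod.smul_fst, hx, Pi.smul_apply, smul_eq_mul]
      ring)

/-- The form `(∇u, ∇v)_A = ∫_A ∇u · ∇v` on functions defined on `U ⊇ A`. -/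
def gradForm {d : ℕ} {A U : Set (E d)} (h : A ⊆ U) : LinearMap.BilinForm ℝ (PairL2 U) :=
  LinearMap.mk₂ ℝ (fun w z => ∫ x in A, inner ℝ (w.2 x) (z.2 x))
    (by
      intro a b z
      rw [← integral_add (integrable_inner_on h _ _) (integrable_inner_on h _ _)]
      apply integral_congr_ae
      filter_upwards [ae_sub h (Lp.coeFn_add a.2 b.2)] with x hx
      rw [Prod.snd_add, hx, Pi.add_apply, inner_add_left])
    (by
      intro c a z
      rw [smul_eq_mul, ← integral_const_mul]
      apply integral_congr_ae
      filter_upwards [ae_sub h (Lp.coeFn_smul c a.2)] with x hx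
      rw [Prod.smul_snd, hx, Pi.smul_apply, real_inner_smul_left])
    (by
      intro z a b
      rw [← integral_add (integrable_inner_on h _ _) (integrable_inner_on h _ _)]
      apply integral_congr_ae
      filter_upwards [ae_sub h (Lp.coeFn_add a.2 b.2)] with x hx
      rw [Prod.snd_add, hx, Pi.add_apply, inner_add_right])
    (by
      intro c z a
      rw [smul_eq_mul, ← integral_const_mul]
      apply integral_congr_ae
      filter_upwards [ae_sub h (Lp.coeFn_smul c a.2)] with x hx
      rw [Prod.smul_snd, hx, Pi.smul_apply, real_inner_smul_right])

/-- For a subspace `H` and forms `a`, `b`, the solutions `u ∈ H` of the variational spectral problem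
`a(u, φ) = μ b(u, φ)` for all `φ ∈ H`. -/
def eigenspace {V : Type*} [AddCommGroup V] [Module ℝ V] (H : Submodule ℝ V)
    (a b : LinearMap.BilinForm ℝ V) (μ : ℝ) : Submodule ℝ V where
  carrier := {u | u ∈ H ∧ ∀ φ ∈ H, a u φ = μ * b u φ}
  add_mem' := by
    rintro u v ⟨hu, hu'⟩ ⟨hv, hv'⟩
    refine ⟨H.add_mem hu hv, fun φ hφ => ?_⟩
    rw [LinearMap.BilinForm.add_left, LinearMap.BilinForm.add_left, hu' φ hφ, hv' φ hφ, mul_add]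
  zero_mem' := ⟨H.zero_mem, fun φ _ => by simp⟩
  smul_mem' := by
    rintro c u ⟨hu, hu'⟩
    refine ⟨H.smul_mem c hu, fun φ hφ => ?_⟩
    rw [LinearMap.BilinForm.smul_left, LinearMap.BilinForm.smul_left, hu' φ hφ]
    ring

/-- `lam` is the nondecreasing unbounded sequence of all eigenvalues, each repeated according to its
(finite) multiplicity; `S μ` is the eigenspace of `μ`, which is zero if `μ` is no eigenvalue. -/
structure IsEigenvalueSequence {V : Type*} [AddCommGroup V] [Module ℝ V]
    (S : ℝ → Submodule ℝ V) (lam : ℕ → ℝ) : Prop where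
  monotone : Monotone lam
  tendsto_atTop : Tendsto lam atTop atTop
  finite : ∀ μ, Module.Finite ℝ (S μ)
  multiplicity : ∀ μ, Module.finrank ℝ (S μ) = Set.ncard {n | lam n = μ}

variable {d : ℕ}

/-- `(∇u₁, ∇φ₁)_{Ω₁} + ε⁻¹ (∇u₀, ∇φ₀)_{Ω₀}`. -/
def stiffEnergy (G : Geometry d) (ε : ℝ) : LinearMap.BilinForm ℝ (PairL2 G.whole) :=
  gradForm G.annulus_subset + ε⁻¹ • gradForm G.core_subset

/-- `(u₁, φ₁)_{Ω₁} + ε^{-2m} (u₀, φ₀)_{Ω₀}`. -/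
def stiffMass (G : Geometry d) (m ε : ℝ) : LinearMap.BilinForm ℝ (PairL2 G.whole) :=
  massForm G.annulus_subset + (ε ^ (-2 * m)) • massForm G.core_subset

/-- Eigenspaces of the stiff Neumann transmission problem. -/
def stiffEigenspace (G : Geometry d) (m ε μ : ℝ) : Submodule ℝ (PairL2 G.whole) :=
  eigenspace (H1 G.whole) (stiffEnergy G ε) (stiffMass G m ε) μ

/-- Eigenspaces of the mixed problem in the annulus: Neumann on `∂Ω`, Dirichlet on `∂Ω₀`. -/
def mixedEigenspace (G : Geometry d) (μ : ℝ) : Submodule ℝ (PairL2 G.annulus) :=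
  eigenspace (mixedH1 G) (gradForm subset_rfl) (massForm subset_rfl) μ

end StiffNeumann

end

noncomputable section

namespace StiffNeumann

/-! ### Spectral theory of compact pairs of quadratic forms -/

section AbstractSpectral

variable {V : Type*} [AddCommGroup V] [Module ℝ V]

/-! A normalized function of bounded stiff energy has core mass at most `ε ^ (2 * m)` and core
gradient energy of order `ε`. Any weak limit therefore vanishes in the core, so it is the extension
by zero of a function of the mixed space. The danger is that the weighted core mass, carrying the
factor `ε ^ (-2 * m)`, might survive in the limit and leave less than unit mass in the annulus.

It does not survive, provided the function is orthogonal to constants for the stiff mass.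
Orthogonality makes the weighted core integral the negative of the annulus integral, which is
bounded; hence the core mean is of order `ε ^ (2 * m)` and adds only order `ε ^ (2 * m)` to the
weighted mass. By the Poincaré inequality in the core, the oscillation adds at most order `ε ^ (1 -
2 * m)`, which vanishes because `m < 1 / 2`. This is `Geometry.exists_limit`, the heart of the
proof.

The eigenvalues are then squeezed. From above (`stiff_eigenvalue_le`), min-max is applied to the
span of the constants and the extended mixed eigenfunctions; constants have no energy, and
`weighted_mass_lower_bound` shows that adding one hardly lowers the mass. From below, a suitable
combination of stiff eigenvectors converges to a normalized mixed function orthogonal to the first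
mixed eigenfunctions, whose energy would be too small if the stiff eigenvalues stayed below the
mixed one. For eigenfunctions, the equation passes to the limit when tested with extensions by zero,
which do not see the core.

The functional analysis rests on two results. `IsCompactFormPair.exists_isEigenbasis` is the
spectral theorem, by successive minimization of the Rayleigh quotient, and
`IsEigenvalueSequence.unique` transfers it to any enumeration of the spectrum.
`IsSmoothBoundedDomain.tendsto_norm_of_weak` is the Rellich theorem, proved without an extension
operator: a smooth domain has a local cone condition, so functions may be averaged over small
displacements pointing inward, and the averaging error is controlled by the weak gradient. -/

/-- A nontrivial linear combination of the `w i` on which fewer linear forms vanish. -/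
lemma exists_combination_eq_zero {ι κ : Type*} [Fintype ι] [Fintype κ]
    (hcard : Fintype.card κ < Fintype.card ι) (f : κ → V →ₗ[ℝ] ℝ) (w : ι → V) :
    ∃ c : ι → ℝ, c ≠ 0 ∧ ∀ k, f k (∑ i, c i • w i) = 0 := by
  classical
  let F : (ι → ℝ) →ₗ[ℝ] (κ → ℝ) :=
    LinearMap.pi (fun k => (f k) ∘ₗ (Fintype.linearCombination ℝ w))
  have hF : LinearMap.ker F ≠ ⊥ := LinearMap.ker_ne_bot_of_finrank_lt (by simpa using hcard)
  obtain ⟨c, hc, hc0⟩ := (Submodule.ne_bot_iff _).1 hF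
  refine ⟨c, hc0, fun k => ?_⟩
  have := congrFun (LinearMap.mem_ker.1 hc) k
  simpa [F, Fintype.linearCombination_apply] using this

/-- A pair of symmetric nonnegative forms on an infinite-dimensional space `H`, the second one
definite, such that sequences bounded for both forms are relatively compact, strongly for the second
and weakly for the first. -/
structure IsCompactFormPair (H : Submodule ℝ V) (a b : LinearMap.BilinForm ℝ V) : Prop where
  symm_left : ∀ u v, a u v = a v u
  symm_right : ∀ u v, b u v = b v u
  nonneg_left : ∀ u, 0 ≤ a u u
  nonneg_right : ∀ u, 0 ≤ b u u
  definite : ∀ u ∈ H, b u u = 0 → u = 0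
  infinite : ∀ n : ℕ, ∃ w : Fin n → V, (∀ i, w i ∈ H) ∧ LinearIndependent ℝ w
  compact : ∀ (w : ℕ → V) (C : ℝ), (∀ k, w k ∈ H) → (∀ k, a (w k) (w k) ≤ C) →
    (∀ k, b (w k) (w k) ≤ C) → ∃ s : ℕ → ℕ, StrictMono s ∧ ∃ u ∈ H,
      Tendsto (fun k => b (w (s k) - u) (w (s k) - u)) atTop (𝓝 0) ∧
      ∀ φ ∈ H, Tendsto (fun k => a (w (s k)) φ) atTop (𝓝 (a u φ))

/-- An orthonormal sequence of eigenvectors which exhausts the spectrum. -/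
structure IsEigenbasis (H : Submodule ℝ V) (a b : LinearMap.BilinForm ℝ V)
    (u : ℕ → V) (lam : ℕ → ℝ) : Prop where
  mem : ∀ n, u n ∈ H
  norm_one : ∀ n, b (u n) (u n) = 1
  orthogonal : ∀ i j, i ≠ j → b (u i) (u j) = 0
  eigen : ∀ n, ∀ φ ∈ H, a (u n) φ = lam n * b (u n) φ
  le_of_orthogonal : ∀ n, ∀ w ∈ H, (∀ i < n, b (u i) w = 0) → lam n * b w w ≤ a w w
  monotone : Monotone lam
  tendsto_atTop : Tendsto lam atTop atTop

/-- Recursive choice in which each term is constrained only by the set of earlier values. It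
produces eigenvectors one at a time, each minimizing on the complement of its predecessors. -/
lemma exists_seq_of_forall_finset {α : Type*} (P : Finset α → α → Prop)
    (h : ∀ s, ∃ y, P s y) :
    ∃ f : ℕ → α, ∀ n, ∃ s : Finset α, (∀ x, x ∈ s ↔ ∃ i < n, f i = x) ∧ P s (f n) := by
  classical
  choose y hy using h
  let g : ℕ → Finset α := fun n => Nat.rec ∅ (fun _ s => insert (y s) s) n
  refine ⟨fun n => y (g n), fun n => ⟨g n, ?_, hy _⟩⟩
  induction n with
  | zero => intro x; simp [g]
  | succ n ih =>
    intro x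
    have : g (n + 1) = insert (y (g n)) (g n) := rfl
    rw [this, Finset.mem_insert, ih]
    constructor
    · rintro (rfl | ⟨i, hi, rfl⟩)
      · exact ⟨n, by omega, rfl⟩
      · exact ⟨i, by omega, rfl⟩
    · rintro ⟨i, hi, rfl⟩
      rcases Nat.lt_succ_iff_lt_or_eq.1 hi with h | rfl
      · exact Or.inr ⟨i, h, rfl⟩
      · exact Or.inl rfl

lemma form_sq_le {b : LinearMap.BilinForm ℝ V} (symm : ∀ u v, b u v = b v u)
    (nonneg : ∀ u, 0 ≤ b u u) (u v : V) : b u v ^ 2 ≤ b u u * b v v := by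
  have := LinearMap.BilinForm.apply_mul_apply_le_of_forall_zero_le b nonneg u v
  rwa [symm v u, ← sq] at this

lemma form_sub_self {b : LinearMap.BilinForm ℝ V} (symm : ∀ u v, b u v = b v u) (u v : V) :
    b (u - v) (u - v) = b u u - 2 * b u v + b v v := by
  simp only [map_sub, LinearMap.sub_apply, symm v u]
  ring

/-- Strong convergence for a nonnegative form implies weak convergence. -/
lemma tendsto_form_of_tendsto_sub {b : LinearMap.BilinForm ℝ V} (symm : ∀ u v, b u v = b v u)
    (nonneg : ∀ u, 0 ≤ b u u) {w : ℕ → V} {u : V}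
    (h : Tendsto (fun k => b (w k - u) (w k - u)) atTop (𝓝 0)) (v : V) :
    Tendsto (fun k => b (w k) v) atTop (𝓝 (b u v)) := by
  rw [← tendsto_sub_nhds_zero_iff]
  have h2 : Tendsto (fun k => √(b (w k - u) (w k - u) * b v v)) atTop (𝓝 0) := by
    simpa using (h.mul_const (b v v)).sqrt
  refine squeeze_zero_norm (fun k => ?_) h2
  rw [← LinearMap.sub_apply, ← map_sub, Real.norm_eq_abs]
  exact Real.abs_le_sqrt (form_sq_le symm nonneg _ _)

/-- Strong convergence for a nonnegative form implies convergence of norms. -/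
lemma tendsto_form_self_of_tendsto_sub {b : LinearMap.BilinForm ℝ V}
    (symm : ∀ u v, b u v = b v u) (nonneg : ∀ u, 0 ≤ b u u) {w : ℕ → V} {u : V}
    (h : Tendsto (fun k => b (w k - u) (w k - u)) atTop (𝓝 0)) :
    Tendsto (fun k => b (w k) (w k)) atTop (𝓝 (b u u)) := by
  have h1 := tendsto_form_of_tendsto_sub symm nonneg h u
  have h2 := (h.add (h1.const_mul 2)).sub_const (b u u)
  have e : 0 + 2 * b u u - b u u = b u u := by ring
  rw [e] at h2
  refine h2.congr (fun k => ?_)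
  rw [form_sub_self symm]
  ring

/-- Weak lower semicontinuity of a nonnegative form. -/
lemma form_self_le_of_tendsto {a : LinearMap.BilinForm ℝ V} (symm : ∀ u v, a u v = a v u)
    (nonneg : ∀ u, 0 ≤ a u u) {w : ℕ → V} {u : V} {M : ℕ → ℝ} {L : ℝ}
    (h : Tendsto (fun k => a (w k) u) atTop (𝓝 (a u u)))
    (hM : ∀ k, a (w k) (w k) ≤ M k) (hL : Tendsto M atTop (𝓝 L)) : a u u ≤ L := by
  have h2 : Tendsto (fun k => 2 * a (w k) u - a u u) atTop (𝓝 (a u u)) := by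
    have := (h.const_mul 2).sub_const (a u u)
    rwa [show 2 * a u u - a u u = a u u by ring] at this
  refine le_of_tendsto_of_tendsto' h2 hL (fun k => ?_)
  have := nonneg (w k - u)
  rw [form_sub_self symm] at this
  linarith [hM k]

/-- Null vectors of a form which is nonnegative on a subspace. -/
lemma form_eq_zero_of_self_eq_zero {q : LinearMap.BilinForm ℝ V} (symm : ∀ u v, q u v = q v u)
    {K : Submodule ℝ V} (nonneg : ∀ u ∈ K, 0 ≤ q u u) {u v : V} (hu : u ∈ K) (hv : v ∈ K)
    (h0 : q u u = 0) : q u v = 0 := by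
  by_contra hne
  have hvv := nonneg v hv
  have key : ∀ t : ℝ, 0 ≤ 2 * t * q u v + t ^ 2 * q v v := by
    intro t
    have := nonneg (u + t • v) (K.add_mem hu (K.smul_mem t hv))
    simp only [map_add, LinearMap.add_apply, map_smul, LinearMap.smul_apply, smul_eq_mul,
      symm v u, h0] at this
    nlinarith
  -- The minimizer of the parabola would have denominator `q v v`; adding 1 avoids dividing by zero
  -- and still gives a negative value.
  have h1 := key (-(q u v) / (q v v + 1))
  have hpos : 0 < q v v + 1 := by linarith
  have h2 : 2 * (-(q u v) / (q v v + 1)) * q u v + (-(q u v) / (q v v + 1)) ^ 2 * q v v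
      = -(q u v) ^ 2 * (q v v + 2) / (q v v + 1) ^ 2 := by
    field_simp
    ring
  rw [h2] at h1
  have h3 : 0 < (q u v) ^ 2 * (q v v + 2) / (q v v + 1) ^ 2 := by positivity
  have h4 : -(q u v) ^ 2 * (q v v + 2) / (q v v + 1) ^ 2
      = -((q u v) ^ 2 * (q v v + 2) / (q v v + 1) ^ 2) := by ring
  linarith

namespace IsCompactFormPair

variable {H : Submodule ℝ V} {a b : LinearMap.BilinForm ℝ V}

lemma pos (h : IsCompactFormPair H a b) {u : V} (hu : u ∈ H) (h0 : u ≠ 0) : 0 < b u u :=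
  lt_of_le_of_ne (h.nonneg_right u) (fun h1 => h0 (h.definite u hu h1.symm))

/-- The Rayleigh quotient has a minimizer on the orthogonal complement of a finite set. -/
lemma exists_minimizer (h : IsCompactFormPair H a b) (s : Finset V) :
    ∃ y, y ∈ H ∧ b y y = 1 ∧ (∀ x ∈ s, b x y = 0) ∧
      ∀ w ∈ H, (∀ x ∈ s, b x w = 0) → a y y * b w w ≤ a w w := by
  classical
  let A : Set ℝ := {r | ∃ w ∈ H, b w w = 1 ∧ (∀ x ∈ s, b x w = 0) ∧ a w w = r}
  have scale : ∀ w ∈ H, w ≠ 0 → (∀ x ∈ s, b x w = 0) → a w w / b w w ∈ A := by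
    intro w hw hw0 hws
    have hp := h.pos hw hw0
    have hsq : √(b w w) * √(b w w) = b w w := Real.mul_self_sqrt hp.le
    have hs0 : √(b w w) ≠ 0 := (Real.sqrt_pos.2 hp).ne'
    refine ⟨(√(b w w))⁻¹ • w, H.smul_mem _ hw, ?_, fun x hx => by simp [hws x hx], ?_⟩
    · simp only [map_smul, LinearMap.smul_apply, smul_eq_mul]
      field_simp
      rw [sq, hsq]
    · simp only [map_smul, LinearMap.smul_apply, smul_eq_mul]
      rw [← mul_assoc, ← mul_inv, hsq]
      field_simp
  -- With one more independent vector than there are constraints, some nonzero combination is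
  -- admissible.
  have hne : A.Nonempty := by
    obtain ⟨w, hwH, hwi⟩ := h.infinite (s.card + 1)
    obtain ⟨c, hc0, hc⟩ := exists_combination_eq_zero (κ := s) (ι := Fin (s.card + 1))
      (by simp) (fun x => b x.1) w
    have hW0 : ∑ i, c i • w i ≠ 0 := fun h0 =>
      hc0 (funext (Fintype.linearIndependent_iff.1 hwi c h0))
    exact ⟨_, scale _ (H.sum_mem (fun i _ => H.smul_mem _ (hwH i))) hW0
      (fun x hx => hc ⟨x, hx⟩)⟩
  have hbdd : BddBelow A := ⟨0, by rintro r ⟨w, _, _, _, rfl⟩; exact h.nonneg_left w⟩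
  -- Direct method: a minimizing sequence converges strongly for `b`, which preserves normalization
  -- and constraints, and weakly for `a`, which does not raise the energy.
  obtain ⟨r, -, hr, hrA⟩ := exists_seq_tendsto_sInf hne hbdd
  choose w hwH hw1 hws hwr using hrA
  obtain ⟨C, hC⟩ := hr.bddAbove_range
  obtain ⟨σ, hσ, u, huH, hub, hua⟩ := h.compact w (max C 1) hwH
    (fun k => by rw [hwr]; exact le_max_of_le_left (hC ⟨k, rfl⟩))
    (fun k => by rw [hw1]; exact le_max_right _ _)
  have hu1 : b u u = 1 := by
    have := tendsto_form_self_of_tendsto_sub h.symm_right h.nonneg_right hub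
    exact tendsto_nhds_unique this (by simp [hw1])
  have hus : ∀ x ∈ s, b x u = 0 := by
    intro x hx
    have := tendsto_form_of_tendsto_sub h.symm_right h.nonneg_right hub x
    rw [h.symm_right]
    refine tendsto_nhds_unique this ?_
    simp [h.symm_right _ x, hws _ x hx]
  have hle : a u u ≤ sInf A := form_self_le_of_tendsto h.symm_left h.nonneg_left (hua u huH)
    (fun k => (hwr (σ k)).le) (hr.comp hσ.tendsto_atTop)
  refine ⟨u, huH, hu1, hus, fun w hw hws => ?_⟩
  by_cases hw0 : w = 0
  · simp [hw0]
  · have hp := h.pos hw hw0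
    rw [← le_div_iff₀ hp]
    exact hle.trans (csInf_le hbdd (scale w hw hw0 hws))

/-- The spectral theorem for compact pairs of forms. -/
theorem exists_isEigenbasis (h : IsCompactFormPair H a b) :
    ∃ u lam, IsEigenbasis H a b u lam := by
  classical
  obtain ⟨u, hu⟩ := exists_seq_of_forall_finset _ h.exists_minimizer
  have hmem : ∀ n, u n ∈ H := fun n => by obtain ⟨s, -, h1, -⟩ := hu n; exact h1
  have hone : ∀ n, b (u n) (u n) = 1 := fun n => by obtain ⟨s, -, -, h1, -⟩ := hu n; exact h1
  have hlt : ∀ i n, i < n → b (u i) (u n) = 0 := fun i n hin => by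
    obtain ⟨s, hs, -, -, h1, -⟩ := hu n
    exact h1 _ ((hs _).2 ⟨i, hin, rfl⟩)
  have horth : ∀ i j, i ≠ j → b (u i) (u j) = 0 := by
    intro i j hij
    rcases lt_or_gt_of_ne hij with h1 | h1
    · exact hlt i j h1
    · rw [h.symm_right]; exact hlt j i h1
  have hmin : ∀ n, ∀ w ∈ H, (∀ i < n, b (u i) w = 0) → a (u n) (u n) * b w w ≤ a w w := by
    intro n w hw hw0
    obtain ⟨s, hs, -, -, -, h1⟩ := hu n
    refine h1 w hw (fun x hx => ?_)
    obtain ⟨i, hi, rfl⟩ := (hs x).1 hx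
    exact hw0 i hi
  -- Euler-Lagrange equation: `a - a (u n) (u n) • b` is nonnegative on the complement `K` of the
  -- earlier eigenvectors and vanishes at `u n`, so `u n` is a null vector of it on `K`. The
  -- directions of the earlier eigenvectors are covered by induction.
  have heig : ∀ n, ∀ φ ∈ H, a (u n) φ = a (u n) (u n) * b (u n) φ := by
    intro n
    induction n using Nat.strong_induction_on with
    | _ n ih =>
    let K : Submodule ℝ V := H ⊓ ⨅ i : Fin n, LinearMap.ker (b (u i))
    have hK : ∀ x, x ∈ K ↔ x ∈ H ∧ ∀ i < n, b (u i) x = 0 := by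
      intro x
      simp only [K, Submodule.mem_inf, Submodule.mem_iInf, LinearMap.mem_ker, and_congr_right_iff]
      exact fun _ => ⟨fun h i hi => h ⟨i, hi⟩, fun h i => h i i.2⟩
    let q : LinearMap.BilinForm ℝ V := a - a (u n) (u n) • b
    have hq : ∀ x y, q x y = a x y - a (u n) (u n) * b x y := fun x y => rfl
    have hqK : ∀ φ ∈ K, q (u n) φ = 0 := fun φ hφ => by
      refine form_eq_zero_of_self_eq_zero (K := K) ?_ ?_ ?_ hφ ?_
      · intro x y; rw [hq, hq, h.symm_left, h.symm_right]
      · intro x hx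
        rw [hq, sub_nonneg]
        exact hmin n x ((hK x).1 hx).1 ((hK x).1 hx).2
      · exact (hK _).2 ⟨hmem n, fun i hi => hlt i n hi⟩
      · rw [hq, hone]; ring
    have hqu : ∀ i < n, q (u n) (u i) = 0 := fun i hi => by
      rw [hq, h.symm_left, ih i hi _ (hmem n), hlt i n hi, h.symm_right, hlt i n hi]
      ring
    intro φ hφ
    have hφK : φ - ∑ i ∈ Finset.range n, b (u i) φ • u i ∈ K := by
      refine (hK _).2 ⟨H.sub_mem hφ (H.sum_mem fun i _ => H.smul_mem _ (hmem i)), ?_⟩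
      intro j hj
      rw [map_sub, map_sum, Finset.sum_eq_single j]
      · simp [hone]
      · intro i _ hij
        simp [horth j i hij.symm]
      · intro h1; exact absurd (Finset.mem_range.2 hj) h1
    have h2 := hqK _ hφK
    rw [map_sub, map_sum, Finset.sum_eq_zero, sub_zero, hq] at h2
    · linarith
    · intro i hi
      rw [map_smul, hqu i (Finset.mem_range.1 hi), smul_zero]
  have hmono : Monotone (fun n => a (u n) (u n)) := by
    intro i j hij
    have := hmin i (u j) (hmem j) (fun k hk => hlt k j (hk.trans_le hij))
    simpa [hone] using this
  refine ⟨u, fun n => a (u n) (u n), hmem, hone, horth, heig, hmin, hmono, ?_⟩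
  rcases tendsto_atTop_of_monotone hmono with h1 | ⟨l, hl⟩
  · exact h1
  -- If the eigenvalues stayed bounded, a subsequence of the orthonormal `u` would converge to a
  -- unit vector orthogonal to every `u i`, hence to itself.
  · exfalso
    obtain ⟨C, hC⟩ := hl.bddAbove_range
    obtain ⟨σ, hσ, v, hvH, hvb, -⟩ := h.compact u (max C 1) hmem
      (fun k => le_max_of_le_left (hC ⟨k, rfl⟩))
      (fun k => by rw [hone]; exact le_max_right _ _)
    have hv1 : b v v = 1 := by
      have := tendsto_form_self_of_tendsto_sub h.symm_right h.nonneg_right hvb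
      exact tendsto_nhds_unique this (by simp [hone])
    have hvu : ∀ i, b (u i) v = 0 := by
      intro i
      have := tendsto_form_of_tendsto_sub h.symm_right h.nonneg_right hvb (u i)
      rw [h.symm_right]
      refine tendsto_nhds_unique this (tendsto_const_nhds.congr' ?_)
      filter_upwards [eventually_gt_atTop i] with k hk
      exact (horth _ _ (hk.trans_le (hσ.id_le k)).ne').symm
    have hvv := tendsto_form_of_tendsto_sub h.symm_right h.nonneg_right hvb v
    simp only [hvu, hv1] at hvv
    exact zero_ne_one (tendsto_nhds_unique tendsto_const_nhds hvv)

end IsCompactFormPair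

namespace IsEigenbasis

variable {H : Submodule ℝ V} {a b : LinearMap.BilinForm ℝ V} {u : ℕ → V} {lam : ℕ → ℝ}

lemma form_sum (hu : IsEigenbasis H a b u lam) (s : Finset ℕ) (c : ℕ → ℝ) (j : ℕ) :
    b (u j) (∑ i ∈ s, c i • u i) = if j ∈ s then c j else 0 := by
  classical
  rw [map_sum]
  split_ifs with hj
  · rw [Finset.sum_eq_single_of_mem j hj]
    · simp [hu.norm_one]
    · intro i _ hij
      simp [hu.orthogonal j i hij.symm]
  · refine Finset.sum_eq_zero (fun i hi => ?_)
    simp [hu.orthogonal j i (fun h => hj (h ▸ hi))]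

lemma linearIndependent (hu : IsEigenbasis H a b u lam) : LinearIndependent ℝ u := by
  rw [linearIndependent_iff']
  intro s c h0 i hi
  have := hu.form_sum s c i
  rw [h0, map_zero, if_pos hi] at this
  exact this.symm

/-- The upper half of the min-max principle. -/
lemma le_of_forall_combination (h : IsCompactFormPair H a b) (hu : IsEigenbasis H a b u lam)
    {n : ℕ} {M : ℝ} {w : Fin (n + 1) → V} (hw : ∀ i, w i ∈ H) (hli : LinearIndependent ℝ w)
    (hM : ∀ c : Fin (n + 1) → ℝ, a (∑ i, c i • w i) (∑ i, c i • w i)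
      ≤ M * b (∑ i, c i • w i) (∑ i, c i • w i)) : lam n ≤ M := by
  obtain ⟨c, hc0, hc⟩ := exists_combination_eq_zero (κ := Fin n) (ι := Fin (n + 1))
    (by simp) (fun i => b (u i)) w
  have hW0 : ∑ i, c i • w i ≠ 0 := fun h0 =>
    hc0 (funext (Fintype.linearIndependent_iff.1 hli c h0))
  have hWH : ∑ i, c i • w i ∈ H := H.sum_mem (fun i _ => H.smul_mem _ (hw i))
  have h1 := hu.le_of_orthogonal n _ hWH (fun i hi => hc ⟨i, hi⟩)
  exact le_of_mul_le_mul_right (h1.trans (hM c)) (h.pos hWH hW0)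

lemma mem_eigenspace_iff {μ : ℝ} {w : V} :
    w ∈ eigenspace H a b μ ↔ w ∈ H ∧ ∀ φ ∈ H, a w φ = μ * b w φ := Iff.rfl

/-- Every eigenspace is spanned by the members of the eigenbasis which belong to it. -/
lemma eigenspace_eq_span (h : IsCompactFormPair H a b) (hu : IsEigenbasis H a b u lam) (μ : ℝ) :
    eigenspace H a b μ = Submodule.span ℝ (u '' {n | lam n = μ}) := by
  classical
  apply le_antisymm
  · intro w hw
    obtain ⟨hwH, hwe⟩ := mem_eigenspace_iff.1 hw
    have horth : ∀ i, lam i ≠ μ → b (u i) w = 0 := by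
      intro i hi
      have h1 := hu.eigen i w hwH
      rw [h.symm_left, hwe _ (hu.mem i), h.symm_right w] at h1
      have : (lam i - μ) * b (u i) w = 0 := by linarith
      exact (mul_eq_zero.1 this).resolve_left (sub_ne_zero.2 hi)
    -- The remainder `z` after the first `N` components still satisfies the eigenvalue equation for
    -- `μ`, while its Rayleigh quotient would be at least `lam N > μ`; so it is zero.
    obtain ⟨N, hN⟩ := (hu.tendsto_atTop.eventually_gt_atTop μ).exists
    set z := w - ∑ i ∈ Finset.range N, b (u i) w • u i with hz
    have hzH : z ∈ H := H.sub_mem hwH (H.sum_mem fun i _ => H.smul_mem _ (hu.mem i))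
    have hzo : ∀ i < N, b (u i) z = 0 := by
      intro i hi
      rw [hz, map_sub, hu.form_sum, if_pos (Finset.mem_range.2 hi), sub_self]
    have hsum : ∑ i ∈ Finset.range N, b (u i) w • u i ∈ eigenspace H a b μ := by
      refine Submodule.sum_mem _ (fun i _ => ?_)
      by_cases hi : lam i = μ
      · exact Submodule.smul_mem _ _ (mem_eigenspace_iff.2 ⟨hu.mem i, hi ▸ hu.eigen i⟩)
      · rw [horth i hi, zero_smul]; exact Submodule.zero_mem _
    have hze := (mem_eigenspace_iff.1 (Submodule.sub_mem _ hw hsum)).2 z hzH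
    rw [← hz] at hze
    have h1 := hu.le_of_orthogonal N z hzH hzo
    rw [hze] at h1
    have h2 := h.nonneg_right z
    have h3 : b z z = 0 := by nlinarith
    have h4 : w = ∑ i ∈ Finset.range N, b (u i) w • u i :=
      sub_eq_zero.1 (h.definite z hzH h3)
    rw [h4]
    refine Submodule.sum_mem _ (fun i _ => ?_)
    by_cases hi : lam i = μ
    · exact Submodule.smul_mem _ _ (Submodule.subset_span ⟨i, hi, rfl⟩)
    · rw [horth i hi, zero_smul]; exact Submodule.zero_mem _
  · rw [Submodule.span_le]
    rintro _ ⟨i, hi, rfl⟩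
    exact mem_eigenspace_iff.2 ⟨hu.mem i, hi ▸ hu.eigen i⟩

lemma finite_level {lam : ℕ → ℝ} (h : Tendsto lam atTop atTop) (t : ℝ) :
    {n | lam n ≤ t}.Finite := by
  obtain ⟨N, hN⟩ := (h.eventually_gt_atTop t).exists_forall_of_atTop
  exact (Set.finite_lt_nat N).subset (fun n hn => by
    by_contra h1
    exact absurd (hN n (not_lt.1 h1)) (not_lt.2 hn))

theorem isEigenvalueSequence (h : IsCompactFormPair H a b) (hu : IsEigenbasis H a b u lam) :
    IsEigenvalueSequence (eigenspace H a b) lam where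
  monotone := hu.monotone
  tendsto_atTop := hu.tendsto_atTop
  finite μ := by
    have hfin : {n | lam n = μ}.Finite :=
      (finite_level hu.tendsto_atTop μ).subset (fun n hn => le_of_eq hn)
    rw [eigenspace_eq_span h hu]
    exact Module.Finite.span_of_finite ℝ (hfin.image u)
  multiplicity μ := by
    have hfin : {n | lam n = μ}.Finite :=
      (finite_level hu.tendsto_atTop μ).subset (fun n hn => le_of_eq hn)
    have : Fintype {n | lam n = μ} := hfin.fintype
    have hli : LinearIndependent ℝ (fun n : {n | lam n = μ} => u n) :=
      hu.linearIndependent.comp _ Subtype.val_injective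
    have := finrank_span_eq_card hli
    rw [eigenspace_eq_span h hu, Set.image_eq_range, this, Set.ncard_eq_toFinset_card',
      Set.toFinset_card]

end IsEigenbasis

/-- The eigenvalue sequence is determined by the eigenspaces. -/
lemma IsEigenvalueSequence.unique {S : ℝ → Submodule ℝ V} {lam lam' : ℕ → ℝ}
    (h : IsEigenvalueSequence S lam) (h' : IsEigenvalueSequence S lam') : lam = lam' := by
  classical
  have key : ∀ lam lam' : ℕ → ℝ, IsEigenvalueSequence S lam → IsEigenvalueSequence S lam' →
      ∀ n, lam' n ≤ lam n := by
    intro lam lam' h h' n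
    by_contra hlt
    rw [not_le] at hlt
    set t := lam n
    let A := (IsEigenbasis.finite_level h.tendsto_atTop t).toFinset
    let A' := (IsEigenbasis.finite_level h'.tendsto_atTop t).toFinset
    let F := A.image lam ∪ A'.image lam'
    -- The number of indices with value at most `t` is a sum of dimensions depending on `S` alone.
    -- If `lam n < lam' n`, it would be at least `n + 1` for one sequence and at most `n` for the
    -- other.
    have card : ∀ l : ℕ → ℝ, IsEigenvalueSequence S l → ∀ B : Finset ℕ,
        (∀ k, k ∈ B ↔ l k ≤ t) → (∀ k ∈ B, l k ∈ F) →
        B.card = ∑ μ ∈ F, Module.finrank ℝ (S μ) := by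
      intro l hl B hB hF
      rw [Finset.card_eq_sum_card_fiberwise (f := l) (t := F) hF]
      refine Finset.sum_congr rfl (fun μ hμ => ?_)
      have hμt : μ ≤ t := by
        rcases Finset.mem_union.1 hμ with h1 | h1
        · obtain ⟨k, hk, rfl⟩ := Finset.mem_image.1 h1
          simpa [A] using hk
        · obtain ⟨k, hk, rfl⟩ := Finset.mem_image.1 h1
          simpa [A'] using hk
      rw [hl.multiplicity, ← Set.ncard_coe_finset]
      congr 1
      ext k
      simp only [Finset.coe_filter, Set.mem_ofPred_eq, hB]
      exact ⟨fun h => h.2, fun h => ⟨h.le.trans hμt, h⟩⟩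
    have c1 := card lam h A (by simp [A])
      (fun k hk => Finset.mem_union_left _ (Finset.mem_image_of_mem _ hk))
    have c2 := card lam' h' A' (by simp [A'])
      (fun k hk => Finset.mem_union_right _ (Finset.mem_image_of_mem _ hk))
    have h1 : Finset.range (n + 1) ⊆ A := by
      intro k hk
      have : lam k ≤ lam n := h.monotone (by simpa [Nat.lt_succ_iff] using hk)
      simpa [A] using this
    have h2 : A' ⊆ Finset.range n := by
      intro k hk
      have hk : lam' k ≤ t := by simpa [A'] using hk
      rw [Finset.mem_range]
      by_contra h3
      exact absurd (h'.monotone (not_lt.1 h3)) (not_le.2 (hk.trans_lt hlt))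
    have h3 := Finset.card_le_card h1
    have h4 := Finset.card_le_card h2
    rw [Finset.card_range] at h3 h4
    omega
  exact funext fun n => le_antisymm (key lam' lam h' h n) (key lam lam' h h' n)

end AbstractSpectral

/-! ### Cone condition and null boundary of smooth domains -/

section SmoothGeometry

open scoped Pointwise

variable {d : ℕ} {U : Set (E d)}

/-- A smooth domain satisfies a uniform cone condition near each point of its closure. -/
lemma IsSmoothBoundedDomain.exists_cone (hU : IsSmoothBoundedDomain U) {x : E d}
    (hx : x ∈ closure U) :
    ∃ W : Set (E d), IsOpen W ∧ x ∈ W ∧ ∃ (e : E d) (r : ℝ), 0 < r ∧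
      ∀ y ∈ W, y ∈ closure U → ∀ z ∈ Metric.ball e r, ∀ s : ℝ, 0 < s → s ≤ 1 →
        y + s • z ∈ U := by
  by_cases hxU : x ∈ U
  · obtain ⟨R, hR, hball⟩ := Metric.isOpen_iff.1 hU.isOpen x hxU
    refine ⟨Metric.ball x (R / 2), Metric.isOpen_ball, Metric.mem_ball_self (by positivity), 0,
      R / 2, by positivity, fun y hy _ z hz s hs0 hs1 => hball ?_⟩
    rw [Metric.mem_ball, dist_eq_norm] at *
    have h1 : ‖s • z‖ < R / 2 := by
      rw [norm_smul, Real.norm_of_nonneg hs0.le]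
      rw [sub_zero] at hz
      nlinarith [norm_nonneg z]
    calc ‖y + s • z - x‖ = ‖(y - x) + s • z‖ := by congr 1; abel
      _ ≤ ‖y - x‖ + ‖s • z‖ := norm_add_le _ _
      _ < R := by linarith
  · have hxF : x ∈ frontier U := ⟨hx, by rwa [hU.isOpen.interior_eq]⟩
    obtain ⟨W, hW, hxW, ρ, hρ, hρx, hWU⟩ := hU.smooth_boundary x hxF
    obtain ⟨v, hv⟩ : ∃ v, fderiv ℝ ρ x v < 0 := by
      obtain ⟨v, hv⟩ : ∃ v, fderiv ℝ ρ x v ≠ 0 := by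
        by_contra! h
        exact hρx (ContinuousLinearMap.ext h)
      rcases lt_or_gt_of_ne hv with h | h
      · exact ⟨v, h⟩
      · exact ⟨-v, by simpa using h⟩
    have hcont : Continuous (fun p : E d × E d => fderiv ℝ ρ p.1 p.2) :=
      ((hρ.continuous_fderiv (by simp)).comp continuous_fst).clm_apply continuous_snd
    have hopen : {p : E d × E d | fderiv ℝ ρ p.1 p.2 < 0} ∈ 𝓝 (x, v) :=
      (isOpen_lt hcont continuous_const).mem_nhds hv
    obtain ⟨R', hR', hRb⟩ := Metric.mem_nhds_iff.1 hopen
    obtain ⟨R'', hR'', hRW⟩ := Metric.isOpen_iff.1 hW x hxW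
    set R := min R' R'' with hRdef
    have hR : 0 < R := lt_min hR' hR''
    have hneg : ∀ y ∈ Metric.ball x R, ∀ z ∈ Metric.ball v R, fderiv ℝ ρ y z < 0 := by
      intro y hy z hz
      refine hRb (show (y, z) ∈ _ from ?_)
      rw [← ball_prod_same]
      exact ⟨Metric.ball_subset_ball (min_le_left _ _) hy,
        Metric.ball_subset_ball (min_le_left _ _) hz⟩
    have hWU' : ∀ y ∈ Metric.ball x R, (y ∈ U ↔ ρ y < 0) := fun y hy =>
      hWU y (hRW (Metric.ball_subset_ball (min_le_right _ _) hy))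
    -- This scaling makes every step `t • z'` with `z'` in `ball v R` of length at most `R / 2`.
    -- Segments starting in the half ball thus stay where `ρ` strictly decreases along them, and
    -- since `ρ ≤ 0` at their start they enter `U`.
    set t : ℝ := R / 2 / (‖v‖ + R) with ht
    have hvR : 0 < ‖v‖ + R := by positivity
    have ht0 : 0 < t := by positivity
    refine ⟨Metric.ball x (R / 2), Metric.isOpen_ball, Metric.mem_ball_self (by positivity),
      t • v, t * R, by positivity, fun y hy hyU z hz s hs0 hs1 => ?_⟩
    obtain ⟨z', hz', rfl⟩ : ∃ z' ∈ Metric.ball v R, z = t • z' := by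
      refine ⟨t⁻¹ • z, ?_, by rw [smul_smul, mul_inv_cancel₀ ht0.ne', one_smul]⟩
      rw [Metric.mem_ball, dist_eq_norm] at hz ⊢
      have : t⁻¹ • z - v = t⁻¹ • (z - t • v) := by
        rw [smul_sub, smul_smul, inv_mul_cancel₀ ht0.ne', one_smul]
      rw [this, norm_smul, norm_inv, Real.norm_of_nonneg ht0.le, inv_mul_lt_iff₀ ht0]
      exact hz
    have hnz : ‖z'‖ < ‖v‖ + R := by
      rw [Metric.mem_ball, dist_eq_norm] at hz'
      linarith [norm_le_norm_add_norm_sub' z' v]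
    have htz : ‖t • z'‖ ≤ R / 2 := by
      rw [norm_smul, Real.norm_of_nonneg ht0.le, ht, div_mul_eq_mul_div, div_le_iff₀ hvR]
      exact mul_le_mul_of_nonneg_left hnz.le (by positivity)
    have hseg : ∀ τ ∈ Set.Icc (0 : ℝ) 1, y + τ • t • z' ∈ Metric.ball x R := by
      intro τ hτ
      rw [Metric.mem_ball, dist_eq_norm] at hy ⊢
      have h1 : ‖τ • t • z'‖ ≤ R / 2 := by
        rw [norm_smul, Real.norm_of_nonneg hτ.1]
        nlinarith [norm_nonneg (t • z'), hτ.1, hτ.2]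
      calc ‖y + τ • t • z' - x‖ = ‖(y - x) + τ • t • z'‖ := by congr 1; abel
        _ ≤ ‖y - x‖ + ‖τ • t • z'‖ := norm_add_le _ _
        _ < R := by linarith
    have hder : ∀ τ : ℝ, HasDerivAt (fun τ : ℝ => ρ (y + τ • t • z'))
        (fderiv ℝ ρ (y + τ • t • z') (t • z')) τ := by
      intro τ
      have h1 : HasDerivAt (fun τ : ℝ => y + τ • t • z') (t • z') τ := by
        simpa using ((hasDerivAt_id τ).smul_const (t • z')).const_add y
      exact ((hρ.differentiable (by simp)).differentiableAt.hasFDerivAt).comp_hasDerivAt τ h1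
    have hanti : StrictAntiOn (fun τ : ℝ => ρ (y + τ • t • z')) (Set.Icc 0 1) := by
      apply strictAntiOn_of_deriv_neg (convex_Icc 0 1)
      · exact fun τ _ => (hder τ).continuousAt.continuousWithinAt
      · intro τ hτ
        rw [interior_Icc] at hτ
        rw [(hder τ).deriv, map_smul, smul_eq_mul]
        exact mul_neg_of_pos_of_neg ht0 (hneg _ (hseg τ ⟨hτ.1.le, hτ.2.le⟩) _ hz')
    have hyb : y ∈ Metric.ball x R := Metric.ball_subset_ball (by linarith) hy
    have hρy : ρ y ≤ 0 := by
      by_contra hpos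
      rw [not_le] at hpos
      have hN : {w | 0 < ρ w} ∩ Metric.ball x R ∈ 𝓝 y :=
        inter_mem ((isOpen_lt continuous_const hρ.continuous).mem_nhds hpos)
          (Metric.isOpen_ball.mem_nhds hyb)
      obtain ⟨w, hw, hwU⟩ := mem_closure_iff_nhds.1 hyU _ hN
      exact absurd ((hWU' w hw.2).1 hwU) (not_lt.2 (le_of_lt hw.1))
    rw [hWU' _ (hseg s ⟨hs0.le, hs1⟩)]
    have := hanti (Set.left_mem_Icc.2 zero_le_one) ⟨hs0.le, hs1⟩ hs0
    simp only [zero_smul, add_zero] at this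
    exact this.trans_le hρy

/-- The boundary of a smooth domain is a null set. -/
lemma IsSmoothBoundedDomain.volume_frontier (hU : IsSmoothBoundedDomain U) :
    volume (frontier U) = 0 := by
  refine measure_null_of_locally_null _ (fun x hx => ?_)
  obtain ⟨W, hW, hxW, e, r, hr, hcone⟩ := hU.exists_cone (frontier_subset_closure hx)
  refine ⟨frontier U ∩ W, inter_mem_nhdsWithin _ (hW.mem_nhds hxW), ?_⟩
  -- Translates of the boundary piece along the cone axis are disjoint: a common point would make
  -- one boundary point an inward displacement of another, hence a point of the open set `U`. A set
  -- with infinitely many disjoint translates by bounded vectors is null.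
  let u : ℕ → E d := fun n => ((n : ℝ) + 1)⁻¹ • e
  have hle : ∀ n : ℕ, ((n : ℝ) + 1)⁻¹ ≤ 1 := fun n => inv_le_one_of_one_le₀ (by
    have : (0 : ℝ) ≤ n := n.cast_nonneg
    linarith)
  have key : ∀ n m : ℕ, n < m → Disjoint ({u n} + (frontier U ∩ W)) ({u m} + (frontier U ∩ W)) := by
    intro n m hnm
    rw [Set.disjoint_left]
    intro p hp hp'
    rw [Set.singleton_add] at hp hp'
    obtain ⟨y, hy, rfl⟩ := hp
    obtain ⟨y', hy', he⟩ := hp'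
    have h1 : y' = y + (((n : ℝ) + 1)⁻¹ - ((m : ℝ) + 1)⁻¹) • e := by
      simp only [u] at he
      rw [sub_smul]
      rw [← sub_eq_zero] at he ⊢
      rw [← he]; abel
    have hlt : ((m : ℝ) + 1)⁻¹ < ((n : ℝ) + 1)⁻¹ := by
      have : (n : ℝ) < m := by exact_mod_cast hnm
      gcongr
    have hpos : (0 : ℝ) < ((m : ℝ) + 1)⁻¹ := by positivity
    have h2 : y' ∈ U := h1 ▸ hcone y hy.2 (frontier_subset_closure hy.1) e
      (Metric.mem_ball_self hr) _ (sub_pos.2 hlt) (by linarith [hle n])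
    have h3 := hy'.1.2
    rw [hU.isOpen.interior_eq] at h3
    exact h3 h2
  refine Measure.addHaar_eq_zero_of_disjoint_translates volume u ?_ ?_
    (isClosed_frontier.measurableSet.inter hW.measurableSet)
  · refine (Metric.isBounded_closedBall (x := (0 : E d)) (r := ‖e‖)).subset ?_
    rintro _ ⟨n, rfl⟩
    rw [mem_closedBall_zero_iff, norm_smul, Real.norm_of_nonneg (by positivity)]
    exact mul_le_of_le_one_left (norm_nonneg e) (hle n)
  · intro n m hnm
    rcases lt_or_gt_of_ne hnm with h | h
    · exact key n m h
    · exact (key m n h).symm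

lemma IsSmoothBoundedDomain.volume_lt_top (hU : IsSmoothBoundedDomain U) : volume U < ⊤ :=
  hU.isBounded.measure_lt_top

lemma IsSmoothBoundedDomain.volume_pos (hU : IsSmoothBoundedDomain U) : 0 < volume U :=
  hU.isOpen.measure_pos _ hU.isConnected.nonempty

end SmoothGeometry

/-! ### Duality and weak compactness in `L²` -/

section SquareIntegrable

variable {α : Type*} [MeasurableSpace α] {μ : Measure α}

lemma integral_mul_eq_inner (f : Lp ℝ 2 μ) {h : α → ℝ} (hh : MemLp h 2 μ) :
    ∫ x, f x * h x ∂μ = inner ℝ f (hh.toLp h) := by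
  rw [L2.inner_def]
  refine integral_congr_ae ?_
  filter_upwards [hh.coeFn_toLp] with x hx
  rw [hx]
  simp [mul_comm]

lemma integral_sq_eq_norm_sq (f : Lp ℝ 2 μ) : ∫ x, f x ^ 2 ∂μ = ‖f‖ ^ 2 := by
  rw [← real_inner_self_eq_norm_sq, L2.inner_def]
  refine integral_congr_ae (.of_forall fun x => ?_)
  simp [sq]

lemma integral_norm_sq_eq_norm_sq {F : Type*} [NormedAddCommGroup F] [InnerProductSpace ℝ F]
    (f : Lp F 2 μ) : ∫ x, ‖f x‖ ^ 2 ∂μ = ‖f‖ ^ 2 := by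
  rw [← real_inner_self_eq_norm_sq, L2.inner_def]
  refine integral_congr_ae (.of_forall fun x => ?_)
  exact (real_inner_self_eq_norm_sq (f x)).symm

lemma norm_toLp_eq_sqrt {h : α → ℝ} (hh : MemLp h 2 μ) :
    ‖hh.toLp h‖ = √(∫ x, h x ^ 2 ∂μ) := by
  have : ∫ x, h x ^ 2 ∂μ = ‖hh.toLp h‖ ^ 2 := by
    rw [← integral_sq_eq_norm_sq]
    refine integral_congr_ae ?_
    filter_upwards [hh.coeFn_toLp] with x hx
    rw [hx]
  rw [this, Real.sqrt_sq (norm_nonneg _)]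

lemma abs_integral_mul_le {f g : α → ℝ} (hf : MemLp f 2 μ) (hg : MemLp g 2 μ) :
    |∫ x, f x * g x ∂μ| ≤ √(∫ x, f x ^ 2 ∂μ) * √(∫ x, g x ^ 2 ∂μ) := by
  have : ∫ x, f x * g x ∂μ = inner ℝ (hf.toLp f) (hg.toLp g) := by
    rw [← integral_mul_eq_inner]
    refine integral_congr_ae ?_
    filter_upwards [hf.coeFn_toLp] with x hx
    rw [hx]
  rw [this, ← norm_toLp_eq_sqrt hf, ← norm_toLp_eq_sqrt hg]
  exact abs_real_inner_le_norm _ _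

/-- Bounded sequences in a separable Hilbert space have weakly convergent subsequences. -/
lemma exists_weakly_convergent_subseq {F : Type*} [NormedAddCommGroup F] [InnerProductSpace ℝ F]
    [CompleteSpace F] [TopologicalSpace.SeparableSpace F] {x : ℕ → F} {C : ℝ}
    (hx : ∀ n, ‖x n‖ ≤ C) :
    ∃ s : ℕ → ℕ, StrictMono s ∧ ∃ y : F, ∀ z : F,
      Tendsto (fun k => inner ℝ (x (s k)) z) atTop (𝓝 (inner ℝ y z)) := by
  obtain ⟨f, -, s, hs, hf⟩ := WeakDual.isSeqCompact_closedBall ℝ F 0 C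
    (x := fun n => StrongDual.toWeakDual (InnerProductSpace.toDual ℝ F (x n)))
    (fun n => by
      rw [Set.mem_preimage, mem_closedBall_zero_iff]
      exact ((InnerProductSpace.toDual ℝ F).norm_map (x n)).le.trans (hx n))
  refine ⟨s, hs, (InnerProductSpace.toDual ℝ F).symm (WeakDual.toStrongDual f), fun z => ?_⟩
  have h1 := ((WeakDual.eval_continuous z).tendsto f).comp hf
  rw [InnerProductSpace.toDual_symm_apply]
  exact h1

end SquareIntegrable

/-! ### Translations and averages estimated by duality -/

section TestFunctions

variable {d : ℕ} {U A : Set (E d)}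

lemma memLp_test {ψ : E d → ℝ} (hψ : Continuous ψ) (hc : HasCompactSupport ψ)
    (ν : Measure (E d)) [IsFiniteMeasureOnCompacts ν] : MemLp ψ 2 ν :=
  hψ.memLp_of_hasCompactSupport hc

/-- Smooth functions with compact support in an open set determine the `L²` norm by duality. -/
lemma integral_sq_le_of_forall_test (hA : IsOpen A) {f : E d → ℝ}
    (hf : MemLp f 2 (volume.restrict A)) {M : ℝ} (hM : 0 ≤ M)
    (h : ∀ ψ : E d → ℝ, ContDiff ℝ ∞ ψ → HasCompactSupport ψ → tsupport ψ ⊆ A →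
      |∫ x in A, f x * ψ x| ≤ M * √(∫ x, ψ x ^ 2)) :
    ∫ x in A, f x ^ 2 ≤ M ^ 2 := by
  let D : Set (Lp ℝ 2 (volume.restrict A)) := {q | ∃ (ψ : E d → ℝ) (hψ : ContDiff ℝ ∞ ψ)
    (hc : HasCompactSupport ψ), tsupport ψ ⊆ A ∧
      q = (memLp_test hψ.continuous hc (volume.restrict A)).toLp ψ}
  let S : Submodule ℝ (Lp ℝ 2 (volume.restrict A)) :=
    { carrier := D
      add_mem' := by
        rintro _ _ ⟨ψ, hψ, hc, hs, rfl⟩ ⟨ψ', hψ', hc', hs', rfl⟩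
        exact ⟨ψ + ψ', hψ.add hψ', hc.add hc',
          (tsupport_add ψ ψ').trans (Set.union_subset hs hs'), rfl⟩
      zero_mem' := ⟨0, contDiff_const, HasCompactSupport.zero, by simp [tsupport], rfl⟩
      smul_mem' := by
        rintro c _ ⟨ψ, hψ, hc, hs, rfl⟩
        refine ⟨c • ψ, hψ.const_smul c, hc.smul_left (f := fun _ => c), ?_, rfl⟩
        exact (closure_mono (Function.support_const_smul_subset c ψ)).trans hs }
  -- Test functions are dense, since an `L²` function orthogonal to all of them vanishes almost
  -- everywhere. The assumed bound then extends to all of `L²` and may be applied to `f` itself.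
  have hS : S.topologicalClosure = ⊤ := by
    rw [Submodule.topologicalClosure_eq_top_iff, Submodule.eq_bot_iff]
    intro q hq
    have hq0 : ∀ᵐ x, x ∈ A → q x = 0 := by
      refine hA.ae_eq_zero_of_integral_contDiff_smul_eq_zero ?_ ?_
      · have := (Lp.memLp q).locallyIntegrable (by norm_num)
        exact (locallyIntegrableOn_of_locallyIntegrable_restrict this)
      · intro ψ hψ hc hs
        have h1 := (Submodule.mem_orthogonal' S q).1 hq _ ⟨ψ, hψ, hc, hs, rfl⟩
        rw [← integral_mul_eq_inner] at h1
        rw [← h1, ← setIntegral_eq_integral_of_forall_compl_eq_zero (s := A)]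
        · simp [mul_comm]
        · intro x hx
          rw [image_eq_zero_of_notMem_tsupport (fun h => hx (hs h)), zero_smul]
    rw [Lp.ext_iff]
    filter_upwards [(ae_restrict_iff' hA.measurableSet).2 hq0,
      Lp.coeFn_zero ℝ 2 (volume.restrict A)] with x h1 h2
    rw [h1, h2]; rfl
  set F := hf.toLp f
  have key : ∀ q : Lp ℝ 2 (volume.restrict A), |inner ℝ F q| ≤ M * ‖q‖ := by
    intro q
    have hq : q ∈ closure (S : Set (Lp ℝ 2 (volume.restrict A))) := by
      have : q ∈ S.topologicalClosure := hS ▸ Submodule.mem_top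
      exact this
    refine closure_minimal (t := {q | |inner ℝ F q| ≤ M * ‖q‖}) ?_ ?_ hq
    · rintro _ ⟨ψ, hψ, hc, hs, rfl⟩
      have h1 := h ψ hψ hc hs
      rw [Set.mem_ofPred_eq, ← integral_mul_eq_inner, norm_toLp_eq_sqrt]
      have h2 : ∫ x in A, F x * ψ x = ∫ x in A, f x * ψ x := by
        refine integral_congr_ae ?_
        filter_upwards [hf.coeFn_toLp] with x hx
        rw [hx]
      rw [h2, setIntegral_eq_integral_of_forall_compl_eq_zero (f := fun x => ψ x ^ 2)]
      · exact h1
      · intro x hx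
        rw [image_eq_zero_of_notMem_tsupport (fun h => hx (hs h))]
        ring
    · exact isClosed_le (by fun_prop) (by fun_prop)
  have h1 := key F
  rw [real_inner_self_eq_norm_sq, abs_of_nonneg (by positivity)] at h1
  have h2 : ‖F‖ ≤ M := by
    by_contra hlt
    rw [not_le] at hlt
    nlinarith [norm_nonneg F]
  have h3 : ∫ x in A, f x ^ 2 = ‖F‖ ^ 2 := by
    rw [norm_toLp_eq_sqrt hf, Real.sq_sqrt (integral_nonneg fun x => sq_nonneg _)]
  rw [h3]
  gcongr

lemma integrable_fst (hvol : volume U ≠ ⊤) (f : Lp ℝ 2 (volume.restrict U)) :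
    Integrable f (volume.restrict U) := by
  have : IsFiniteMeasure (volume.restrict U) := isFiniteMeasure_restrict.2 hvol
  exact (Lp.memLp f).integrable (by norm_num)

/-- Difference quotients are controlled by the weak gradient, tested against a smooth function which
can be moved along the segment `[0, z]` inside the domain. -/
lemma abs_integral_translate_sub_le (hvol : volume U ≠ ⊤) {w : PairL2 U} (hw : w ∈ H1 U)
    {ψ : E d → ℝ} (hψ : ContDiff ℝ ∞ ψ) (hc : HasCompactSupport ψ) {z : E d}
    (hz : ∀ τ ∈ Set.Icc (0 : ℝ) 1, ∀ x ∈ tsupport ψ, x + τ • z ∈ U) :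
    |(∫ x in U, w.1 x * ψ (x - z)) - ∫ x in U, w.1 x * ψ x|
      ≤ ‖z‖ * ‖w.2‖ * √(∫ x, ψ x ^ 2) := by
  have hint := integrable_fst hvol w.1
  have hshift : ∀ p : E d, ContDiff ℝ ∞ (fun x => ψ (x - p)) := fun p =>
    hψ.comp (contDiff_id.sub contDiff_const)
  have hshiftc : ∀ p : E d, HasCompactSupport (fun x => ψ (x - p)) := fun p =>
    hc.comp_homeomorph (Homeomorph.subRight p)
  obtain ⟨B, hB⟩ := (hc.fderiv (𝕜 := ℝ)).exists_bound_of_continuous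
    (hψ.continuous_fderiv (by simp))
  have hfd : ∀ (p x : E d), fderiv ℝ (fun x => ψ (x - p)) x = fderiv ℝ ψ (x - p) := by
    intro p x
    exact fderiv_comp_sub p
  have hcd : Continuous (fderiv ℝ ψ) := hψ.continuous_fderiv (by simp)
  -- Differentiating in `τ` puts the derivative on the translated test function, and integration by
  -- parts moves it to the weak gradient; `hz` keeps the translated supports inside `U`. The mean
  -- value inequality concludes.
  have hder : ∀ τ₀ : ℝ, HasDerivAt (fun τ : ℝ => ∫ x in U, w.1 x * ψ (x - τ • z))
      (∫ x in U, w.1 x * (fderiv ℝ ψ (x - τ₀ • z) (-z))) τ₀ := by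
    intro τ₀
    refine (hasDerivAt_integral_of_dominated_loc_of_deriv_le
      (F' := fun τ x => w.1 x * (fderiv ℝ ψ (x - τ • z) (-z)))
      (bound := fun x => ‖w.1 x‖ * (B * ‖z‖)) univ_mem ?_ ?_ ?_ ?_ ?_ ?_).2
    · refine .of_forall fun τ => ?_
      exact hint.aestronglyMeasurable.mul (hshift _).continuous.aestronglyMeasurable
    · exact integrable_mul_test _ (hshift _).continuous (hshiftc _)
    · refine hint.aestronglyMeasurable.mul (Continuous.aestronglyMeasurable ?_)
      exact (hcd.comp (continuous_id.sub continuous_const)).clm_apply continuous_const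
    · refine .of_forall fun x τ _ => ?_
      rw [norm_mul]
      gcongr
      refine ((fderiv ℝ ψ (x - τ • z)).le_opNorm (-z)).trans ?_
      rw [norm_neg]
      gcongr
      exact hB _
    · exact hint.norm.mul_const _
    · refine .of_forall fun x τ _ => ?_
      have h1 : HasDerivAt (fun τ : ℝ => x - τ • z) (-z) τ := by
        simpa using ((hasDerivAt_id τ).smul_const z).const_sub x
      exact (((hψ.differentiable (by simp)).differentiableAt.hasFDerivAt).comp_hasDerivAt τ
        h1).const_mul _
  have hbound : ∀ τ ∈ Set.Ico (0 : ℝ) 1,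
      ‖∫ x in U, w.1 x * (fderiv ℝ ψ (x - τ • z) (-z))‖ ≤ ‖z‖ * ‖w.2‖ * √(∫ x, ψ x ^ 2) := by
    intro τ hτ
    have h1 := hw (fun x => ψ (x - τ • z)) (hshift _) (hshiftc _) (by
      intro x hx
      have hx' : x - τ • z ∈ tsupport ψ := by
        have := tsupport_comp_subset_preimage ψ (f := fun x : E d => x - τ • z) (by fun_prop) hx
        exact this
      have := hz τ ⟨hτ.1, hτ.2.le⟩ _ hx'
      rwa [sub_add_cancel] at this) (-z)
    simp only [hfd] at h1
    rw [h1, Real.norm_eq_abs, abs_neg]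
    have hm1 : MemLp (fun x => inner ℝ (w.2 x) (-z)) 2 (volume.restrict U) :=
      (Lp.memLp w.2).inner_const _
    have hm2 : MemLp (fun x => ψ (x - τ • z)) 2 (volume.restrict U) :=
      memLp_test (hshift _).continuous (hshiftc _) _
    refine (abs_integral_mul_le hm1 hm2).trans ?_
    have h2 : √(∫ x in U, inner ℝ (w.2 x) (-z) ^ 2) ≤ ‖z‖ * ‖w.2‖ := by
      apply Real.sqrt_le_iff.2 ⟨by positivity, ?_⟩
      rw [mul_pow, ← integral_norm_sq_eq_norm_sq, ← integral_const_mul]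
      refine integral_mono_of_nonneg (.of_forall fun x => sq_nonneg _)
        ((Lp.memLp w.2).integrable_norm_pow (by norm_num) |>.const_mul _) (.of_forall fun x => ?_)
      have := abs_real_inner_le_norm (w.2 x) (-z)
      rw [norm_neg] at this
      calc inner ℝ (w.2 x) (-z) ^ 2 = |inner ℝ (w.2 x) (-z)| ^ 2 := (sq_abs _).symm
        _ ≤ (‖w.2 x‖ * ‖z‖) ^ 2 := by gcongr
        _ = ‖z‖ ^ 2 * ‖w.2 x‖ ^ 2 := by ring
    have h3 : ∫ x in U, ψ (x - τ • z) ^ 2 ≤ ∫ x, ψ x ^ 2 := by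
      rw [← integral_sub_right_eq_self (fun x => ψ x ^ 2) (τ • z)]
      refine setIntegral_le_integral ?_ (.of_forall fun x => sq_nonneg _)
      have := (memLp_test (hshift (τ • z)).continuous (hshiftc _) volume).integrable_sq
      exact this
    gcongr
  have := norm_image_sub_le_of_norm_deriv_le_segment_01'
    (fun τ _ => (hder τ).hasDerivWithinAt) hbound
  simpa using this

/-- Averages over small translations are close to the function, in duality with test functions. -/
lemma abs_integral_average_sub_le (hvol : volume U ≠ ⊤) {w : PairL2 U} (hw : w ∈ H1 U)
    {κ : E d → ℝ} (hκ : Continuous κ) (hκc : HasCompactSupport κ) (hκ0 : ∀ z, 0 ≤ κ z)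
    (hκ1 : ∫ z, κ z = 1) {ψ : E d → ℝ} (hψ : ContDiff ℝ ∞ ψ) (hc : HasCompactSupport ψ)
    {R : ℝ} (hR : ∀ z, κ z ≠ 0 → ‖z‖ ≤ R)
    (hz : ∀ z, κ z ≠ 0 → ∀ τ ∈ Set.Icc (0 : ℝ) 1, ∀ x ∈ tsupport ψ, x + τ • z ∈ U) :
    |(∫ y, (∫ x in U, w.1 x * κ (x - y)) * ψ y) - ∫ x in U, w.1 x * ψ x|
      ≤ R * ‖w.2‖ * √(∫ x, ψ x ^ 2) := by
  have hint := integrable_fst hvol w.1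
  have hκi : Integrable κ := hκ.integrable_of_hasCompactSupport hκc
  have hψi : Integrable ψ := hψ.continuous.integrable_of_hasCompactSupport hc
  obtain ⟨Bψ, hBψ⟩ := hc.exists_bound_of_continuous hψ.continuous
  obtain ⟨Bκ, hBκ⟩ := hκc.exists_bound_of_continuous hκ
  -- By Fubini and the substitution `z = x - y`, averaging `w` amounts to taking the `κ`-mean of
  -- translates of `ψ`, so the translation estimate applies for each `z`.
  have e1 : ∫ y, (∫ x in U, w.1 x * κ (x - y)) * ψ y
      = ∫ x in U, ∫ y, w.1 x * κ (x - y) * ψ y := by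
    rw [integral_integral_swap]
    · simp only [integral_mul_const]
    · have h1 := (hint.mul_prod hψi).mul_bdd (c := Bκ) (g := fun p : E d × E d => κ (p.1 - p.2))
        (hκ.comp (continuous_fst.sub continuous_snd)).aestronglyMeasurable
        (.of_forall fun p => hBκ _)
      refine h1.congr (.of_forall fun p => ?_)
      simp only [Function.uncurry]
      ring
  have e2 : ∀ x, ∫ y, w.1 x * κ (x - y) * ψ y = ∫ z, w.1 x * κ z * ψ (x - z) := by
    intro x
    rw [← integral_sub_left_eq_self (fun z => w.1 x * κ z * ψ (x - z)) volume x]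
    simp
  have e3 : ∫ x in U, ∫ z, w.1 x * κ z * ψ (x - z)
      = ∫ z, κ z * ∫ x in U, w.1 x * ψ (x - z) := by
    rw [integral_integral_swap]
    · refine integral_congr_ae (.of_forall fun z => ?_)
      simp only
      rw [← integral_const_mul]
      refine integral_congr_ae (.of_forall fun x => ?_)
      simp only
      ring
    · exact (hint.mul_prod hκi).mul_bdd (c := Bψ) (g := fun p : E d × E d => ψ (p.1 - p.2))
        (hψ.continuous.comp (continuous_fst.sub continuous_snd)).aestronglyMeasurable
        (.of_forall fun p => hBψ _)
  have e4 : ∫ x in U, w.1 x * ψ x = ∫ z, κ z * ∫ x in U, w.1 x * ψ x := by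
    rw [integral_mul_const, hκ1, one_mul]
  have hcontF : Continuous (fun z => ∫ x in U, w.1 x * ψ (x - z)) := by
    refine continuous_of_dominated (bound := fun x => ‖w.1 x‖ * Bψ) ?_ ?_ ?_ ?_
    · intro z
      exact hint.aestronglyMeasurable.mul
        (hψ.continuous.comp (continuous_id.sub continuous_const)).aestronglyMeasurable
    · intro z
      refine .of_forall fun x => ?_
      rw [norm_mul]
      gcongr
      exact hBψ _
    · exact hint.norm.mul_const _
    · refine .of_forall fun x => ?_
      have := hψ.continuous
      fun_prop
  have hi1 : Integrable (fun z => κ z * ∫ x in U, w.1 x * ψ (x - z)) :=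
    (hκ.mul hcontF).integrable_of_hasCompactSupport hκc.mul_right
  rw [e1, integral_congr_ae (.of_forall e2), e3, e4, ← integral_sub hi1 (hκi.mul_const _),
    ← Real.norm_eq_abs]
  have e5 : R * ‖w.2‖ * √(∫ x, ψ x ^ 2) = ∫ z, κ z * (R * ‖w.2‖ * √(∫ x, ψ x ^ 2)) := by
    rw [integral_mul_const, hκ1, one_mul]
  rw [e5]
  refine norm_integral_le_of_norm_le (hκi.mul_const _) (.of_forall fun z => ?_)
  by_cases h0 : κ z = 0
  · simp [h0]
  · rw [← mul_sub, norm_mul, Real.norm_of_nonneg (hκ0 z), Real.norm_eq_abs]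
    refine mul_le_mul_of_nonneg_left ?_ (hκ0 z)
    refine (abs_integral_translate_sub_le hvol hw hψ hc (hz z h0)).trans ?_
    gcongr
    exact hR z h0

end TestFunctions

/-! ### The Rellich theorem -/

section Rellich

variable {d : ℕ} {U A : Set (E d)}

/-- The average `∫_U f(x) κ(x - y) dx` of `f` around the point `y`. -/
def average (U : Set (E d)) (κ : E d → ℝ) (f : E d → ℝ) (y : E d) : ℝ :=
  ∫ x in U, f x * κ (x - y)

lemma continuous_average (hvol : volume U ≠ ⊤) (f : Lp ℝ 2 (volume.restrict U)) {κ : E d → ℝ}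
    (hκ : Continuous κ) (hκc : HasCompactSupport κ) : Continuous (average U κ f) := by
  have hint := integrable_fst hvol f
  obtain ⟨B, hB⟩ := hκc.exists_bound_of_continuous hκ
  refine continuous_of_dominated (bound := fun x => ‖f x‖ * B) ?_ ?_ ?_ ?_
  · intro z
    exact hint.aestronglyMeasurable.mul
      (hκ.comp (continuous_id.sub continuous_const)).aestronglyMeasurable
  · intro z
    refine .of_forall fun x => ?_
    rw [norm_mul]
    gcongr
    exact hB _
  · exact hint.norm.mul_const _
  · refine .of_forall fun x => ?_
    fun_prop

lemma memLp_translate {κ : E d → ℝ} (hκ : Continuous κ) (hκc : HasCompactSupport κ) (y : E d)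
    (ν : Measure (E d)) [IsFiniteMeasureOnCompacts ν] : MemLp (fun x => κ (x - y)) 2 ν :=
  memLp_test (hκ.comp (continuous_id.sub continuous_const))
    (hκc.comp_homeomorph (Homeomorph.subRight y)) ν

lemma abs_average_le (f : Lp ℝ 2 (volume.restrict U)) {κ : E d → ℝ}
    (hκ : Continuous κ) (hκc : HasCompactSupport κ) (y : E d) :
    |average U κ f y| ≤ ‖f‖ * √(∫ x, κ x ^ 2) := by
  refine (abs_integral_mul_le (Lp.memLp f) (memLp_translate hκ hκc y _)).trans ?_
  rw [integral_sq_eq_norm_sq, Real.sqrt_sq (norm_nonneg f)]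
  gcongr
  rw [← integral_sub_right_eq_self (fun x => κ x ^ 2) y]
  exact setIntegral_le_integral (memLp_translate hκ hκc y volume).integrable_sq
    (.of_forall fun x => sq_nonneg _)

lemma memLp_average (hvol : volume U ≠ ⊤) (hA : A ⊆ U) (f : Lp ℝ 2 (volume.restrict U))
    {κ : E d → ℝ} (hκ : Continuous κ) (hκc : HasCompactSupport κ) :
    MemLp (average U κ f) 2 (volume.restrict A) := by
  have : IsFiniteMeasure (volume.restrict A) :=
    isFiniteMeasure_restrict.2 ((measure_mono hA).trans_lt (lt_top_iff_ne_top.2 hvol)).ne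
  exact MemLp.of_bound (continuous_average hvol f hκ hκc).aestronglyMeasurable _
    (.of_forall fun y => abs_average_le f hκ hκc y)

lemma memLp_of_subset (hA : A ⊆ U) {F : Type*} [NormedAddCommGroup F]
    (f : Lp F 2 (volume.restrict U)) : MemLp f 2 (volume.restrict A) :=
  (Lp.memLp f).mono_measure (Measure.restrict_mono hA le_rfl)

/-- Averages over small translations are close to the function in `L²`. -/
lemma integral_average_sub_sq_le (hvol : volume U ≠ ⊤) (hA : IsOpen A) (hAU : A ⊆ U)
    {w : PairL2 U} (hw : w ∈ H1 U)
    {κ : E d → ℝ} (hκ : Continuous κ) (hκc : HasCompactSupport κ) (hκ0 : ∀ z, 0 ≤ κ z)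
    (hκ1 : ∫ z, κ z = 1) {R : ℝ} (hR0 : 0 ≤ R) (hR : ∀ z, κ z ≠ 0 → ‖z‖ ≤ R)
    (hz : ∀ z, κ z ≠ 0 → ∀ τ ∈ Set.Icc (0 : ℝ) 1, ∀ x ∈ A, x + τ • z ∈ U) :
    ∫ y in A, (average U κ w.1 y - w.1 y) ^ 2 ≤ (R * ‖w.2‖) ^ 2 := by
  have hm := memLp_average hvol hAU w.1 hκ hκc
  refine integral_sq_le_of_forall_test hA (hm.sub (memLp_of_subset hAU w.1))
    (by positivity) (fun ψ hψ hc hs => ?_)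
  have hψm := memLp_test hψ.continuous hc (volume.restrict A)
  have e1 : ∫ y in A, (average U κ w.1 y - w.1 y) * ψ y
      = (∫ y, (∫ x in U, w.1 x * κ (x - y)) * ψ y) - ∫ x in U, w.1 x * ψ x := by
    have hz0 : ∀ y ∉ A, ψ y = 0 := fun y hy =>
      image_eq_zero_of_notMem_tsupport (fun h => hy (hs h))
    simp only [sub_mul]
    rw [integral_sub (f := fun y => average U κ w.1 y * ψ y) (g := fun y => w.1 y * ψ y)
      (hm.integrable_mul hψm) ((memLp_of_subset hAU w.1).integrable_mul hψm)]
    congr 1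
    · rw [setIntegral_eq_integral_of_forall_compl_eq_zero]
      · rfl
      · intro y hy
        rw [hz0 y hy, mul_zero]
    · rw [setIntegral_eq_integral_of_forall_compl_eq_zero,
        setIntegral_eq_integral_of_forall_compl_eq_zero]
      · intro y hy
        rw [hz0 y (fun h => hy (hAU h)), mul_zero]
      · intro y hy
        rw [hz0 y hy, mul_zero]
  have := abs_integral_average_sub_le hvol hw hκ hκc hκ0 hκ1 hψ hc hR
    (fun z h τ hτ x hx => hz z h τ hτ x (hs hx))
  rwa [← e1] at this

/-- Local form of the Rellich theorem, near a point where the domain satisfies a cone condition. -/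
lemma tendsto_integral_sq_of_cone (hvol : volume U ≠ ⊤) (hA : IsOpen A) (hAU : A ⊆ U)
    {e : E d} {r : ℝ} (hr : 0 < r)
    (hcone : ∀ y ∈ A, ∀ z ∈ Metric.ball e r, ∀ s : ℝ, 0 < s → s ≤ 1 → y + s • z ∈ U)
    {w : ℕ → PairL2 U} (hw : ∀ n, w n ∈ H1 U) {C : ℝ} (hC1 : ∀ n, ‖(w n).1‖ ≤ C)
    (hC2 : ∀ n, ‖(w n).2‖ ≤ C)
    (hweak : ∀ h : Lp ℝ 2 (volume.restrict U),
      Tendsto (fun n => inner ℝ (w n).1 h) atTop (𝓝 0)) :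
    Tendsto (fun n => ∫ x in A, (w n).1 x ^ 2) atTop (𝓝 0) := by
  have hC0 : 0 ≤ C := (norm_nonneg _).trans (hC1 0)
  have : IsFiniteMeasure (volume.restrict A) :=
    isFiniteMeasure_restrict.2 ((measure_mono hAU).trans_lt (lt_top_iff_ne_top.2 hvol)).ne
  rw [tendsto_order]
  refine ⟨fun δ hδ => .of_forall fun n =>
    hδ.trans_le (integral_nonneg fun x => sq_nonneg _), fun δ hδ => ?_⟩
  -- Displacements of size at most `s * (‖e‖ + r)` cause an averaging error of at most this length
  -- times `C` in `L²`; the factor 2 comes from splitting the square below.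
  obtain ⟨s, hs0, hs1, hsδ⟩ : ∃ s : ℝ, 0 < s ∧ s ≤ 1 ∧ 2 * (s * (‖e‖ + r) * C) ^ 2 < δ / 2 := by
    have hcont : Tendsto (fun s : ℝ => 2 * (s * (‖e‖ + r) * C) ^ 2) (𝓝[>] 0) (𝓝 0) := by
      have : Continuous (fun s : ℝ => 2 * (s * (‖e‖ + r) * C) ^ 2) := by fun_prop
      have h1 := this.tendsto 0
      simp only [zero_mul, ne_eq, OfNat.ofNat_ne_zero, not_false_eq_true, zero_pow,
        mul_zero] at h1
      exact h1.mono_left nhdsWithin_le_nhds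
    have h2 : Set.Ioc (0 : ℝ) 1 ∈ 𝓝[>] (0 : ℝ) := Ioc_mem_nhdsGT zero_lt_one
    obtain ⟨s, h3, h4⟩ := ((hcont.eventually_lt_const (half_pos hδ)).and h2).exists
    exact ⟨s, h4.1, h4.2, h3⟩
  -- The kernel is centred at `s • e`, not at the origin, so that all displacements it uses lie in
  -- the scaled cone and lead from `A` into `U`, even next to the boundary.
  let f : ContDiffBump (s • e) := ⟨s * r / 4, s * r / 2, by positivity, by
    have : 0 < s * r := by positivity
    linarith⟩
  set κ := f.normed volume with hκdef
  have hκ : Continuous κ := f.continuous_normed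
  have hκc : HasCompactSupport κ := f.hasCompactSupport_normed
  have hκz : ∀ z, κ z ≠ 0 → ∃ z' ∈ Metric.ball e r, z = s • z' := by
    intro z h
    have hzb : z ∈ Metric.ball (s • e) (s * r / 2) := by
      have : z ∈ Function.support κ := h
      rwa [hκdef, f.support_normed_eq] at this
    refine ⟨s⁻¹ • z, ?_, by rw [smul_smul, mul_inv_cancel₀ hs0.ne', one_smul]⟩
    rw [Metric.mem_ball, dist_eq_norm] at hzb ⊢
    have h1 : s⁻¹ • z - e = s⁻¹ • (z - s • e) := by
      rw [smul_sub, smul_smul, inv_mul_cancel₀ hs0.ne', one_smul]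
    rw [h1, norm_smul, norm_inv, Real.norm_of_nonneg hs0.le, inv_mul_lt_iff₀ hs0]
    have : 0 < s * r := by positivity
    linarith
  have hR : ∀ z, κ z ≠ 0 → ‖z‖ ≤ s * (‖e‖ + r) := by
    intro z h
    obtain ⟨z', hz', rfl⟩ := hκz z h
    rw [norm_smul, Real.norm_of_nonneg hs0.le]
    rw [Metric.mem_ball, dist_eq_norm] at hz'
    gcongr
    linarith [norm_le_norm_add_norm_sub' z' e]
  have hseg : ∀ z, κ z ≠ 0 → ∀ τ ∈ Set.Icc (0 : ℝ) 1, ∀ x ∈ A, x + τ • z ∈ U := by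
    intro z h τ hτ x hx
    obtain ⟨z', hz', rfl⟩ := hκz z h
    rcases hτ.1.eq_or_lt with h0 | h0
    · rw [← h0, zero_smul, add_zero]; exact hAU hx
    · rw [smul_smul]
      exact hcone x hx z' hz' _ (by positivity) (mul_le_one₀ hτ.2 hs0.le hs1)
  -- For a fixed kernel, weak convergence makes the averages tend to zero at every point, and they
  -- are uniformly bounded.
  have hT : Tendsto (fun n => ∫ y in A, average U κ (w n).1 y ^ 2) atTop (𝓝 0) := by
    have h0 : (0 : ℝ) = ∫ y in A, (0 : ℝ) := by simp
    rw [h0]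
    refine tendsto_integral_of_dominated_convergence (fun _ => (C * √(∫ x, κ x ^ 2)) ^ 2)
      (fun n => (((continuous_average hvol (w n).1 hκ hκc).pow 2).aestronglyMeasurable))
      (integrable_const _) (fun n => .of_forall fun y => ?_) (.of_forall fun y => ?_)
    · rw [norm_pow, Real.norm_eq_abs]
      gcongr
      refine (abs_average_le (w n).1 hκ hκc y).trans ?_
      gcongr
      exact hC1 n
    · have h1 := (hweak ((memLp_translate hκ hκc y _).toLp _)).pow 2
      simp only [← integral_mul_eq_inner, ne_eq, OfNat.ofNat_ne_zero, not_false_eq_true,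
        zero_pow] at h1
      exact h1
  have hT2 : ∀ᶠ n in atTop, 2 * ∫ y in A, average U κ (w n).1 y ^ 2 < δ / 2 := by
    have h1 := hT.const_mul 2
    rw [mul_zero] at h1
    exact h1.eventually_lt_const (half_pos hδ)
  filter_upwards [hT2] with n hn
  have hm := memLp_average hvol hAU (w n).1 hκ hκc
  have hmu := memLp_of_subset hAU (w n).1
  have hsub : Integrable (fun y => 2 * (average U κ (w n).1 y - (w n).1 y) ^ 2)
      (volume.restrict A) := (hm.sub hmu).integrable_sq.const_mul 2
  have h1 : ∫ x in A, (w n).1 x ^ 2 ≤ ∫ y in A, (2 * (average U κ (w n).1 y - (w n).1 y) ^ 2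
      + 2 * average U κ (w n).1 y ^ 2) := by
    refine integral_mono hmu.integrable_sq
      (hsub.add (hm.integrable_sq.const_mul 2)) (fun y => ?_)
    simp only
    nlinarith [sq_nonneg (2 * average U κ (w n).1 y - (w n).1 y)]
  rw [integral_add hsub (hm.integrable_sq.const_mul 2),
    integral_const_mul, integral_const_mul] at h1
  have h2 := integral_average_sub_sq_le hvol hA hAU (hw n) hκ hκc
    (fun z => f.nonneg_normed z) f.integral_normed (by positivity) hR hseg
  have h3 : (s * (‖e‖ + r) * ‖(w n).2‖) ^ 2 ≤ (s * (‖e‖ + r) * C) ^ 2 := by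
    gcongr
    exact hC2 n
  linarith

/-- The Rellich theorem: weakly convergent sequences in `H¹` converge strongly in `L²`. -/
lemma IsSmoothBoundedDomain.tendsto_norm_of_weak (hU : IsSmoothBoundedDomain U)
    {w : ℕ → PairL2 U} (hw : ∀ n, w n ∈ H1 U) {C : ℝ} (hC1 : ∀ n, ‖(w n).1‖ ≤ C)
    (hC2 : ∀ n, ‖(w n).2‖ ≤ C)
    (hweak : ∀ h : Lp ℝ 2 (volume.restrict U),
      Tendsto (fun n => inner ℝ (w n).1 h) atTop (𝓝 0)) :
    Tendsto (fun n => ‖(w n).1‖) atTop (𝓝 0) := by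
  have hvol : volume U ≠ ⊤ := hU.volume_lt_top.ne
  have hi : ∀ (S : Set (E d)) n, Integrable (fun x => (w n).1 x ^ 2) (volume.restrict (U ∩ S)) :=
    fun S n => (memLp_of_subset Set.inter_subset_left _).integrable_sq
  have key : Tendsto (fun n => ∫ x in U ∩ closure U, (w n).1 x ^ 2) atTop (𝓝 0) := by
    -- Vanishing of the mass in the limit is inherited by subsets and finite unions, so by
    -- compactness of the closure the local version suffices.
    refine (hU.isBounded.isCompact_closure).induction_on
      (p := fun S => Tendsto (fun n => ∫ x in U ∩ S, (w n).1 x ^ 2) atTop (𝓝 0)) ?_ ?_ ?_ ?_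
    · simp
    · intro S T hST hT
      refine squeeze_zero (fun n => integral_nonneg fun x => sq_nonneg _) (fun n => ?_) hT
      exact setIntegral_mono_set (hi T n) (.of_forall fun x => sq_nonneg _)
        (Set.inter_subset_inter_right U hST).eventuallyLE
    · intro S T hS hT
      have := hS.add hT
      rw [add_zero] at this
      refine squeeze_zero (fun n => integral_nonneg fun x => sq_nonneg _) (fun n => ?_) this
      rw [Set.inter_union_distrib_left, ← integral_add_measure (hi S n) (hi T n)]
      exact integral_mono_measure (Measure.restrict_union_le _ _) (.of_forall fun x => sq_nonneg _)
        ((hi S n).add_measure (hi T n))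
    · intro x hx
      obtain ⟨W, hW, hxW, e, r, hr, hcone⟩ := hU.exists_cone hx
      refine ⟨W, mem_nhdsWithin_of_mem_nhds (hW.mem_nhds hxW), ?_⟩
      exact tendsto_integral_sq_of_cone hvol (hU.isOpen.inter hW) Set.inter_subset_left hr
        (fun y hy => hcone y hy.2 (subset_closure hy.1)) hw hC1 hC2 hweak
  rw [Set.inter_eq_left.2 subset_closure] at key
  simp only [integral_sq_eq_norm_sq] at key
  have := key.sqrt
  simpa [Real.sqrt_sq (norm_nonneg _)] using this

end Rellich

/-! ### Compactness, constancy and dimension in Sobolev spaces -/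

section SobolevSpace

variable {d : ℕ} {U V A : Set (E d)}

lemma massForm_apply (h : A ⊆ U) (w z : PairL2 U) : massForm h w z = ∫ x in A, w.1 x * z.1 x := rfl

lemma gradForm_apply (h : A ⊆ U) (w z : PairL2 U) :
    gradForm h w z = ∫ x in A, inner ℝ (w.2 x) (z.2 x) := rfl

lemma massForm_self (h : A ⊆ U) (w : PairL2 U) : massForm h w w = ∫ x in A, w.1 x ^ 2 := by
  simp only [massForm_apply, sq]

lemma gradForm_self (h : A ⊆ U) (w : PairL2 U) : gradForm h w w = ∫ x in A, ‖w.2 x‖ ^ 2 := by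
  simp only [gradForm_apply, real_inner_self_eq_norm_sq]

lemma massForm_symm (h : A ⊆ U) (w z : PairL2 U) : massForm h w z = massForm h z w := by
  simp only [massForm_apply, mul_comm]

lemma gradForm_symm (h : A ⊆ U) (w z : PairL2 U) : gradForm h w z = gradForm h z w := by
  simp only [gradForm_apply, real_inner_comm]

lemma massForm_nonneg (h : A ⊆ U) (w : PairL2 U) : 0 ≤ massForm h w w := by
  rw [massForm_self]; exact integral_nonneg fun x => sq_nonneg _

lemma gradForm_nonneg (h : A ⊆ U) (w : PairL2 U) : 0 ≤ gradForm h w w := by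
  rw [gradForm_self]; exact integral_nonneg fun x => sq_nonneg _

lemma massForm_self_eq_norm (w : PairL2 U) : massForm subset_rfl w w = ‖w.1‖ ^ 2 := by
  rw [massForm_self, integral_sq_eq_norm_sq]

lemma gradForm_self_eq_norm (w : PairL2 U) : gradForm subset_rfl w w = ‖w.2‖ ^ 2 := by
  rw [gradForm_self, integral_norm_sq_eq_norm_sq]

lemma massForm_self_le (h : A ⊆ U) (w : PairL2 U) : massForm h w w ≤ ‖w.1‖ ^ 2 := by
  rw [massForm_self, ← integral_sq_eq_norm_sq]
  exact setIntegral_mono_set (Lp.memLp w.1).integrable_sq (.of_forall fun x => sq_nonneg _)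
    h.eventuallyLE

lemma integral_inner_eq_inner {μ : Measure (E d)} (f : Lp (E d) 2 μ) {h : E d → E d}
    (hh : MemLp h 2 μ) : ∫ x, inner ℝ (f x) (h x) ∂μ = inner ℝ f (hh.toLp h) := by
  rw [L2.inner_def]
  refine integral_congr_ae ?_
  filter_upwards [hh.coeFn_toLp] with x hx
  rw [hx]

lemma restrict_restrict_subset (hA : MeasurableSet A) (h : A ⊆ U) :
    (volume.restrict U).restrict A = volume.restrict A := by
  rw [Measure.restrict_restrict hA, Set.inter_eq_left.2 h]

/-- Weak convergence of gradients in `L²(U)` passes to the forms on subsets. -/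
lemma tendsto_gradForm (hA : MeasurableSet A) (h : A ⊆ U) {w : ℕ → PairL2 U} {w₀ : PairL2 U}
    (hw : ∀ q : Lp (E d) 2 (volume.restrict U),
      Tendsto (fun k => inner ℝ (w k).2 q) atTop (𝓝 (inner ℝ w₀.2 q))) (φ : PairL2 U) :
    Tendsto (fun k => gradForm h (w k) φ) atTop (𝓝 (gradForm h w₀ φ)) := by
  have hm : MemLp (A.indicator φ.2) 2 (volume.restrict U) := (Lp.memLp φ.2).indicator hA
  have key : ∀ z : PairL2 U, gradForm h z φ = inner ℝ z.2 (hm.toLp _) := by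
    intro z
    rw [← integral_inner_eq_inner, gradForm_apply, ← restrict_restrict_subset hA h,
      ← integral_indicator hA]
    refine integral_congr_ae (.of_forall fun x => ?_)
    by_cases hx : x ∈ A <;> simp [hx]
  simp only [key]
  exact hw _

/-- Integration by parts is preserved by weak limits. -/
lemma mem_partsSpace_of_weak {w : ℕ → PairL2 U} {w₀ : PairL2 U} (hw : ∀ k, w k ∈ partsSpace U V)
    (h1 : ∀ q : Lp ℝ 2 (volume.restrict U),
      Tendsto (fun k => inner ℝ (w k).1 q) atTop (𝓝 (inner ℝ w₀.1 q)))
    (h2 : ∀ q : Lp (E d) 2 (volume.restrict U),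
      Tendsto (fun k => inner ℝ (w k).2 q) atTop (𝓝 (inner ℝ w₀.2 q))) :
    w₀ ∈ partsSpace U V := by
  intro φ hφ hc hs v
  have hm1 : MemLp (fun x => fderiv ℝ φ x v) 2 (volume.restrict U) :=
    memLp_test (continuous_fderiv_test hφ v) (hasCompactSupport_fderiv_test hc v) _
  have hm2 : MemLp (fun x => φ x • v) 2 (volume.restrict U) :=
    (hφ.continuous.smul continuous_const).memLp_of_hasCompactSupport hc.smul_right
  have key : ∀ z : PairL2 U, ∫ x in U, inner ℝ (z.2 x) v * φ x = inner ℝ z.2 (hm2.toLp _) := by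
    intro z
    rw [← integral_inner_eq_inner]
    refine integral_congr_ae (.of_forall fun x => ?_)
    simp only
    rw [real_inner_smul_right, mul_comm]
  rw [integral_mul_eq_inner _ hm1, key]
  refine tendsto_nhds_unique (h1 _) ?_
  refine (h2 (hm2.toLp _)).neg.congr (fun k => ?_)
  rw [← key, ← integral_mul_eq_inner _ hm1]
  exact (hw k φ hφ hc hs v).symm

/-- A subspace which is closed under weak limits and satisfies the conclusion of the Rellich theorem
has relatively compact bounded sequences, strongly in `L²` and weakly for the gradients. -/
lemma exists_convergent_subseq (S : Submodule ℝ (PairL2 U))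
    (hclosed : ∀ (w : ℕ → PairL2 U) (w₀ : PairL2 U), (∀ k, w k ∈ S) →
      (∀ q, Tendsto (fun k => inner ℝ (w k).1 q) atTop (𝓝 (inner ℝ w₀.1 q))) →
      (∀ q, Tendsto (fun k => inner ℝ (w k).2 q) atTop (𝓝 (inner ℝ w₀.2 q))) → w₀ ∈ S)
    (hrellich : ∀ (w : ℕ → PairL2 U) (C : ℝ), (∀ k, w k ∈ S) → (∀ k, ‖(w k).1‖ ≤ C) →
      (∀ k, ‖(w k).2‖ ≤ C) → (∀ q, Tendsto (fun k => inner ℝ (w k).1 q) atTop (𝓝 0)) →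
      Tendsto (fun k => ‖(w k).1‖) atTop (𝓝 0))
    {w : ℕ → PairL2 U} (hw : ∀ n, w n ∈ S) {C : ℝ} (hC1 : ∀ n, ‖(w n).1‖ ≤ C)
    (hC2 : ∀ n, ‖(w n).2‖ ≤ C) :
    ∃ s : ℕ → ℕ, StrictMono s ∧ ∃ w₀ ∈ S,
      Tendsto (fun k => ‖(w (s k)).1 - w₀.1‖) atTop (𝓝 0) ∧
      ∀ q : Lp (E d) 2 (volume.restrict U),
        Tendsto (fun k => inner ℝ (w (s k)).2 q) atTop (𝓝 (inner ℝ w₀.2 q)) := by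
  have : Fact ((2 : ENNReal) ≠ ⊤) := ⟨by simp⟩
  obtain ⟨s₁, hs₁, u, hu⟩ := exists_weakly_convergent_subseq hC1
  obtain ⟨s₂, hs₂, g, hg⟩ := exists_weakly_convergent_subseq (x := fun k => (w (s₁ k)).2)
    (fun k => hC2 (s₁ k))
  have hu2 : ∀ q, Tendsto (fun k => inner ℝ (w (s₁ (s₂ k))).1 q) atTop (𝓝 (inner ℝ u q)) :=
    fun q => (hu q).comp hs₂.tendsto_atTop
  have hmem : (u, g) ∈ S := hclosed (fun k => w (s₁ (s₂ k))) _ (fun k => hw _) hu2 hg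
  refine ⟨s₁ ∘ s₂, hs₁.comp hs₂, (u, g), hmem, ?_, hg⟩
  refine hrellich (fun k => w (s₁ (s₂ k)) - (u, g)) (C + ‖u‖ + ‖g‖)
    (fun k => S.sub_mem (hw _) hmem) (fun k => ?_) (fun k => ?_) (fun q => ?_)
  · refine (norm_sub_le _ _).trans ?_
    linarith [hC1 (s₁ (s₂ k)), norm_nonneg g]
  · refine (norm_sub_le _ _).trans ?_
    linarith [hC2 (s₁ (s₂ k)), norm_nonneg u]
  · have := (hu2 q).sub_const (inner ℝ u q)
    rw [sub_self] at this
    refine this.congr (fun k => ?_)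
    rw [Prod.fst_sub, inner_sub_left]

/-- Bounded sequences in `H¹` of a smooth domain are relatively compact, strongly in `L²` and weakly
for the gradients. -/
lemma IsSmoothBoundedDomain.exists_convergent_subseq (hU : IsSmoothBoundedDomain U)
    {w : ℕ → PairL2 U} (hw : ∀ n, w n ∈ H1 U) {C : ℝ} (hC1 : ∀ n, ‖(w n).1‖ ≤ C)
    (hC2 : ∀ n, ‖(w n).2‖ ≤ C) :
    ∃ s : ℕ → ℕ, StrictMono s ∧ ∃ w₀ ∈ H1 U,
      Tendsto (fun k => ‖(w (s k)).1 - w₀.1‖) atTop (𝓝 0) ∧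
      ∀ q : Lp (E d) 2 (volume.restrict U),
        Tendsto (fun k => inner ℝ (w (s k)).2 q) atTop (𝓝 (inner ℝ w₀.2 q)) :=
  StiffNeumann.exists_convergent_subseq (H1 U)
    (fun _ _ => mem_partsSpace_of_weak)
    (fun _ _ h h1 h2 h3 => hU.tendsto_norm_of_weak h h1 h2 h3) hw hC1 hC2

/-- The weak gradient is determined by the function. -/
lemma snd_eq_zero_of_fst_eq_zero (hU : IsOpen U) {w : PairL2 U} (hw : w ∈ H1 U)
    (h0 : w.1 =ᵐ[volume.restrict U] 0) : w.2 =ᵐ[volume.restrict U] 0 := by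
  have h1 : ∀ᵐ x, x ∈ U → w.2 x = 0 := by
    refine hU.ae_eq_zero_of_integral_contDiff_smul_eq_zero ?_ ?_
    · exact locallyIntegrableOn_of_locallyIntegrable_restrict
        ((Lp.memLp w.2).locallyIntegrable (by norm_num))
    · intro φ hφ hc hs
      have hφi : Integrable (fun x => φ x • w.2 x) (volume.restrict U) :=
        memLp_one_iff_integrable.1
          ((Lp.memLp w.2).smul (memLp_test hφ.continuous hc (volume.restrict U)))
      have e1 : ∫ x, φ x • w.2 x = ∫ x in U, φ x • w.2 x := by
        rw [setIntegral_eq_integral_of_forall_compl_eq_zero]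
        intro x hx
        rw [image_eq_zero_of_notMem_tsupport (fun h => hx (hs h)), zero_smul]
      rw [e1]
      refine ext_inner_right ℝ (fun v => ?_)
      rw [inner_zero_left, real_inner_comm, ← integral_inner hφi]
      have h2 := hw φ hφ hc hs v
      have h3 : ∫ x in U, w.1 x * fderiv ℝ φ x v = 0 := by
        refine integral_eq_zero_of_ae ?_
        filter_upwards [h0] with x hx
        rw [hx]; simp
      rw [h3, eq_comm, neg_eq_zero] at h2
      rw [← h2]
      refine integral_congr_ae (.of_forall fun x => ?_)
      simp only
      rw [real_inner_smul_right, real_inner_comm, mul_comm]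
  exact (ae_restrict_iff' hU.measurableSet).2 h1

lemma eq_zero_of_fst_eq_zero (hU : IsOpen U) {w : PairL2 U} (hw : w ∈ H1 U)
    (h0 : w.1 =ᵐ[volume.restrict U] 0) : w = 0 := by
  refine Prod.ext ?_ ?_
  · rw [Prod.fst_zero, Lp.ext_iff]
    exact h0.trans (Lp.coeFn_zero ℝ 2 (volume.restrict U)).symm
  · rw [Prod.snd_zero, Lp.ext_iff]
    exact (snd_eq_zero_of_fst_eq_zero hU hw h0).trans
      (Lp.coeFn_zero (E d) 2 (volume.restrict U)).symm

/-- A function with zero weak gradient is locally constant. -/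
lemma exists_ball_ae_eq_const (hU : IsOpen U) (hvol : volume U ≠ ⊤) {w : PairL2 U}
    (hw : w ∈ H1 U) (h0 : w.2 = 0) {x₀ : E d} (hx₀ : x₀ ∈ U) :
    ∃ R > 0, ∃ c : ℝ, ∀ᵐ y, y ∈ Metric.ball x₀ R → w.1 y = c := by
  obtain ⟨R', hR', hball⟩ := Metric.isOpen_iff.1 hU x₀ hx₀
  set R := R' / 2 with hRdef
  have hR : 0 < R := by positivity
  have hAU : Metric.ball x₀ R ⊆ U := (Metric.ball_subset_ball (by linarith)).trans hball
  have hadd : ∀ x ∈ Metric.ball x₀ R, ∀ z, ‖z‖ ≤ R → x + z ∈ U := by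
    intro x hx z hz
    refine hball ?_
    rw [Metric.mem_ball, dist_eq_norm] at *
    calc ‖x + z - x₀‖ = ‖(x - x₀) + z‖ := by congr 1; abel
      _ ≤ ‖x - x₀‖ + ‖z‖ := norm_add_le _ _
      _ < R' := by linarith
  let f : ContDiffBump (0 : E d) := ⟨R / 4, R / 2, by positivity, by linarith⟩
  set κ := f.normed volume with hκdef
  have hκ : Continuous κ := f.continuous_normed
  have hκs : ContDiff ℝ ∞ κ := f.contDiff_normed
  have hκc : HasCompactSupport κ := f.hasCompactSupport_normed
  have hκt : ∀ z ∈ tsupport κ, ‖z‖ ≤ R := by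
    intro z hz
    rw [hκdef, f.tsupport_normed_eq, mem_closedBall_zero_iff] at hz
    have : f.rOut = R / 2 := rfl
    linarith
  -- With zero gradient the averaging error is zero, so the function equals its average on the ball.
  -- For the same reason the average does not change when its centre moves from `x₀` to `y`.
  have h1 := integral_average_sub_sq_le hvol Metric.isOpen_ball hAU hw hκ hκc
    (fun z => f.nonneg_normed z) f.integral_normed hR.le
    (fun z hz => hκt z (subset_tsupport _ hz))
    (fun z hz τ hτ x hx => hadd x hx _ (by
      rw [norm_smul, Real.norm_of_nonneg hτ.1]
      exact (mul_le_of_le_one_left (norm_nonneg z) hτ.2).trans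
        (hκt z (subset_tsupport _ hz))))
  rw [h0, norm_zero, mul_zero, zero_pow (by norm_num)] at h1
  have hconst : ∀ y ∈ Metric.ball x₀ R, average U κ w.1 y = average U κ w.1 x₀ := by
    intro y hy
    have h2 := abs_integral_translate_sub_le hvol hw (ψ := fun x => κ (x - x₀)) (z := y - x₀)
      (hκs.comp (contDiff_id.sub contDiff_const))
      (hκc.comp_homeomorph (Homeomorph.subRight x₀)) (by
        intro τ hτ x hx
        have hx' := tsupport_comp_subset_preimage κ (f := fun x : E d => x - x₀) (by fun_prop) hx
        have h3 := hκt _ hx'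
        have h4 : x₀ + τ • (y - x₀) ∈ Metric.ball x₀ R := by
          rw [Metric.mem_ball, dist_eq_norm] at hy ⊢
          rw [add_sub_cancel_left, norm_smul, Real.norm_of_nonneg hτ.1]
          exact (mul_le_of_le_one_left (norm_nonneg _) hτ.2).trans_lt hy
        have h5 := hadd _ h4 _ h3
        have h6 : x₀ + τ • (y - x₀) + (x - x₀) = x + τ • (y - x₀) := by abel
        exact h6 ▸ h5)
    rw [h0, norm_zero, mul_zero, zero_mul] at h2
    have h3 := abs_eq_zero.1 (le_antisymm h2 (abs_nonneg _))
    have h4 : ∀ x, x - (y - x₀) - x₀ = x - y := fun x => by abel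
    simp only [h4] at h3
    exact sub_eq_zero.1 h3
  refine ⟨R, hR, average U κ w.1 x₀, ?_⟩
  have hm := (memLp_average hvol hAU w.1 hκ hκc).sub (memLp_of_subset hAU w.1)
  have h2 := (integral_eq_zero_iff_of_nonneg (fun x => sq_nonneg _) hm.integrable_sq).1
    (le_antisymm h1 (integral_nonneg fun x => sq_nonneg _))
  filter_upwards [(ae_restrict_iff' measurableSet_ball).1 h2] with y hy hyb
  have h3 : (average U κ w.1 y - w.1 y) ^ 2 = 0 := hy hyb
  rw [← hconst y hyb]
  exact (sub_eq_zero.1 (pow_eq_zero_iff (by norm_num) |>.1 h3)).symm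

/-- On a connected set a function with zero weak gradient is constant. -/
lemma exists_ae_eq_const (hU : IsOpen U) (hconn : IsConnected U) (hvol : volume U ≠ ⊤)
    {w : PairL2 U} (hw : w ∈ H1 U) (h0 : w.2 = 0) :
    ∃ c : ℝ, w.1 =ᵐ[volume.restrict U] fun _ => c := by
  -- The sets `P c` are open, pairwise disjoint and cover `U`; connectedness leaves only one of
  -- them.
  let P : ℝ → Set (E d) := fun c => {x | ∃ O, IsOpen O ∧ x ∈ O ∧ ∀ᵐ y, y ∈ O → w.1 y = c}
  have hPo : ∀ c, IsOpen (P c) := by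
    intro c
    rw [isOpen_iff_forall_mem_open]
    rintro x ⟨O, hO, hxO, hO'⟩
    exact ⟨O, fun y hy => ⟨O, hO, hy, hO'⟩, hO, hxO⟩
  have hPU : ∀ x ∈ U, ∃ c, x ∈ P c := by
    intro x hx
    obtain ⟨R, hR, c, hc⟩ := exists_ball_ae_eq_const hU hvol hw h0 hx
    exact ⟨c, Metric.ball x R, Metric.isOpen_ball, Metric.mem_ball_self hR, hc⟩
  have hPd : ∀ c c' x, x ∈ P c → x ∈ P c' → c = c' := by
    rintro c c' x ⟨O, hO, hxO, h1⟩ ⟨O', hO', hxO', h2⟩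
    by_contra hne
    have hpos := (hO.inter hO').measure_pos volume ⟨x, hxO, hxO'⟩
    have hnull : volume (O ∩ O') = 0 := by
      refine measure_mono_null ?_ (h1.and h2)
      intro y hy hy'
      exact hne ((hy'.1 hy.1).symm.trans (hy'.2 hy.2))
    exact hpos.ne' hnull
  obtain ⟨x₀, hx₀⟩ := hconn.nonempty
  obtain ⟨c, hc⟩ := hPU x₀ hx₀
  refine ⟨c, ?_⟩
  have hsub : U ⊆ P c := by
    refine hconn.isPreconnected.subset_left_of_subset_union (hPo c)
      (isOpen_iUnion fun c' => isOpen_iUnion fun _ : c' ≠ c => hPo c') ?_ ?_ ⟨x₀, hx₀, hc⟩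
    · rw [Set.disjoint_left]
      intro x hx hx'
      simp only [Set.mem_iUnion] at hx'
      obtain ⟨c', hne, hx'⟩ := hx'
      exact hne (hPd c' c x hx' hx)
    · intro x hx
      obtain ⟨c', hc'⟩ := hPU x hx
      by_cases h : c' = c
      · exact Or.inl (h ▸ hc')
      · exact Or.inr (Set.mem_iUnion₂.2 ⟨c', h, hc'⟩)
  rw [Filter.EventuallyEq, ae_restrict_iff' hU.measurableSet]
  have : volume {x | ¬(x ∈ U → w.1 x = c)} = 0 := by
    refine measure_null_of_locally_null _ (fun x hx => ?_)
    have hxU : x ∈ U := by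
      by_contra h
      exact hx (fun h' => absurd h' h)
    obtain ⟨O, hO, hxO, h1⟩ := hsub hxU
    refine ⟨O ∩ {x | ¬(x ∈ U → w.1 x = c)},
      inter_mem (mem_nhdsWithin_of_mem_nhds (hO.mem_nhds hxO)) self_mem_nhdsWithin, ?_⟩
    refine measure_mono_null ?_ h1
    intro y hy hy'
    exact hy.2 (fun _ => hy' hy.1)
  exact this

lemma partsSpace_anti (h : A ⊆ V) : partsSpace U V ≤ partsSpace U A :=
  fun _ hw φ hφ hc hs v => hw φ hφ hc (hs.trans h) v

lemma integral_fderiv_test {φ : E d → ℝ} (hφ : ContDiff ℝ ∞ φ) (hc : HasCompactSupport φ)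
    (v : E d) : ∫ x, fderiv ℝ φ x v = 0 := by
  have h1 : Integrable (fun x => fderiv ℝ φ x v) :=
    (continuous_fderiv_test hφ v).integrable_of_hasCompactSupport
      (hasCompactSupport_fderiv_test hc v)
  have h2 : Integrable φ := hφ.continuous.integrable_of_hasCompactSupport hc
  have h := integral_mul_fderiv_eq_neg_fderiv_mul_of_integrable (μ := volume) (v := v)
    (f := fun _ : E d => (1 : ℝ)) (g := φ) (by simp) (by simpa using h1) (by simpa using h2)
    (by simp) (fun x _ => hφ.differentiable (by simp) x)
  simpa using h

/-- Constants belong to `H¹`. -/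
lemma exists_one_mem_H1 (hvol : volume U ≠ ⊤) :
    ∃ o ∈ H1 U, o.1 =ᵐ[volume.restrict U] (fun _ => (1 : ℝ)) ∧ o.2 = 0 := by
  have : IsFiniteMeasure (volume.restrict U) := isFiniteMeasure_restrict.2 hvol
  have hm : MemLp (fun _ : E d => (1 : ℝ)) 2 (volume.restrict U) := memLp_const 1
  refine ⟨(hm.toLp _, 0), ?_, hm.coeFn_toLp, rfl⟩
  intro φ hφ hc hs v
  have h1 : ∫ x in U, hm.toLp _ x * fderiv ℝ φ x v = 0 := by
    rw [← integral_fderiv_test hφ hc v, ← setIntegral_eq_integral_of_forall_compl_eq_zero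
      (f := fun x => fderiv ℝ φ x v) (s := U)]
    · refine integral_congr_ae ?_
      filter_upwards [hm.coeFn_toLp] with x hx
      rw [hx, one_mul]
    · intro x hx
      rw [image_eq_zero_of_notMem_tsupport (f := fderiv ℝ φ)
        (fun h => hx (hs (tsupport_fderiv_subset ℝ h)))]
      rfl
  have h2 : ∫ x in U, inner ℝ ((0 : Lp (E d) 2 (volume.restrict U)) x) v * φ x = 0 := by
    refine integral_eq_zero_of_ae ?_
    filter_upwards [Lp.coeFn_zero (E d) 2 (volume.restrict U)] with x hx
    rw [hx]; simp
  rw [h1, h2, neg_zero]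

/-- Smooth functions with compact support in `U` belong to `H¹(U)`. -/
lemma exists_mem_partsSpace_of_test {φ : E d → ℝ} (hφ : ContDiff ℝ ∞ φ)
    (hc : HasCompactSupport φ) (hs : tsupport φ ⊆ U) :
    ∃ w ∈ partsSpace U Set.univ, w.1 =ᵐ[volume.restrict U] φ := by
  have hm1 : MemLp φ 2 (volume.restrict U) := memLp_test hφ.continuous hc _
  let G : E d → E d := fun x => (InnerProductSpace.toDual ℝ (E d)).symm (fderiv ℝ φ x)
  have hGc : Continuous G := (LinearIsometryEquiv.continuous _).comp
    (hφ.continuous_fderiv (by simp))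
  have hGs : HasCompactSupport G := (hc.fderiv (𝕜 := ℝ)).comp_left (map_zero _)
  have hm2 : MemLp G 2 (volume.restrict U) := hGc.memLp_of_hasCompactSupport hGs
  refine ⟨(hm1.toLp _, hm2.toLp _), ?_, hm1.coeFn_toLp⟩
  -- The support of `φ` already lies in `U`, so `ψ` needs no support condition. Hence the same
  -- functions serve for the Neumann and the mixed space.
  intro ψ hψ hψc _ v
  have e1 : ∫ x in U, hm1.toLp φ x * fderiv ℝ ψ x v = ∫ x, φ x * fderiv ℝ ψ x v := by
    rw [← setIntegral_eq_integral_of_forall_compl_eq_zero (f := fun x => φ x * fderiv ℝ ψ x v)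
      (s := U)]
    · refine integral_congr_ae ?_
      filter_upwards [hm1.coeFn_toLp] with x hx
      rw [hx]
    · intro x hx
      rw [image_eq_zero_of_notMem_tsupport (fun h => hx (hs h)), zero_mul]
  have e2 : ∫ x in U, inner ℝ (hm2.toLp G x) v * ψ x = ∫ x, fderiv ℝ φ x v * ψ x := by
    rw [← setIntegral_eq_integral_of_forall_compl_eq_zero (f := fun x => fderiv ℝ φ x v * ψ x)
      (s := U)]
    · refine integral_congr_ae ?_
      filter_upwards [hm2.coeFn_toLp] with x hx
      rw [hx, InnerProductSpace.toDual_symm_apply]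
    · intro x hx
      rw [image_eq_zero_of_notMem_tsupport (f := fderiv ℝ φ)
        (fun h => hx (hs (tsupport_fderiv_subset ℝ h)))]
      simp
  change ∫ x in U, hm1.toLp φ x * fderiv ℝ ψ x v = -∫ x in U, inner ℝ (hm2.toLp G x) v * ψ x
  rw [e1, e2]
  have c1 := continuous_fderiv_test hφ v
  have c2 := continuous_fderiv_test hψ v
  exact integral_mul_fderiv_eq_neg_fderiv_mul_of_integrable
    ((c1.mul hψ.continuous).integrable_of_hasCompactSupport hψc.mul_left)
    ((hφ.continuous.mul c2).integrable_of_hasCompactSupport hc.mul_right)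
    ((hφ.continuous.mul hψ.continuous).integrable_of_hasCompactSupport hc.mul_right)
    (fun x _ => hφ.differentiable (by simp) x) (fun x _ => hψ.differentiable (by simp) x)

lemma coeFn_sum_smul {ι : Type*} (s : Finset ι) (c : ι → ℝ) (w : ι → PairL2 U)
    {φ : ι → E d → ℝ} (h : ∀ i, (w i).1 =ᵐ[volume.restrict U] φ i) :
    (∑ i ∈ s, c i • w i).1 =ᵐ[volume.restrict U] fun x => ∑ i ∈ s, c i * φ i x := by
  classical
  induction s using Finset.induction_on with
  | empty =>
    simp only [Finset.sum_empty, Prod.fst_zero]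
    exact Lp.coeFn_zero ℝ 2 (volume.restrict U)
  | insert a s ha ih =>
    rw [Finset.sum_insert ha, Prod.fst_add, Prod.smul_fst]
    filter_upwards [Lp.coeFn_add (c a • (w a).1) (∑ i ∈ s, c i • w i).1,
      Lp.coeFn_smul (c a) (w a).1, h a, ih] with x h1 h2 h3 h4
    rw [h1, Pi.add_apply, h2, Pi.smul_apply, h3, h4, Finset.sum_insert ha, smul_eq_mul]

/-- The Sobolev spaces are infinite-dimensional. -/
lemma exists_linearIndependent_partsSpace (hd : 0 < d) (hU : IsOpen U) (hne : U.Nonempty)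
    (n : ℕ) : ∃ w : Fin n → PairL2 U, (∀ i, w i ∈ partsSpace U Set.univ) ∧
      LinearIndependent ℝ w := by
  have : Nonempty (Fin d) := ⟨⟨0, hd⟩⟩
  have hinf : U.Infinite := by
    obtain ⟨x, hx⟩ := hne
    have := Module.punctured_nhds_neBot ℝ (E d) x
    exact infinite_of_mem_nhds x (hU.mem_nhds hx)
  obtain ⟨p, hp⟩ : ∃ p : Fin n → U, Function.Injective p := by
    have := hinf.to_subtype
    exact ⟨fun i => Infinite.natEmbedding U i,
      fun i j hij => Fin.ext ((Infinite.natEmbedding U).injective hij)⟩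
  -- Bumps equal to 1 at one chosen point and 0 at the others are independent: continuity turns an
  -- almost everywhere relation into a pointwise one, and evaluation at the points isolates each
  -- coefficient.
  have hφ : ∀ i, ∃ φ : E d → ℝ, ContDiff ℝ ∞ φ ∧ HasCompactSupport φ ∧ tsupport φ ⊆ U ∧
      φ (p i) = 1 ∧ ∀ j, j ≠ i → φ (p j) = 0 := by
    intro i
    have hfin : (Set.range fun j : {j // j ≠ i} => (p j : E d)).Finite := Set.finite_range _
    have hN : U ∩ (Set.range fun j : {j // j ≠ i} => (p j : E d))ᶜ ∈ 𝓝 (p i : E d) := by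
      refine (hU.inter hfin.isClosed.isOpen_compl).mem_nhds ⟨(p i).2, ?_⟩
      rintro ⟨j, hj⟩
      exact j.2 (hp (Subtype.ext hj))
    obtain ⟨φ, h1, h2, h3, -, h5⟩ := exists_contDiff_tsupport_subset (n := ⊤) hN
    refine ⟨φ, h3, h2, h1.trans Set.inter_subset_left, h5, fun j hj => ?_⟩
    refine image_eq_zero_of_notMem_tsupport (fun h => ?_)
    exact (h1 h).2 ⟨⟨j, hj⟩, rfl⟩
  choose φ hφs hφc hφt hφ1 hφ0 using hφ
  choose w hw hwφ using fun i => exists_mem_partsSpace_of_test (hφs i) (hφc i) (hφt i)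
  refine ⟨w, hw, Fintype.linearIndependent_iff.2 (fun c hc i => ?_)⟩
  have h1 := coeFn_sum_smul Finset.univ c w hwφ
  rw [hc] at h1
  have h2 : (fun x => ∑ i, c i * φ i x) =ᵐ[volume.restrict U] fun _ => (0 : ℝ) :=
    h1.symm.trans (Lp.coeFn_zero ℝ 2 (volume.restrict U))
  have h3 := Measure.eqOn_open_of_ae_eq h2 hU
    (continuous_finsetSum _ fun i _ =>
      continuous_const.mul (hφs i).continuous).continuousOn continuousOn_const (p i).2
  simp only at h3
  rw [Finset.sum_eq_single i (fun j _ hj => by rw [hφ0 j i hj.symm, mul_zero])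
    (fun h => absurd (Finset.mem_univ i) h), hφ1, mul_one] at h3
  exact h3

end SobolevSpace

/-! ### Restriction and extension by zero -/

section ExtensionRestriction

variable {d : ℕ} {U A B : Set (E d)}

/-- Restriction of a pair to a subset. -/
def restrictPair (h : A ⊆ U) (w : PairL2 U) : PairL2 A :=
  ((memLp_of_subset h w.1).toLp w.1, (memLp_of_subset h w.2).toLp w.2)

lemma restrictPair_fst (h : A ⊆ U) (w : PairL2 U) :
    (restrictPair h w).1 =ᵐ[volume.restrict A] w.1 :=
  MemLp.coeFn_toLp (memLp_of_subset h w.1)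

lemma restrictPair_snd (h : A ⊆ U) (w : PairL2 U) :
    (restrictPair h w).2 =ᵐ[volume.restrict A] w.2 :=
  MemLp.coeFn_toLp (memLp_of_subset h w.2)

lemma massForm_restrictPair (h : A ⊆ U) (w z : PairL2 U) :
    massForm subset_rfl (restrictPair h w) (restrictPair h z) = massForm h w z := by
  refine integral_congr_ae ?_
  filter_upwards [restrictPair_fst h w, restrictPair_fst h z] with x h1 h2
  rw [h1, h2]

lemma gradForm_restrictPair (h : A ⊆ U) (w z : PairL2 U) :
    gradForm subset_rfl (restrictPair h w) (restrictPair h z) = gradForm h w z := by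
  refine integral_congr_ae ?_
  filter_upwards [restrictPair_snd h w, restrictPair_snd h z] with x h1 h2
  rw [h1, h2]

lemma restrictPair_mem_H1 (h : A ⊆ U) {w : PairL2 U} (hw : w ∈ H1 U) : restrictPair h w ∈ H1 A := by
  intro φ hφ hc hs v
  have e1 : ∫ x in A, (restrictPair h w).1 x * fderiv ℝ φ x v
      = ∫ x in U, w.1 x * fderiv ℝ φ x v := by
    have : ∫ x in A, (restrictPair h w).1 x * fderiv ℝ φ x v
        = ∫ x in A, w.1 x * fderiv ℝ φ x v := by
      refine integral_congr_ae ?_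
      filter_upwards [restrictPair_fst h w] with x hx
      rw [hx]
    have hz : ∀ x ∉ A, w.1 x * fderiv ℝ φ x v = 0 := by
      intro x hx
      rw [image_eq_zero_of_notMem_tsupport (f := fderiv ℝ φ)
        (fun h => hx (hs (tsupport_fderiv_subset ℝ h)))]
      simp
    rw [this, setIntegral_eq_integral_of_forall_compl_eq_zero hz,
      setIntegral_eq_integral_of_forall_compl_eq_zero (fun x hx => hz x (fun h' => hx (h h')))]
  have e2 : ∫ x in A, inner ℝ ((restrictPair h w).2 x) v * φ x
      = ∫ x in U, inner ℝ (w.2 x) v * φ x := by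
    have : ∫ x in A, inner ℝ ((restrictPair h w).2 x) v * φ x
        = ∫ x in A, inner ℝ (w.2 x) v * φ x := by
      refine integral_congr_ae ?_
      filter_upwards [restrictPair_snd h w] with x hx
      rw [hx]
    have hz : ∀ x ∉ A, inner ℝ (w.2 x) v * φ x = 0 := by
      intro x hx
      rw [image_eq_zero_of_notMem_tsupport (fun h => hx (hs h)), mul_zero]
    rw [this, setIntegral_eq_integral_of_forall_compl_eq_zero hz,
      setIntegral_eq_integral_of_forall_compl_eq_zero (fun x hx => hz x (fun h' => hx (h h')))]
  rw [e1, e2]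
  exact hw φ hφ hc (hs.trans h) v

lemma memLp_extend (hA : MeasurableSet A) (h : A ⊆ U) {F : Type*} [NormedAddCommGroup F]
    (f : Lp F 2 (volume.restrict A)) : MemLp (A.indicator f) 2 (volume.restrict U) := by
  rw [memLp_indicator_iff_restrict hA, restrict_restrict_subset hA h]
  exact Lp.memLp f

lemma ae_indicator_congr (hA : MeasurableSet A) (h : A ⊆ U) {F : Type*} [Zero F] {f g : E d → F}
    (hfg : f =ᵐ[volume.restrict A] g) :
    A.indicator f =ᵐ[volume.restrict U] A.indicator g := by
  rw [← restrict_restrict_subset hA h, Filter.EventuallyEq, ae_restrict_iff' hA] at hfg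
  filter_upwards [hfg] with x hx
  by_cases hxA : x ∈ A <;> simp [hxA, hx]

/-- Extension of `L²` functions by zero. -/
def extendLp (hA : MeasurableSet A) (h : A ⊆ U) (F : Type*) [NormedAddCommGroup F]
    [NormedSpace ℝ F] : Lp F 2 (volume.restrict A) →ₗ[ℝ] Lp F 2 (volume.restrict U) where
  toFun f := (memLp_extend hA h f).toLp _
  map_add' f g := by
    rw [Lp.ext_iff]
    filter_upwards [(memLp_extend hA h (f + g)).coeFn_toLp, (memLp_extend hA h f).coeFn_toLp,
      (memLp_extend hA h g).coeFn_toLp, Lp.coeFn_add ((memLp_extend hA h f).toLp _)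
      ((memLp_extend hA h g).toLp _), ae_indicator_congr hA h (Lp.coeFn_add f g)]
      with x h1 h2 h3 h4 h5
    rw [h1, h4, Pi.add_apply, h2, h3, h5, Set.indicator_add']
    rfl
  map_smul' c f := by
    rw [Lp.ext_iff]
    filter_upwards [(memLp_extend hA h (c • f)).coeFn_toLp, (memLp_extend hA h f).coeFn_toLp,
      Lp.coeFn_smul c ((memLp_extend hA h f).toLp _),
      ae_indicator_congr hA h (Lp.coeFn_smul c f)] with x h1 h2 h3 h4
    rw [h1, RingHom.id_apply, h3, Pi.smul_apply, h2, h4]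
    by_cases hxA : x ∈ A <;> simp [hxA]

lemma extendLp_ae (hA : MeasurableSet A) (h : A ⊆ U) {F : Type*} [NormedAddCommGroup F]
    [NormedSpace ℝ F] (f : Lp F 2 (volume.restrict A)) :
    extendLp hA h F f =ᵐ[volume.restrict U] A.indicator f :=
  MemLp.coeFn_toLp (memLp_extend hA h f)

lemma extendLp_ae_self (hA : MeasurableSet A) (h : A ⊆ U) {F : Type*} [NormedAddCommGroup F]
    [NormedSpace ℝ F] (f : Lp F 2 (volume.restrict A)) :
    extendLp hA h F f =ᵐ[volume.restrict A] f := by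
  filter_upwards [ae_sub h (extendLp_ae hA h f), ae_restrict_mem hA] with x h1 h2
  rw [h1, Set.indicator_of_mem h2]

lemma extendLp_ae_zero (hA : MeasurableSet A) (h : A ⊆ U) {F : Type*} [NormedAddCommGroup F]
    [NormedSpace ℝ F] (f : Lp F 2 (volume.restrict A)) (hB : MeasurableSet B) (hBU : B ⊆ U)
    (hd : Disjoint A B) : extendLp hA h F f =ᵐ[volume.restrict B] 0 := by
  filter_upwards [ae_sub hBU (extendLp_ae hA h f), ae_restrict_mem hB] with x h1 h2
  rw [h1, Set.indicator_of_notMem (fun h3 => Set.disjoint_left.1 hd h3 h2)]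
  rfl

/-- Extension of pairs by zero. -/
def extendPair (hA : MeasurableSet A) (h : A ⊆ U) : PairL2 A →ₗ[ℝ] PairL2 U :=
  (extendLp hA h ℝ).prodMap (extendLp hA h (E d))

lemma extendPair_fst (hA : MeasurableSet A) (h : A ⊆ U) (w : PairL2 A) :
    (extendPair hA h w).1 = extendLp hA h ℝ w.1 := rfl

lemma extendPair_snd (hA : MeasurableSet A) (h : A ⊆ U) (w : PairL2 A) :
    (extendPair hA h w).2 = extendLp hA h (E d) w.2 := rfl

lemma setIntegral_extend (hA : MeasurableSet A) (h : A ⊆ U) {f g : E d → ℝ}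
    (hfg : f =ᵐ[volume.restrict U] A.indicator g) : ∫ x in U, f x = ∫ x in A, g x := by
  rw [integral_congr_ae hfg, integral_indicator hA, restrict_restrict_subset hA h]

lemma massForm_extendPair (hA : MeasurableSet A) (h : A ⊆ U) (w z : PairL2 A) :
    massForm h (extendPair hA h w) (extendPair hA h z) = massForm subset_rfl w z := by
  refine integral_congr_ae ?_
  filter_upwards [extendLp_ae_self hA h w.1, extendLp_ae_self hA h z.1] with x h1 h2
  rw [extendPair_fst, extendPair_fst, h1, h2]

lemma gradForm_extendPair (hA : MeasurableSet A) (h : A ⊆ U) (w z : PairL2 A) :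
    gradForm h (extendPair hA h w) (extendPair hA h z) = gradForm subset_rfl w z := by
  refine integral_congr_ae ?_
  filter_upwards [extendLp_ae_self hA h w.2, extendLp_ae_self hA h z.2] with x h1 h2
  rw [extendPair_snd, extendPair_snd, h1, h2]

lemma massForm_extendPair_eq_zero (hA : MeasurableSet A) (h : A ⊆ U) (hB : MeasurableSet B)
    (hBU : B ⊆ U) (hd : Disjoint A B) (z : PairL2 U) (w : PairL2 A) :
    massForm hBU z (extendPair hA h w) = 0 := by
  refine integral_eq_zero_of_ae ?_
  filter_upwards [extendLp_ae_zero hA h w.1 hB hBU hd] with x h1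
  rw [extendPair_fst, h1]
  simp

lemma gradForm_extendPair_eq_zero (hA : MeasurableSet A) (h : A ⊆ U) (hB : MeasurableSet B)
    (hBU : B ⊆ U) (hd : Disjoint A B) (z : PairL2 U) (w : PairL2 A) :
    gradForm hBU z (extendPair hA h w) = 0 := by
  refine integral_eq_zero_of_ae ?_
  filter_upwards [extendLp_ae_zero hA h w.2 hB hBU hd] with x h1
  rw [extendPair_snd, h1]
  simp

lemma norm_extendLp (hA : MeasurableSet A) (h : A ⊆ U) {F : Type*} [NormedAddCommGroup F]
    [InnerProductSpace ℝ F] (f : Lp F 2 (volume.restrict A)) : ‖extendLp hA h F f‖ = ‖f‖ := by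
  have : ‖extendLp hA h F f‖ ^ 2 = ‖f‖ ^ 2 := by
    rw [← integral_norm_sq_eq_norm_sq, ← integral_norm_sq_eq_norm_sq]
    refine setIntegral_extend hA h ?_
    filter_upwards [extendLp_ae hA h f] with x hx
    rw [hx]
    by_cases hxA : x ∈ A <;> simp [hxA]
  exact (pow_left_inj₀ (norm_nonneg _) (norm_nonneg _) (by norm_num)).1 this

/-- If integration by parts holds up to the part of the boundary of `A` inside `U`, then extension
by zero is in `H¹(U)`. -/
lemma extendPair_mem_H1 (hA : MeasurableSet A) (h : A ⊆ U) {w : PairL2 A}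
    (hw : w ∈ partsSpace A U) : extendPair hA h w ∈ H1 U := by
  intro φ hφ hc hs v
  have e1 : ∫ x in U, (extendPair hA h w).1 x * fderiv ℝ φ x v
      = ∫ x in A, w.1 x * fderiv ℝ φ x v := by
    refine setIntegral_extend hA h ?_
    filter_upwards [extendLp_ae hA h w.1] with x hx
    rw [extendPair_fst, hx]
    by_cases hxA : x ∈ A <;> simp [hxA]
  have e2 : ∫ x in U, inner ℝ ((extendPair hA h w).2 x) v * φ x
      = ∫ x in A, inner ℝ (w.2 x) v * φ x := by
    refine setIntegral_extend hA h ?_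
    filter_upwards [extendLp_ae hA h w.2] with x hx
    rw [extendPair_snd, hx]
    by_cases hxA : x ∈ A <;> simp [hxA]
  rw [e1, e2]
  exact hw φ hφ hc hs v

/-- Extension by zero is adjoint to restriction, so it carries weak convergence over to the larger
set. -/
lemma inner_extendLp (hA : MeasurableSet A) (h : A ⊆ U) (f : Lp ℝ 2 (volume.restrict A))
    (q : Lp ℝ 2 (volume.restrict U)) :
    inner ℝ (extendLp hA h ℝ f) q = inner ℝ f ((memLp_of_subset h q).toLp q) := by
  rw [← integral_mul_eq_inner, L2.inner_def]
  refine setIntegral_extend hA h ?_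
  filter_upwards [extendLp_ae hA h f] with x hx
  rw [hx]
  by_cases hxA : x ∈ A <;> simp [hxA, mul_comm]

end ExtensionRestriction

/-! ### The Neumann, stiff and mixed problems as compact form pairs -/

section FormPairs

variable {d : ℕ} {U : Set (E d)}

/-- The Neumann forms on a smooth domain. -/
lemma IsSmoothBoundedDomain.isCompactFormPair (hd : 0 < d) (hU : IsSmoothBoundedDomain U) :
    IsCompactFormPair (H1 U) (gradForm subset_rfl) (massForm subset_rfl) where
  symm_left := gradForm_symm _
  symm_right := massForm_symm _
  nonneg_left := gradForm_nonneg _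
  nonneg_right := massForm_nonneg _
  definite u hu h0 := by
    rw [massForm_self_eq_norm] at h0
    have h1 : u.1 = 0 := norm_eq_zero.1 (pow_eq_zero_iff (by norm_num) |>.1 h0)
    exact eq_zero_of_fst_eq_zero hU.isOpen hu (h1 ▸ Lp.coeFn_zero ℝ 2 (volume.restrict U))
  infinite n := by
    obtain ⟨w, hw, hli⟩ := exists_linearIndependent_partsSpace hd hU.isOpen
      hU.isConnected.nonempty n
    exact ⟨w, fun i => partsSpace_anti (Set.subset_univ _) (hw i), hli⟩
  compact w C hw ha hb := by
    simp only [massForm_self_eq_norm, gradForm_self_eq_norm] at ha hb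
    obtain ⟨s, hs, w₀, hw₀, h1, h2⟩ := hU.exists_convergent_subseq hw (C := √C)
      (fun n => Real.le_sqrt_of_sq_le (hb n)) (fun n => Real.le_sqrt_of_sq_le (ha n))
    refine ⟨s, hs, w₀, hw₀, ?_, fun φ _ => tendsto_gradForm hU.isOpen.measurableSet _ h2 φ⟩
    simp only [massForm_self_eq_norm]
    simpa using h1.pow 2

variable (G : Geometry d)

lemma Geometry.isOpen_annulus : IsOpen G.annulus :=
  G.whole_smooth.isOpen.sdiff isClosed_closure

lemma Geometry.nonempty_annulus : G.annulus.Nonempty := G.annulus_connected.nonempty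

lemma Geometry.measurableSet_annulus : MeasurableSet G.annulus := G.isOpen_annulus.measurableSet

lemma Geometry.measurableSet_core : MeasurableSet G.core := G.core_smooth.isOpen.measurableSet

lemma Geometry.disjoint_annulus_core : Disjoint G.annulus G.core :=
  Set.disjoint_left.2 fun _ h1 h2 => h1.2 (subset_closure h2)

/-- In dimension zero the space is a single point, which cannot lie in both the core and the
annulus. -/
lemma Geometry.pos_dim (G : Geometry d) : 0 < d := by
  rcases Nat.eq_zero_or_pos d with rfl | h
  · obtain ⟨x, hx⟩ := G.nonempty_annulus
    obtain ⟨y, hy⟩ := G.core_smooth.isConnected.nonempty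
    exact absurd (subset_closure (Subsingleton.elim y x ▸ hy)) hx.2
  · exact h

/-- The two sets differ by the interface, which is null. Integrals over the whole domain therefore
split into annulus and core. -/
lemma Geometry.core_ae_eq_closure : G.core =ᵐ[volume] closure G.core := by
  refine (subset_closure.eventuallyLE).antisymm ?_
  rw [ae_le_set]
  have : closure G.core \ G.core = frontier G.core := by
    rw [frontier, G.core_smooth.isOpen.interior_eq]
  rw [this]
  exact G.core_smooth.volume_frontier

lemma Geometry.restrict_whole :
    (volume.restrict G.whole : Measure (E d))
      = volume.restrict G.annulus + volume.restrict G.core := by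
  have h1 : G.whole = G.annulus ∪ closure G.core := by
    rw [Geometry.annulus, Set.sdiff_union_of_subset G.closure_core_subset]
  rw [Measure.restrict_congr_set G.core_ae_eq_closure, h1, Measure.restrict_union
    (Set.disjoint_left.2 fun _ h1 h2 => h1.2 h2) isClosed_closure.measurableSet]

lemma Geometry.ae_whole {p : E d → Prop} (h1 : ∀ᵐ x ∂volume.restrict G.annulus, p x)
    (h2 : ∀ᵐ x ∂volume.restrict G.core, p x) : ∀ᵐ x ∂volume.restrict G.whole, p x := by
  rw [G.restrict_whole, ae_add_measure_iff]
  exact ⟨h1, h2⟩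

lemma Geometry.norm_fst_sq (w : PairL2 G.whole) :
    ‖w.1‖ ^ 2 = massForm G.annulus_subset w w + massForm G.core_subset w w := by
  rw [← integral_sq_eq_norm_sq, massForm_self, massForm_self,
    ← integral_add_measure (memLp_of_subset G.annulus_subset _).integrable_sq
      (memLp_of_subset G.core_subset _).integrable_sq, ← G.restrict_whole]

lemma Geometry.norm_snd_sq (w : PairL2 G.whole) :
    ‖w.2‖ ^ 2 = gradForm G.annulus_subset w w + gradForm G.core_subset w w := by
  rw [← integral_norm_sq_eq_norm_sq, gradForm_self, gradForm_self,
    ← integral_add_measure ((memLp_of_subset G.annulus_subset _).integrable_norm_pow (by norm_num))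
      ((memLp_of_subset G.core_subset _).integrable_norm_pow (by norm_num)), ← G.restrict_whole]

lemma stiffEnergy_apply (ε : ℝ) (w z : PairL2 G.whole) : stiffEnergy G ε w z
    = gradForm G.annulus_subset w z + ε⁻¹ * gradForm G.core_subset w z := rfl

lemma stiffMass_apply (m ε : ℝ) (w z : PairL2 G.whole) : stiffMass G m ε w z
    = massForm G.annulus_subset w z + ε ^ (-2 * m) * massForm G.core_subset w z := rfl

/-- The forms of the stiff transmission problem. -/
lemma Geometry.isCompactFormPair_stiff (m : ℝ) {ε : ℝ} (hε : 0 < ε) :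
    IsCompactFormPair (H1 G.whole) (stiffEnergy G ε) (stiffMass G m ε) where
  symm_left u v := by
    rw [stiffEnergy_apply, stiffEnergy_apply, gradForm_symm, gradForm_symm G.core_subset]
  symm_right u v := by
    rw [stiffMass_apply, stiffMass_apply, massForm_symm, massForm_symm G.core_subset]
  nonneg_left u := by
    have := gradForm_nonneg G.annulus_subset u
    have := gradForm_nonneg G.core_subset u
    rw [stiffEnergy_apply]
    positivity
  nonneg_right u := by
    have := massForm_nonneg G.annulus_subset u
    have := massForm_nonneg G.core_subset u
    rw [stiffMass_apply]
    positivity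
  definite u hu h0 := by
    have h1 := massForm_nonneg G.annulus_subset u
    have h2 := massForm_nonneg G.core_subset u
    have h3 : 0 < ε ^ (-2 * m) := Real.rpow_pos_of_pos hε _
    rw [stiffMass_apply] at h0
    have h4 : massForm G.annulus_subset u u = 0 := by nlinarith
    have h5 : massForm G.core_subset u u = 0 := by nlinarith
    have h6 := G.norm_fst_sq u
    rw [h4, h5, add_zero] at h6
    have h7 : u.1 = 0 := norm_eq_zero.1 (pow_eq_zero_iff (by norm_num) |>.1 h6)
    exact eq_zero_of_fst_eq_zero G.whole_smooth.isOpen hu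
      (h7 ▸ Lp.coeFn_zero ℝ 2 (volume.restrict G.whole))
  infinite := (G.whole_smooth.isCompactFormPair G.pos_dim).infinite
  compact w C hw ha hb := by
    have hβ : 0 < ε ^ (-2 * m) := Real.rpow_pos_of_pos hε _
    set β := ε ^ (-2 * m)
    -- Here `C` bounds the annulus part, `C / β` the core mass and `ε * C` the core gradient; their
    -- sum is one constant that serves for both norms.
    have hb1 : ∀ k, ‖(w k).1‖ ^ 2 ≤ C + C / β + ε * C := by
      intro k
      have h0 := hb k
      have h0' := ha k
      have h1 := massForm_nonneg G.annulus_subset (w k)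
      have h2 := massForm_nonneg G.core_subset (w k)
      have h3 := gradForm_nonneg G.annulus_subset (w k)
      have h4 := gradForm_nonneg G.core_subset (w k)
      rw [stiffMass_apply] at h0
      have hC : 0 ≤ C := by nlinarith [mul_nonneg hβ.le h2]
      rw [G.norm_fst_sq]
      have h5 : massForm G.core_subset (w k) (w k) ≤ C / β := by
        rw [le_div_iff₀ hβ]; linarith [mul_comm β (massForm G.core_subset (w k) (w k))]
      have h6 : 0 ≤ ε * C := by positivity
      nlinarith [mul_nonneg hβ.le h2]
    have hb2 : ∀ k, ‖(w k).2‖ ^ 2 ≤ C + C / β + ε * C := by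
      intro k
      have h0 := ha k
      have h0' := hb k
      have h2 := gradForm_nonneg G.core_subset (w k)
      have h1 := gradForm_nonneg G.annulus_subset (w k)
      have hε' : 0 < ε⁻¹ := by positivity
      rw [stiffEnergy_apply] at h0
      have hC : 0 ≤ C := by nlinarith [mul_nonneg hε'.le h2]
      rw [G.norm_snd_sq]
      have h5 : gradForm G.core_subset (w k) (w k) ≤ ε * C := by
        rw [← inv_mul_le_iff₀ hε]; linarith
      have h6 : 0 ≤ C / β := by positivity
      nlinarith [mul_nonneg hε'.le h2]
    obtain ⟨s, hs, w₀, hw₀, h1, h2⟩ := G.whole_smooth.exists_convergent_subseq hw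
      (fun n => Real.le_sqrt_of_sq_le (hb1 n)) (fun n => Real.le_sqrt_of_sq_le (hb2 n))
    refine ⟨s, hs, w₀, hw₀, ?_, fun φ _ => ?_⟩
    · have h3 := (h1.pow 2).const_mul (1 + β)
      rw [zero_pow (by norm_num), mul_zero] at h3
      refine squeeze_zero (fun k => ?_) (fun k => ?_) h3
      · have := massForm_nonneg G.annulus_subset (w (s k) - w₀)
        have := massForm_nonneg G.core_subset (w (s k) - w₀)
        rw [stiffMass_apply]
        positivity
      · have h4 := massForm_self_le G.annulus_subset (w (s k) - w₀)
        have h5 := massForm_self_le G.core_subset (w (s k) - w₀)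
        rw [Prod.fst_sub] at h4 h5
        rw [stiffMass_apply]
        nlinarith [mul_le_mul_of_nonneg_left h5 hβ.le]
    · exact (tendsto_gradForm G.measurableSet_annulus G.annulus_subset h2 φ).add
        ((tendsto_gradForm G.measurableSet_core G.core_subset h2 φ).const_mul _)

/-- Extension by zero from the annulus to the whole domain. -/
def Geometry.ext : PairL2 G.annulus →ₗ[ℝ] PairL2 G.whole :=
  extendPair G.measurableSet_annulus G.annulus_subset

lemma Geometry.ext_mem_H1 {w : PairL2 G.annulus} (hw : w ∈ mixedH1 G) : G.ext w ∈ H1 G.whole :=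
  extendPair_mem_H1 _ _ hw.2

lemma Geometry.massForm_ext (w z : PairL2 G.annulus) :
    massForm G.annulus_subset (G.ext w) (G.ext z) = massForm subset_rfl w z :=
  massForm_extendPair _ _ w z

lemma Geometry.gradForm_ext (w z : PairL2 G.annulus) :
    gradForm G.annulus_subset (G.ext w) (G.ext z) = gradForm subset_rfl w z :=
  gradForm_extendPair _ _ w z

lemma Geometry.massForm_core_ext (z : PairL2 G.whole) (w : PairL2 G.annulus) :
    massForm G.core_subset z (G.ext w) = 0 :=
  massForm_extendPair_eq_zero _ _ G.measurableSet_core _ G.disjoint_annulus_core z w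

lemma Geometry.gradForm_core_ext (z : PairL2 G.whole) (w : PairL2 G.annulus) :
    gradForm G.core_subset z (G.ext w) = 0 :=
  gradForm_extendPair_eq_zero _ _ G.measurableSet_core _ G.disjoint_annulus_core z w

lemma Geometry.norm_ext_fst (w : PairL2 G.annulus) : ‖(G.ext w).1‖ = ‖w.1‖ :=
  norm_extendLp G.measurableSet_annulus G.annulus_subset w.1

lemma Geometry.norm_ext_snd (w : PairL2 G.annulus) : ‖(G.ext w).2‖ = ‖w.2‖ :=
  norm_extendLp G.measurableSet_annulus G.annulus_subset w.2

/-- A function in `H¹(Ω)` which vanishes in the core is the extension of a function in the space of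
the mixed problem. -/
lemma Geometry.exists_ext_eq {w : PairL2 G.whole} (hw : w ∈ H1 G.whole)
    (h1 : massForm G.core_subset w w = 0) (h2 : gradForm G.core_subset w w = 0) :
    ∃ g ∈ mixedH1 G, G.ext g = w := by
  have z1 : w.1 =ᵐ[volume.restrict G.core] 0 := by
    rw [massForm_self] at h1
    have := (integral_eq_zero_iff_of_nonneg (fun x => sq_nonneg _)
      (memLp_of_subset G.core_subset w.1).integrable_sq).1 h1
    filter_upwards [this] with x hx
    exact pow_eq_zero_iff (by norm_num) |>.1 hx
  have z2 : w.2 =ᵐ[volume.restrict G.core] 0 := by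
    rw [gradForm_self] at h2
    have := (integral_eq_zero_iff_of_nonneg (fun x => sq_nonneg _)
      ((memLp_of_subset G.core_subset w.2).integrable_norm_pow (by norm_num))).1 h2
    filter_upwards [this] with x hx
    exact norm_eq_zero.1 (pow_eq_zero_iff (by norm_num) |>.1 hx)
  have heq : G.ext (restrictPair G.annulus_subset w) = w := by
    refine Prod.ext ?_ ?_
    · rw [Lp.ext_iff]
      refine G.ae_whole ?_ ?_
      · exact (extendLp_ae_self G.measurableSet_annulus G.annulus_subset
          (restrictPair G.annulus_subset w).1).trans (restrictPair_fst _ _)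
      · exact (extendLp_ae_zero G.measurableSet_annulus G.annulus_subset
          (restrictPair G.annulus_subset w).1 G.measurableSet_core G.core_subset
          G.disjoint_annulus_core).trans z1.symm
    · rw [Lp.ext_iff]
      refine G.ae_whole ?_ ?_
      · exact (extendLp_ae_self G.measurableSet_annulus G.annulus_subset
          (restrictPair G.annulus_subset w).2).trans (restrictPair_snd _ _)
      · exact (extendLp_ae_zero G.measurableSet_annulus G.annulus_subset
          (restrictPair G.annulus_subset w).2 G.measurableSet_core G.core_subset
          G.disjoint_annulus_core).trans z2.symm
  -- Since `w` vanishes in the core, integration by parts on the whole domain involves the annulus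
  -- only. Its test functions are arbitrary on the interface, so this is the zero trace condition.
  have hmem : restrictPair G.annulus_subset w ∈ partsSpace G.annulus G.whole := by
    intro φ hφ hc hs v
    set g := restrictPair G.annulus_subset w
    have e1 : ∫ x in G.whole, (G.ext g).1 x * fderiv ℝ φ x v
        = ∫ x in G.annulus, g.1 x * fderiv ℝ φ x v := by
      refine setIntegral_extend G.measurableSet_annulus G.annulus_subset ?_
      filter_upwards [extendLp_ae G.measurableSet_annulus G.annulus_subset g.1] with x hx
      rw [Geometry.ext, extendPair_fst, hx]
      by_cases hxA : x ∈ G.annulus <;> simp [hxA]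
    have e2 : ∫ x in G.whole, inner ℝ ((G.ext g).2 x) v * φ x
        = ∫ x in G.annulus, inner ℝ (g.2 x) v * φ x := by
      refine setIntegral_extend G.measurableSet_annulus G.annulus_subset ?_
      filter_upwards [extendLp_ae G.measurableSet_annulus G.annulus_subset g.2] with x hx
      rw [Geometry.ext, extendPair_snd, hx]
      by_cases hxA : x ∈ G.annulus <;> simp [hxA]
    rw [← e1, ← e2, heq]
    exact hw φ hφ hc hs v
  exact ⟨_, ⟨partsSpace_anti G.annulus_subset hmem, hmem⟩, heq⟩

/-- The forms of the mixed problem. -/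
lemma Geometry.isCompactFormPair_mixed :
    IsCompactFormPair (mixedH1 G) (gradForm subset_rfl) (massForm subset_rfl) where
  symm_left := gradForm_symm _
  symm_right := massForm_symm _
  nonneg_left := gradForm_nonneg _
  nonneg_right := massForm_nonneg _
  definite u hu h0 := by
    rw [massForm_self_eq_norm] at h0
    have h1 : u.1 = 0 := norm_eq_zero.1 (pow_eq_zero_iff (by norm_num) |>.1 h0)
    exact eq_zero_of_fst_eq_zero G.isOpen_annulus hu.1
      (h1 ▸ Lp.coeFn_zero ℝ 2 (volume.restrict G.annulus))
  infinite n := by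
    obtain ⟨w, hw, hli⟩ := exists_linearIndependent_partsSpace G.pos_dim G.isOpen_annulus
      G.nonempty_annulus n
    exact ⟨w, fun i => ⟨partsSpace_anti (Set.subset_univ _) (hw i),
      partsSpace_anti (Set.subset_univ _) (hw i)⟩, hli⟩
  compact w C hw ha hb := by
    simp only [massForm_self_eq_norm, gradForm_self_eq_norm] at ha hb
    obtain ⟨s, hs, w₀, hw₀, h1, h2⟩ := exists_convergent_subseq (mixedH1 G)
      (fun w w₀ h h1 h2 => ⟨mem_partsSpace_of_weak (fun k => (h k).1) h1 h2,
        mem_partsSpace_of_weak (fun k => (h k).2) h1 h2⟩)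
      -- Extension by zero reduces the Rellich property to the whole domain, so no boundary
      -- regularity of the annulus enters.
      (fun w C h h1 h2 h3 => by
        have := G.whole_smooth.tendsto_norm_of_weak (w := fun k => G.ext (w k)) (C := C)
          (fun k => G.ext_mem_H1 (h k))
          (fun k => (G.norm_ext_fst _).le.trans (h1 k))
          (fun k => (G.norm_ext_snd _).le.trans (h2 k))
          (fun q => by
            refine (h3 ((memLp_of_subset G.annulus_subset q).toLp q)).congr (fun k => ?_)
            exact (inner_extendLp G.measurableSet_annulus G.annulus_subset (w k).1 q).symm)
        exact this.congr (fun k => G.norm_ext_fst _))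
      hw (C := √C)
      (fun n => Real.le_sqrt_of_sq_le (hb n)) (fun n => Real.le_sqrt_of_sq_le (ha n))
    refine ⟨s, hs, w₀, hw₀, ?_, fun φ _ => tendsto_gradForm G.measurableSet_annulus _ h2 φ⟩
    simp only [massForm_self_eq_norm]
    simpa using h1.pow 2

end FormPairs

/-! ### Rayleigh quotients and the spectral gap -/

section SpectralGap

variable {V : Type*} [AddCommGroup V] [Module ℝ V] {H : Submodule ℝ V}
  {a b : LinearMap.BilinForm ℝ V} {u : ℕ → V} {lam : ℕ → ℝ}

namespace IsEigenbasis

lemma form_self (hu : IsEigenbasis H a b u lam) (n : ℕ) : a (u n) (u n) = lam n := by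
  rw [hu.eigen n _ (hu.mem n), hu.norm_one, mul_one]

/-- The Rayleigh quotient of a combination of eigenvectors is at most the largest eigenvalue. -/
lemma form_combination_le (hu : IsEigenbasis H a b u lam) {ι : Type*} [Fintype ι] {σ : ι → ℕ}
    (hσ : Function.Injective σ) {M : ℝ} (hM : ∀ i, lam (σ i) ≤ M) (c : ι → ℝ) :
    a (∑ i, c i • u (σ i)) (∑ i, c i • u (σ i))
      ≤ M * b (∑ i, c i • u (σ i)) (∑ i, c i • u (σ i)) := by
  classical
  set W := ∑ i, c i • u (σ i) with hW
  have hWH : W ∈ H := H.sum_mem fun i _ => H.smul_mem _ (hu.mem _)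
  have hbW : ∀ i, b (u (σ i)) W = c i := by
    intro i
    rw [hW, map_sum, Finset.sum_eq_single i]
    · simp [hu.norm_one]
    · intro j _ hj
      simp [hu.orthogonal _ _ (fun h => hj (hσ h).symm)]
    · intro h; exact absurd (Finset.mem_univ i) h
  have h1 : a W W = ∑ i, lam (σ i) * c i ^ 2 := by
    nth_rewrite 1 [hW]
    simp only [map_sum, LinearMap.sum_apply]
    refine Finset.sum_congr rfl fun i _ => ?_
    rw [map_smul, LinearMap.smul_apply, hu.eigen _ W hWH, hbW, smul_eq_mul]
    ring
  have h2 : b W W = ∑ i, c i ^ 2 := by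
    nth_rewrite 1 [hW]
    simp only [map_sum, LinearMap.sum_apply]
    refine Finset.sum_congr rfl fun i _ => ?_
    rw [map_smul, LinearMap.smul_apply, hbW, smul_eq_mul]
    ring
  rw [h1, h2, Finset.mul_sum]
  exact Finset.sum_le_sum fun i _ => mul_le_mul_of_nonneg_right (hM i) (sq_nonneg _)

/-- If the kernel of the first form is spanned by `o`, then `o` is the first eigenvector and the
second eigenvalue is positive. -/
lemma spectral_gap (h : IsCompactFormPair H a b) (hu : IsEigenbasis H a b u lam) {o : V}
    (ho : o ∈ H) (ho0 : o ≠ 0) (hao : a o o = 0)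
    (hker : ∀ w ∈ H, a w w = 0 → ∃ c : ℝ, w = c • o) :
    lam 0 = 0 ∧ 0 < lam 1 ∧ (∀ i, b o (u (i + 1)) = 0) ∧
      ∀ w ∈ H, b o w = 0 → lam 1 * b w w ≤ a w w := by
  have hbo := h.pos ho ho0
  have h0 : lam 0 = 0 := by
    have h1 := hu.le_of_orthogonal 0 o ho (by simp)
    have h2 := h.nonneg_left (u 0)
    rw [hu.form_self] at h2
    rw [hao] at h1
    nlinarith
  obtain ⟨c, hc⟩ := hker (u 0) (hu.mem 0) (by rw [hu.form_self, h0])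
  have hne : ∀ n, u n ≠ 0 := fun n hn => by
    have := hu.norm_one n
    simp [hn] at this
  have hc0 : c ≠ 0 := fun h' => hne 0 (by rw [hc, h', zero_smul])
  have horth : ∀ i, b o (u (i + 1)) = 0 := by
    intro i
    have h1 := hu.orthogonal 0 (i + 1) (by omega)
    rw [hc, map_smul, LinearMap.smul_apply, smul_eq_mul] at h1
    exact (mul_eq_zero.1 h1).resolve_left hc0
  refine ⟨h0, ?_, horth, fun w hw how => hu.le_of_orthogonal 1 w hw (fun i hi => ?_)⟩
  -- If `lam 1` were zero, `u 1` would be a multiple of `o` as well as orthogonal to it.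
  · refine lt_of_le_of_ne (h0 ▸ hu.monotone (Nat.zero_le 1)) (fun h1 => ?_)
    obtain ⟨c', hc'⟩ := hker (u 1) (hu.mem 1) (by rw [hu.form_self, ← h1])
    have h2 := horth 0
    rw [zero_add, hc', map_smul, smul_eq_mul] at h2
    rcases mul_eq_zero.1 h2 with h3 | h3
    · exact hne 1 (by rw [hc', h3, zero_smul])
    · exact hbo.ne' h3
  · rw [Nat.lt_one_iff.1 hi, hc, map_smul, LinearMap.smul_apply, how, smul_zero]

end IsEigenbasis

end SpectralGap

/-! ### Constant functions and the Poincaré inequality -/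

section Constants

variable {d : ℕ} {U A : Set (E d)}

/-- `o` represents the constant function `1`. -/
structure IsOne (o : PairL2 U) : Prop where
  mem : o ∈ H1 U
  fst : o.1 =ᵐ[volume.restrict U] fun _ => (1 : ℝ)
  snd : o.2 = 0

namespace IsOne

lemma gradForm_left {o : PairL2 U} (ho : IsOne o) (h : A ⊆ U) (w : PairL2 U) :
    gradForm h o w = 0 := by
  refine integral_eq_zero_of_ae ?_
  rw [ho.snd]
  filter_upwards [ae_sub h (Lp.coeFn_zero (E d) 2 (volume.restrict U))] with x hx
  rw [hx]; simp

lemma massForm_self {o : PairL2 U} (ho : IsOne o) (h : A ⊆ U) :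
    massForm h o o = volume.real A := by
  rw [massForm_apply]
  have : ∫ x in A, o.1 x * o.1 x = ∫ x in A, (1 : ℝ) := by
    refine integral_congr_ae ?_
    filter_upwards [ae_sub h ho.fst] with x hx
    rw [hx]; simp
  rw [this, setIntegral_const]
  simp

lemma restrict {o : PairL2 U} (ho : IsOne o) (h : A ⊆ U) : IsOne (restrictPair h o) where
  mem := restrictPair_mem_H1 h ho.mem
  fst := (restrictPair_fst h o).trans (ae_sub h ho.fst)
  snd := by
    rw [Lp.ext_iff]
    refine (restrictPair_snd h o).trans ?_
    rw [ho.snd]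
    filter_upwards [ae_sub h (Lp.coeFn_zero (E d) 2 (volume.restrict U)),
      Lp.coeFn_zero (E d) 2 (volume.restrict A)] with x h1 h2
    rw [h1, h2]

lemma exists_eq_smul {o : PairL2 U} (ho : IsOne o) (hU : IsSmoothBoundedDomain U) {w : PairL2 U}
    (hw : w ∈ H1 U) (h0 : w.2 = 0) : ∃ c : ℝ, w = c • o := by
  obtain ⟨c, hc⟩ := exists_ae_eq_const hU.isOpen hU.isConnected hU.volume_lt_top.ne hw h0
  refine ⟨c, Prod.ext ?_ (by rw [Prod.smul_snd, ho.snd, h0, smul_zero])⟩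
  rw [Lp.ext_iff, Prod.smul_fst]
  filter_upwards [hc, Lp.coeFn_smul c o.1, ho.fst] with x h1 h2 h3
  rw [h1, h2, Pi.smul_apply, h3]; simp

lemma ne_zero {o : PairL2 U} (ho : IsOne o) (hU : IsSmoothBoundedDomain U) : o ≠ 0 := by
  intro h0
  have h1 := ho.massForm_self subset_rfl
  rw [h0, map_zero] at h1
  exact (measureReal_ne_zero_iff hU.volume_lt_top.ne).2 hU.volume_pos.ne' h1.symm

end IsOne

lemma IsSmoothBoundedDomain.exists_isOne (hU : IsSmoothBoundedDomain U) :
    ∃ o : PairL2 U, IsOne o := by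
  obtain ⟨o, h1, h2, h3⟩ := exists_one_mem_H1 hU.volume_lt_top.ne
  exact ⟨o, h1, h2, h3⟩

/-- The Poincaré inequality on a smooth domain. -/
lemma IsSmoothBoundedDomain.poincare (hd : 0 < d) (hU : IsSmoothBoundedDomain U) {o : PairL2 U}
    (ho : IsOne o) : ∃ C : ℝ, 0 ≤ C ∧ ∀ w ∈ H1 U, massForm subset_rfl w w
      ≤ C * gradForm subset_rfl w w + massForm subset_rfl o w ^ 2 / massForm subset_rfl o o := by
  have hp := hU.isCompactFormPair hd
  obtain ⟨u, lam, hu⟩ := hp.exists_isEigenbasis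
  obtain ⟨-, h1, -, hgap⟩ := IsEigenbasis.spectral_gap hp hu ho.mem (ho.ne_zero hU)
    (ho.gradForm_left _ _) (fun w hw h0 => ho.exists_eq_smul hU hw (by
      rw [gradForm_self_eq_norm] at h0
      exact norm_eq_zero.1 (pow_eq_zero_iff (by norm_num) |>.1 h0)))
  -- The constant is the inverse of the first positive Neumann eigenvalue; the gap inequality is
  -- applied to `w` minus its mean `t`.
  refine ⟨(lam 1)⁻¹, by positivity, fun w hw => ?_⟩
  have hoo := hp.pos ho.mem (ho.ne_zero hU)
  set B := massForm (U := U) (A := U) subset_rfl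
  set A := gradForm (U := U) (A := U) subset_rfl
  set t := B o w / B o o with ht
  have h2 := hgap (w - t • o) ((H1 U).sub_mem hw ((H1 U).smul_mem _ ho.mem)) (by
    rw [map_sub, map_smul, smul_eq_mul, ht, div_mul_cancel₀ _ hoo.ne', sub_self])
  have hA0 : ∀ z, A o z = 0 := fun z => ho.gradForm_left _ z
  rw [form_sub_self hp.symm_left, form_sub_self hp.symm_right] at h2
  simp only [map_smul, LinearMap.smul_apply, hp.symm_left w o, hA0, hp.symm_right w o,
    smul_eq_mul, mul_zero, sub_zero, add_zero] at h2
  have h3 : B w w - 2 * (t * B o w) + t * (t * B o o) = B w w - B o w ^ 2 / B o o := by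
    rw [ht]; field_simp; ring
  rw [h3] at h2
  have h4 : B w w - B o w ^ 2 / B o o ≤ (lam 1)⁻¹ * A w w := by
    rw [inv_mul_eq_div, le_div_iff₀ h1]
    linarith
  linarith

end Constants

/-! ### Kernels of the stiff and mixed problems -/

section Existence

variable {d : ℕ} (G : Geometry d)

/-- Zero stiff energy forces a zero gradient on both parts, and the whole domain is connected, so
for every `ε` the kernel consists of the constants. -/
lemma Geometry.stiff_gap {m ε : ℝ} (hε : 0 < ε) {o : PairL2 G.whole} (ho : IsOne o)
    {u : ℕ → PairL2 G.whole} {lam : ℕ → ℝ}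
    (hu : IsEigenbasis (H1 G.whole) (stiffEnergy G ε) (stiffMass G m ε) u lam) :
    lam 0 = 0 ∧ 0 < lam 1 ∧ ∀ i, stiffMass G m ε o (u (i + 1)) = 0 := by
  obtain ⟨h0, h1, h2, -⟩ := IsEigenbasis.spectral_gap (G.isCompactFormPair_stiff m hε) hu ho.mem
    (ho.ne_zero G.whole_smooth)
    (by rw [stiffEnergy_apply, ho.gradForm_left, ho.gradForm_left]; simp)
    (fun w hw h0 => ho.exists_eq_smul G.whole_smooth hw (by
      have h1 := gradForm_nonneg G.annulus_subset w
      have h2 := gradForm_nonneg G.core_subset w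
      have h3 : 0 < ε⁻¹ := by positivity
      rw [stiffEnergy_apply] at h0
      have h4 : gradForm G.annulus_subset w w = 0 := by nlinarith
      have h5 : gradForm G.core_subset w w = 0 := by nlinarith
      have h6 := G.norm_snd_sq w
      rw [h4, h5, add_zero] at h6
      exact norm_eq_zero.1 (pow_eq_zero_iff (by norm_num) |>.1 h6)))
  exact ⟨h0, h1, h2⟩

/-- An eigenfunction for the eigenvalue zero would extend by zero to a function without gradient on
the connected whole domain. It would be a constant vanishing in the core, against its normalization.
-/
lemma Geometry.mixed_pos {v : ℕ → PairL2 G.annulus} {lam : ℕ → ℝ}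
    (hv : IsEigenbasis (mixedH1 G) (gradForm subset_rfl) (massForm subset_rfl) v lam) :
    0 < lam 0 := by
  obtain ⟨o, ho⟩ := G.whole_smooth.exists_isOne
  have h1 := gradForm_nonneg subset_rfl (v 0)
  rw [hv.form_self] at h1
  refine lt_of_le_of_ne h1 (fun h0 => ?_)
  have h2 := hv.form_self 0
  rw [← h0, gradForm_self_eq_norm, ← G.norm_ext_snd] at h2
  obtain ⟨c, hc⟩ := ho.exists_eq_smul G.whole_smooth (G.ext_mem_H1 (hv.mem 0))
    (norm_eq_zero.1 (pow_eq_zero_iff (by norm_num) |>.1 h2))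
  have h3 := G.massForm_core_ext o (v 0)
  rw [hc, map_smul, smul_eq_mul, ho.massForm_self] at h3
  have hpos : volume.real G.core ≠ 0 :=
    (measureReal_ne_zero_iff G.core_smooth.volume_lt_top.ne).2 G.core_smooth.volume_pos.ne'
  have h4 := hv.norm_one 0
  rw [← G.massForm_ext, hc, (mul_eq_zero.1 h3).resolve_right hpos] at h4
  simp at h4

end Existence

/-! ### A priori bounds, limits and trial functions as `ε` tends to zero -/

section Asymptotics

variable {d : ℕ} (G : Geometry d)

/-- The mean is kept as a separate term because orthogonality to constants controls it better than
the mass bound: its square is of order `ε ^ (4 * m)` instead of `ε ^ (2 * m)`. -/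
lemma Geometry.core_poincare {o : PairL2 G.whole} (ho : IsOne o) :
    ∃ C : ℝ, 0 ≤ C ∧ ∀ w ∈ H1 G.whole, massForm G.core_subset w w
      ≤ C * gradForm G.core_subset w w + massForm G.core_subset o w ^ 2 / volume.real G.core := by
  obtain ⟨C, hC, h⟩ := G.core_smooth.poincare G.pos_dim (ho.restrict G.core_subset)
  refine ⟨C, hC, fun w hw => ?_⟩
  have := h _ (restrictPair_mem_H1 G.core_subset hw)
  rwa [massForm_restrictPair, massForm_restrictPair, massForm_restrictPair, gradForm_restrictPair,
    ho.massForm_self] at this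

lemma Geometry.volume_core_pos : 0 < volume.real G.core :=
  measureReal_nonneg.lt_of_ne'
    ((measureReal_ne_zero_iff G.core_smooth.volume_lt_top.ne).2 G.core_smooth.volume_pos.ne')

lemma Geometry.volume_annulus_pos : 0 < volume.real G.annulus := by
  refine measureReal_nonneg.lt_of_ne' ((measureReal_ne_zero_iff ?_).2 ?_)
  · exact ((measure_mono G.annulus_subset).trans_lt G.whole_smooth.volume_lt_top).ne
  · exact (G.isOpen_annulus.measure_pos _ G.nonempty_annulus).ne'

section Bounds

variable {G} {m ε : ℝ} {w : PairL2 G.whole}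

lemma massForm_annulus_le (hε : 0 < ε) (hb : stiffMass G m ε w w = 1) :
    massForm G.annulus_subset w w ≤ 1 := by
  have h1 := massForm_nonneg G.core_subset w
  have h2 : 0 < ε ^ (-2 * m) := Real.rpow_pos_of_pos hε _
  rw [stiffMass_apply] at hb
  nlinarith [mul_nonneg h2.le h1]

lemma massForm_core_le (hε : 0 < ε) (hb : stiffMass G m ε w w = 1) :
    massForm G.core_subset w w ≤ ε ^ (2 * m) := by
  have h1 := massForm_nonneg G.annulus_subset w
  have h2 : 0 < ε ^ (2 * m) := Real.rpow_pos_of_pos hε _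
  rw [stiffMass_apply, neg_mul, Real.rpow_neg hε.le] at hb
  have h3 : (ε ^ (2 * m))⁻¹ * massForm G.core_subset w w ≤ 1 := by linarith
  rwa [inv_mul_le_iff₀ h2, mul_one] at h3

lemma gradForm_annulus_le (hε : 0 < ε) {C : ℝ} (ha : stiffEnergy G ε w w ≤ C) :
    gradForm G.annulus_subset w w ≤ C := by
  have h1 := gradForm_nonneg G.core_subset w
  have h2 : 0 < ε⁻¹ := by positivity
  rw [stiffEnergy_apply] at ha
  nlinarith [mul_nonneg h2.le h1]

lemma gradForm_core_le (hε : 0 < ε) {C : ℝ} (ha : stiffEnergy G ε w w ≤ C) :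
    gradForm G.core_subset w w ≤ ε * C := by
  have h1 := gradForm_nonneg G.annulus_subset w
  rw [stiffEnergy_apply] at ha
  rw [← inv_mul_le_iff₀ hε]
  linarith

end Bounds

lemma tendsto_rpow_zero {α : Type*} {p : ℝ} (hp : 0 < p) {l : Filter α} {e : α → ℝ}
    (he : Tendsto e l (𝓝 0)) : Tendsto (fun k => e k ^ p) l (𝓝 0) := by
  have := he.rpow_const (p := p) (Or.inr hp.le)
  rwa [Real.zero_rpow hp.ne'] at this

/-- Normalized functions of bounded energy, orthogonal to constants, converge along a subsequence to
a normalized function of the mixed problem: in the limit no mass is left in the core. -/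
lemma Geometry.exists_limit {m : ℝ} (hm0 : 0 < m) (hm1 : m < 1 / 2) {o : PairL2 G.whole}
    (ho : IsOne o) {e : ℕ → ℝ} (he : ∀ k, 0 < e k) (he0 : Tendsto e atTop (𝓝 0))
    {w : ℕ → PairL2 G.whole} (hw : ∀ k, w k ∈ H1 G.whole)
    (hb : ∀ k, stiffMass G m (e k) (w k) (w k) = 1) {C : ℝ}
    (ha : ∀ k, stiffEnergy G (e k) (w k) (w k) ≤ C)
    (hwo : ∀ k, stiffMass G m (e k) o (w k) = 0) :
    ∃ s : ℕ → ℕ, StrictMono s ∧ ∃ g ∈ mixedH1 G, massForm subset_rfl g g = 1 ∧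
      Tendsto (fun k => massForm G.annulus_subset (w (s k) - G.ext g) (w (s k) - G.ext g))
        atTop (𝓝 0) ∧
      ∀ v, Tendsto (fun k => gradForm G.annulus_subset (w (s k)) (G.ext v)) atTop
        (𝓝 (gradForm subset_rfl g v)) := by
  have hp0 : 0 < 2 * m := by positivity
  have hep : Tendsto (fun k => e k ^ (2 * m)) atTop (𝓝 0) := tendsto_rpow_zero hp0 he0
  have heC : Tendsto (fun k => e k * C) atTop (𝓝 0) := by simpa using he0.mul_const C
  obtain ⟨D₁, hD₁⟩ := hep.bddAbove_range
  obtain ⟨D₂, hD₂⟩ := heC.bddAbove_range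
  obtain ⟨s, hs, w₀, hw₀, h1, h2⟩ := G.whole_smooth.exists_convergent_subseq hw
    (C := max √(1 + D₁) √(C + D₂))
    (fun k => le_max_of_le_left (Real.le_sqrt_of_sq_le (by
      rw [G.norm_fst_sq]
      exact add_le_add (massForm_annulus_le (he k) (hb k))
        ((massForm_core_le (he k) (hb k)).trans (hD₁ ⟨k, rfl⟩)))))
    (fun k => le_max_of_le_right (Real.le_sqrt_of_sq_le (by
      rw [G.norm_snd_sq]
      exact add_le_add (gradForm_annulus_le (he k) (ha k))
        ((gradForm_core_le (he k) (ha k)).trans (hD₂ ⟨k, rfl⟩)))))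
  have hconv : ∀ {A : Set (E d)} (hA : A ⊆ G.whole),
      Tendsto (fun k => massForm hA (w (s k) - w₀) (w (s k) - w₀)) atTop (𝓝 0) := by
    intro A hA
    have h3 := h1.pow 2
    rw [zero_pow (by norm_num)] at h3
    exact squeeze_zero (fun k => massForm_nonneg hA _) (fun k => massForm_self_le hA _) h3
  have hes : Tendsto (fun k => e (s k)) atTop (𝓝 0) := he0.comp hs.tendsto_atTop
  have hm : massForm G.core_subset w₀ w₀ = 0 := by
    refine tendsto_nhds_unique (tendsto_form_self_of_tendsto_sub (massForm_symm _)
      (massForm_nonneg _) (hconv G.core_subset)) ?_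
    exact squeeze_zero (fun k => massForm_nonneg _ _)
      (fun k => massForm_core_le (he (s k)) (hb (s k))) (hep.comp hs.tendsto_atTop)
  have hg : gradForm G.core_subset w₀ w₀ = 0 := by
    refine le_antisymm ?_ (gradForm_nonneg _ _)
    exact form_self_le_of_tendsto (gradForm_symm _) (gradForm_nonneg _)
      (tendsto_gradForm G.measurableSet_core G.core_subset h2 w₀)
      (fun k => gradForm_core_le (he (s k)) (ha (s k))) (heC.comp hs.tendsto_atTop)
  obtain ⟨g, hgm, rfl⟩ := G.exists_ext_eq hw₀ hm hg
  refine ⟨s, hs, g, hgm, ?_, hconv G.annulus_subset, fun v => ?_⟩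
  · rw [← G.massForm_ext]
    refine tendsto_nhds_unique (tendsto_form_self_of_tendsto_sub (massForm_symm _)
      (massForm_nonneg _) (hconv G.annulus_subset)) ?_
    obtain ⟨Cp, hCp, hpoin⟩ := G.core_poincare ho
    set N := volume.real G.annulus
    set K := volume.real G.core
    have hK : 0 < K := G.volume_core_pos
    -- The crux: the weighted core mass vanishes. The oscillation gives `β * e k`, which is small
    -- because `m < 1 / 2`. For the mean, orthogonality gives `β * I = -J`, so `β * I ^ 2` equals `J
    -- ^ 2 / β` and is small too.
    have hcore : ∀ k, e k ^ (-2 * m) * massForm G.core_subset (w k) (w k)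
        ≤ Cp * C * e k ^ (1 - 2 * m) + N / K * e k ^ (2 * m) := by
      intro k
      set β := e k ^ (-2 * m) with hβ
      have hβ0 : 0 < β := Real.rpow_pos_of_pos (he k) _
      have hβi : e k ^ (2 * m) = β⁻¹ := by rw [hβ, neg_mul, Real.rpow_neg (he k).le, inv_inv]
      have hβe : e k ^ (1 - 2 * m) = β * e k := by
        rw [hβ, ← Real.rpow_add_one (he k).ne']
        congr 1; ring
      set I := massForm G.core_subset o (w k)
      set J := massForm G.annulus_subset o (w k)
      have hJ : J ^ 2 ≤ N := by
        have h3 := form_sq_le (massForm_symm G.annulus_subset) (massForm_nonneg G.annulus_subset)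
          o (w k)
        rw [ho.massForm_self] at h3
        exact h3.trans (mul_le_of_le_one_right measureReal_nonneg
          (massForm_annulus_le (he k) (hb k)))
      have hIJ : β * I = -J := by
        have := hwo k
        rw [stiffMass_apply] at this
        linarith
      have h3 : β * I ^ 2 ≤ N * β⁻¹ := by
        rw [← div_eq_mul_inv, le_div_iff₀ hβ0]
        calc β * I ^ 2 * β = (β * I) ^ 2 := by ring
          _ = J ^ 2 := by rw [hIJ]; ring
          _ ≤ N := hJ
      have h4 := hpoin (w k) (hw k)
      have h5 := gradForm_core_le (he k) (ha k)
      rw [hβi, hβe]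
      calc β * massForm G.core_subset (w k) (w k)
          ≤ β * (Cp * (e k * C) + I ^ 2 / K) := by
            refine mul_le_mul_of_nonneg_left (h4.trans ?_) hβ0.le
            gcongr
        _ = Cp * C * (β * e k) + (β * I ^ 2) / K := by ring
        _ ≤ Cp * C * (β * e k) + (N * β⁻¹) / K := by gcongr
        _ = Cp * C * (β * e k) + N / K * β⁻¹ := by ring
    have hlim : Tendsto (fun k => Cp * C * e k ^ (1 - 2 * m) + N / K * e k ^ (2 * m)) atTop
        (𝓝 0) := by
      have h3 := ((tendsto_rpow_zero (p := 1 - 2 * m) (by linarith) he0).const_mul (Cp * C)).add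
        (hep.const_mul (N / K))
      simpa using h3
    have hcore0 : Tendsto (fun k => e k ^ (-2 * m) * massForm G.core_subset (w k) (w k)) atTop
        (𝓝 0) := by
      refine squeeze_zero (fun k => ?_) hcore hlim
      exact mul_nonneg (Real.rpow_pos_of_pos (he k) _).le (massForm_nonneg _ _)
    have h3 := (hcore0.comp hs.tendsto_atTop).const_sub 1
    rw [sub_zero] at h3
    refine h3.congr (fun k => ?_)
    have := hb (s k)
    rw [stiffMass_apply] at this
    simp only [Function.comp]
    linarith
  · have := tendsto_gradForm G.measurableSet_annulus G.annulus_subset h2 (G.ext v)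
    rwa [G.gradForm_ext] at this

variable {G} {m ε : ℝ} {o : PairL2 G.whole} {v : ℕ → PairL2 G.annulus} {lam₀ : ℕ → ℝ}
  {u : ℕ → PairL2 G.whole} {lam : ℕ → ℝ}

/-- The right-hand side is the stiff mass of `c` plus an extension by zero of mass `Q` and integral
`J`, where `N` and `K` are the volumes of annulus and core. A constant may cancel mass in the
annulus, but it pays `β * c ^ 2 * K` in the core. The minimum over `c` is `Q - J ^ 2 / (N + β * K)`,
and `J ^ 2 ≤ N * Q` bounds the loss by the fraction `N / (β * K)`. -/
lemma weighted_mass_lower_bound {N K β Q J : ℝ} (hN : 0 < N) (hK : 0 < K) (hβ : 0 < β)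
    (hQ : 0 ≤ Q) (hJ : J ^ 2 ≤ N * Q) (c : ℝ) :
    (1 - N / K * β⁻¹) * Q ≤ c ^ 2 * N + 2 * c * J + Q + β * (c ^ 2 * K) := by
  set δ := N / K * β⁻¹ with hδdef
  have hδ0 : 0 < δ := by positivity
  have hδK : δ * (β * K) = N := by
    rw [hδdef]; field_simp
  -- Expanding cancels `c ^ 2 * J ^ 2` and leaves `Q` as a factor. Dividing by `Q`, writing `N = δ *
  -- (β * K)` and dividing by `δ` gives the claim up to the nonnegative term `c ^ 2 * N`.
  have h1 : 0 ≤ (δ * Q + c * J) ^ 2 + c ^ 2 * (N * Q - J ^ 2) :=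
    add_nonneg (sq_nonneg _) (mul_nonneg (sq_nonneg _) (sub_nonneg.2 hJ))
  have h2 : 0 ≤ Q * (δ * Q * δ + 2 * c * J * δ + c ^ 2 * N) := by linarith
  rcases hQ.eq_or_lt with h3 | h3
  · have hJ0 : J = 0 := by
      rw [← h3, mul_zero] at hJ
      exact pow_eq_zero_iff (by norm_num) |>.1 (le_antisymm hJ (sq_nonneg _))
    rw [← h3, hJ0]
    have : 0 ≤ c ^ 2 * N + β * (c ^ 2 * K) := by positivity
    linarith
  · have h4 : 0 ≤ δ * Q * δ + 2 * c * J * δ + c ^ 2 * N := nonneg_of_mul_nonneg_right h2 h3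
    rw [← hδK] at h4
    have h5 : 0 ≤ δ * (δ * Q + 2 * c * J + c ^ 2 * (β * K)) := by linarith
    have h6 := nonneg_of_mul_nonneg_right h5 hδ0
    have h7 : 0 ≤ c ^ 2 * N := by positivity
    linarith

/-- Upper bound for the positive stiff eigenvalues, by testing with constants and extensions of
eigenfunctions of the mixed problem. -/
lemma stiff_eigenvalue_le (hε : 0 < ε) (ho : IsOne o)
    (hv : IsEigenbasis (mixedH1 G) (gradForm subset_rfl) (massForm subset_rfl) v lam₀)
    (hu : IsEigenbasis (H1 G.whole) (stiffEnergy G ε) (stiffMass G m ε) u lam) (n : ℕ)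
    (hδ : volume.real G.annulus / volume.real G.core * ε ^ (2 * m) < 1) :
    lam (n + 1)
      ≤ lam₀ n / (1 - volume.real G.annulus / volume.real G.core * ε ^ (2 * m)) := by
  have hN := G.volume_annulus_pos
  have hK := G.volume_core_pos
  set N := volume.real G.annulus with hNdef
  set K := volume.real G.core with hKdef
  have hβi : ε ^ (2 * m) = (ε ^ (-2 * m))⁻¹ := by
    rw [neg_mul, Real.rpow_neg hε.le, inv_inv]
  have hβ : 0 < ε ^ (-2 * m) := Real.rpow_pos_of_pos hε _
  rw [hβi] at hδ ⊢
  have hlam0 : 0 ≤ lam₀ n := by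
    rw [← hv.form_self]; exact gradForm_nonneg _ _
  -- The constant accounts for the zero eigenvalue, so these `n + 2` trial functions bound the stiff
  -- eigenvalue of index `n + 1` by the mixed one of index `n`.
  let w : Fin (n + 1 + 1) → PairL2 G.whole := Fin.cons o (fun i => G.ext (v i))
  have hsum : ∀ c : Fin (n + 1 + 1) → ℝ, ∑ i, c i • w i
      = c 0 • o + G.ext (∑ i : Fin (n + 1), c i.succ • v i) := by
    intro c
    rw [Fin.sum_univ_succ, map_sum]
    simp [w]
  have hli : LinearIndependent ℝ w := by
    rw [Fintype.linearIndependent_iff]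
    intro c hc
    rw [hsum] at hc
    -- In the core the extensions vanish, so only the constant is seen there.
    have h0 : c 0 = 0 := by
      have h1 := congrArg (massForm G.core_subset o) hc
      rw [map_add, map_smul, G.massForm_core_ext, ho.massForm_self, map_zero, add_zero,
        smul_eq_mul] at h1
      exact (mul_eq_zero.1 h1).resolve_right hK.ne'
    rw [h0, zero_smul, zero_add] at hc
    have hz : ∑ i : Fin (n + 1), c i.succ • v i = 0 := by
      refine G.isCompactFormPair_mixed.definite _
        ((mixedH1 G).sum_mem fun i _ => (mixedH1 G).smul_mem _ (hv.mem i)) ?_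
      rw [← G.massForm_ext, hc, map_zero]
    have hli' := hv.linearIndependent.comp (fun i : Fin (n + 1) => (i : ℕ)) Fin.val_injective
    have h1 := Fintype.linearIndependent_iff.1 hli' (fun i => c i.succ) hz
    intro i
    refine Fin.cases h0 h1 i
  refine IsEigenbasis.le_of_forall_combination (G.isCompactFormPair_stiff m hε) hu (w := w) ?_ hli
    (fun c => ?_)
  · intro i
    refine Fin.cases ?_ (fun j => ?_) i
    · exact ho.mem
    · exact G.ext_mem_H1 (hv.mem j)
  · rw [hsum]
    set z := ∑ i : Fin (n + 1), c i.succ • v i with hz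
    have hle : gradForm subset_rfl z z ≤ lam₀ n * massForm subset_rfl z z :=
      hv.form_combination_le (σ := fun i : Fin (n + 1) => (i : ℕ)) Fin.val_injective
        (fun i => hv.monotone (Nat.lt_succ_iff.1 i.2)) (fun i => c i.succ)
    have ea : stiffEnergy G ε (c 0 • o + G.ext z) (c 0 • o + G.ext z) = gradForm subset_rfl z z := by
      rw [← G.gradForm_ext, stiffEnergy_apply]
      simp only [map_add, map_smul, LinearMap.add_apply, LinearMap.smul_apply, ho.gradForm_left,
        G.gradForm_core_ext, gradForm_symm _ (G.ext z) o, smul_zero, zero_add, add_zero, mul_zero]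
    have eb : stiffMass G m ε (c 0 • o + G.ext z) (c 0 • o + G.ext z)
        = c 0 ^ 2 * N + 2 * c 0 * massForm G.annulus_subset o (G.ext z)
          + massForm subset_rfl z z + ε ^ (-2 * m) * (c 0 ^ 2 * K) := by
      rw [← G.massForm_ext, stiffMass_apply]
      simp only [map_add, map_smul, LinearMap.add_apply, LinearMap.smul_apply,
        G.massForm_core_ext, massForm_symm _ (G.ext z) o, smul_eq_mul, mul_zero, add_zero,
        ho.massForm_self]
      rw [← hNdef, ← hKdef]
      ring
    have hJ := form_sq_le (massForm_symm G.annulus_subset) (massForm_nonneg G.annulus_subset)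
      o (G.ext z)
    rw [ho.massForm_self, G.massForm_ext] at hJ
    have hmass := weighted_mass_lower_bound hN hK hβ (massForm_nonneg subset_rfl z) hJ (c 0)
    rw [ea, eb]
    have h1δ := sub_pos.2 hδ
    refine hle.trans ?_
    rw [div_mul_eq_mul_div, le_div_iff₀ h1δ, mul_assoc]
    refine mul_le_mul_of_nonneg_left ?_ hlam0
    rw [mul_comm]
    exact hmass

/-- A normalized combination of stiff eigenvectors which is orthogonal to the first eigenfunctions
of the mixed problem. -/
lemma exists_stiff_combination (hε : 0 < ε) (ho : IsOne o)
    (hu : IsEigenbasis (H1 G.whole) (stiffEnergy G ε) (stiffMass G m ε) u lam)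
    (v : ℕ → PairL2 G.annulus) (n : ℕ) :
    ∃ w ∈ H1 G.whole, stiffMass G m ε w w = 1 ∧ stiffEnergy G ε w w ≤ lam (n + 1) ∧
      stiffMass G m ε o w = 0 ∧ ∀ i < n, massForm G.annulus_subset w (G.ext (v i)) = 0 := by
  have hp := G.isCompactFormPair_stiff m hε
  have hσ : Function.Injective (fun i : Fin (n + 1) => (i : ℕ) + 1) :=
    fun i j hij => Fin.ext (Nat.succ_injective hij)
  -- The eigenvectors `u 1, …, u (n + 1)` are used: `u 0` is left out to keep the combination
  -- orthogonal to constants, and `n + 1` of them are enough for `n` conditions.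
  obtain ⟨c, hc0, hc⟩ := exists_combination_eq_zero (κ := Fin n) (ι := Fin (n + 1)) (by simp)
    (fun i => massForm G.annulus_subset (G.ext (v i))) (fun i => u ((i : ℕ) + 1))
  set W := ∑ i : Fin (n + 1), c i • u ((i : ℕ) + 1) with hW
  have hWH : W ∈ H1 G.whole := (H1 G.whole).sum_mem fun i _ => (H1 G.whole).smul_mem _ (hu.mem _)
  have hW0 : W ≠ 0 := fun h0 => hc0 (funext (Fintype.linearIndependent_iff.1
    (hu.linearIndependent.comp _ hσ) c h0))
  have hpos := hp.pos hWH hW0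
  have hle : stiffEnergy G ε W W ≤ lam (n + 1) * stiffMass G m ε W W :=
    hu.form_combination_le hσ (fun i => hu.monotone (Nat.succ_le_of_lt (by
      have := i.2
      omega))) c
  have hWo : stiffMass G m ε o W = 0 := by
    rw [hW, map_sum]
    refine Finset.sum_eq_zero fun i _ => ?_
    rw [map_smul, (G.stiff_gap hε ho hu).2.2, smul_zero]
  set t := (√(stiffMass G m ε W W))⁻¹ with ht
  have htt : t * t * stiffMass G m ε W W = 1 := by
    rw [ht, ← mul_inv, Real.mul_self_sqrt hpos.le, inv_mul_cancel₀ hpos.ne']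
  refine ⟨t • W, (H1 G.whole).smul_mem _ hWH, ?_, ?_, ?_, fun i hi => ?_⟩
  · simp only [map_smul, LinearMap.smul_apply, smul_eq_mul]
    rw [← mul_assoc, htt]
  · simp only [map_smul, LinearMap.smul_apply, smul_eq_mul]
    calc t * (t * stiffEnergy G ε W W) = t * t * stiffEnergy G ε W W := by ring
      _ ≤ t * t * (lam (n + 1) * stiffMass G m ε W W) :=
        mul_le_mul_of_nonneg_left hle (mul_self_nonneg t)
      _ = lam (n + 1) * (t * t * stiffMass G m ε W W) := by ring
      _ = lam (n + 1) := by rw [htt, mul_one]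
  · rw [map_smul, hWo, smul_zero]
  · rw [map_smul, LinearMap.smul_apply, massForm_symm]
    have := hc ⟨i, hi⟩
    rw [this, smul_zero]

end Asymptotics

/-! ### Convergence of eigenvalues and eigenfunctions -/

section Convergence

variable {d : ℕ} {G : Geometry d} {m : ℝ}

/-- Uniqueness of the eigenvalue sequence identifies a prescribed one with that of the constructed
eigenbasis, which makes the variational principles available for it. -/
lemma exists_stiff_eigenbasis {ε : ℝ} (hε : 0 < ε) {lam : ℕ → ℝ}
    (h : IsEigenvalueSequence (stiffEigenspace G m ε) lam) :
    ∃ u, IsEigenbasis (H1 G.whole) (stiffEnergy G ε) (stiffMass G m ε) u lam := by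
  have hp := G.isCompactFormPair_stiff m hε
  obtain ⟨u, lam', hu⟩ := hp.exists_isEigenbasis
  have : lam = lam' := h.unique (IsEigenbasis.isEigenvalueSequence hp hu)
  exact ⟨u, this ▸ hu⟩

lemma exists_mixed_eigenbasis {lam : ℕ → ℝ} (h : IsEigenvalueSequence (mixedEigenspace G) lam) :
    ∃ v, IsEigenbasis (mixedH1 G) (gradForm subset_rfl) (massForm subset_rfl) v lam := by
  have hp := G.isCompactFormPair_mixed
  obtain ⟨u, lam', hu⟩ := hp.exists_isEigenbasis
  have : lam = lam' := h.unique (IsEigenbasis.isEigenvalueSequence hp hu)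
  exact ⟨u, this ▸ hu⟩

/-- Convergence of the positive stiff eigenvalues to those of the mixed problem. -/
lemma tendsto_stiff_eigenvalue (hm0 : 0 < m) (hm1 : m < 1 / 2) {lamE : ℝ → ℕ → ℝ} {lam₀ : ℕ → ℝ}
    (hE : ∀ ε : ℝ, 0 < ε → IsEigenvalueSequence (stiffEigenspace G m ε) (lamE ε))
    (h₀ : IsEigenvalueSequence (mixedEigenspace G) lam₀) (n : ℕ) :
    Tendsto (fun ε => lamE ε (n + 1)) (𝓝[>] 0) (𝓝 (lam₀ n)) := by
  obtain ⟨o, ho⟩ := G.whole_smooth.exists_isOne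
  obtain ⟨v, hv⟩ := exists_mixed_eigenbasis h₀
  set θ := volume.real G.annulus / volume.real G.core
  have hp0 : 0 < 2 * m := by positivity
  have hθ : Tendsto (fun ε : ℝ => θ * ε ^ (2 * m)) (𝓝[>] 0) (𝓝 0) := by
    have h1 : Tendsto (fun ε : ℝ => ε ^ (2 * m)) (𝓝[>] 0) (𝓝 0) :=
      tendsto_rpow_zero hp0 (tendsto_id.mono_left nhdsWithin_le_nhds)
    simpa using h1.const_mul θ
  have hupper : ∀ᶠ ε in 𝓝[>] (0 : ℝ), lamE ε (n + 1) ≤ lam₀ n / (1 - θ * ε ^ (2 * m)) := by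
    filter_upwards [hθ.eventually_lt_const one_pos, self_mem_nhdsWithin] with ε h1 hε
    obtain ⟨u, hu⟩ := exists_stiff_eigenbasis hε (hE ε hε)
    exact stiff_eigenvalue_le hε ho hv hu n h1
  have hlim : Tendsto (fun ε : ℝ => lam₀ n / (1 - θ * ε ^ (2 * m))) (𝓝[>] 0) (𝓝 (lam₀ n)) := by
    have h1 := (tendsto_const_nhds (x := lam₀ n)).div (hθ.const_sub 1) (by norm_num)
    rw [sub_zero, div_one] at h1
    exact h1
  rw [tendsto_order]
  refine ⟨fun L hL => ?_, fun L hL => ?_⟩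
  -- Otherwise the stiff eigenvalues stay at most `L < lam₀ n` along a sequence. The limit of the
  -- combinations is then a unit mixed function of energy at most `L`, yet orthogonal to the first
  -- `n` mixed eigenfunctions.
  · by_contra hcon
    obtain ⟨e, he, heL⟩ := exists_seq_forall_of_frequently
      (((not_eventually.1 hcon)).and_eventually self_mem_nhdsWithin)
    have he0 : Tendsto e atTop (𝓝 0) := he.mono_right nhdsWithin_le_nhds
    have hpos : ∀ k, 0 < e k := fun k => (heL k).2
    have hex : ∀ k, ∃ w ∈ H1 G.whole, stiffMass G m (e k) w w = 1 ∧ stiffEnergy G (e k) w w ≤ L ∧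
        stiffMass G m (e k) o w = 0 ∧
        ∀ i < n, massForm G.annulus_subset w (G.ext (v i)) = 0 := by
      intro k
      obtain ⟨u, hu⟩ := exists_stiff_eigenbasis (hpos k) (hE _ (hpos k))
      obtain ⟨w, h1, h2, h3, h4⟩ := exists_stiff_combination (hpos k) ho hu v n
      exact ⟨w, h1, h2, h3.trans (not_lt.1 (heL k).1), h4⟩
    choose w hwH hwb hwa hwo hwv using hex
    obtain ⟨s, hs, g, hg, hg1, hconv, hgrad⟩ :=
      G.exists_limit hm0 hm1 ho hpos he0 hwH hwb hwa hwo
    have horth : ∀ i < n, massForm subset_rfl (v i) g = 0 := by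
      intro i hi
      rw [massForm_symm, ← G.massForm_ext]
      refine tendsto_nhds_unique (tendsto_form_of_tendsto_sub (massForm_symm _)
        (massForm_nonneg _) hconv (G.ext (v i))) ?_
      simp [hwv _ i hi]
    have h1 := hv.le_of_orthogonal n g hg horth
    rw [hg1, mul_one, ← G.gradForm_ext] at h1
    have h2 := hgrad g
    rw [← G.gradForm_ext] at h2
    have h3 := form_self_le_of_tendsto (gradForm_symm _) (gradForm_nonneg _) h2
      (fun k => gradForm_annulus_le (hpos (s k)) (hwa (s k))) tendsto_const_nhds
    linarith
  · filter_upwards [hupper, hlim.eventually_lt_const hL] with ε h1 h2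
    exact h1.trans_lt h2

/-- Limits of normalized stiff eigenfunctions are normalized eigenfunctions of the mixed problem. -/
lemma exists_eigenfunction_limit (hm0 : 0 < m) (hm1 : m < 1 / 2) {e : ℕ → ℝ} (he : ∀ k, 0 < e k)
    (he0 : Tendsto e atTop (𝓝 0)) {μ : ℕ → ℝ} {μ₀ : ℝ} (hμ : Tendsto μ atTop (𝓝 μ₀))
    (hpos : ∀ k, 0 < μ k) {u : ℕ → PairL2 G.whole}
    (hu : ∀ k, u k ∈ stiffEigenspace G m (e k) (μ k))
    (hb : ∀ k, stiffMass G m (e k) (u k) (u k) = 1) :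
    ∃ s : ℕ → ℕ, StrictMono s ∧ ∃ g ∈ mixedEigenspace G μ₀, ∫ x in G.annulus, g.1 x ^ 2 = 1 ∧
      Tendsto (fun k => ∫ x in G.annulus, ((u (s k)).1 x - g.1 x) ^ 2) atTop (𝓝 0) := by
  obtain ⟨o, ho⟩ := G.whole_smooth.exists_isOne
  have hsymm := fun k => (G.isCompactFormPair_stiff m (he k)).symm_right
  have hae : ∀ k, stiffEnergy G (e k) (u k) (u k) = μ k := fun k => by
    rw [(hu k).2 _ (hu k).1, hb, mul_one]
  obtain ⟨C, hC⟩ := hμ.bddAbove_range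
  -- The eigenvalue equation is tested with a constant, which has no energy; the eigenvalue is
  -- positive and can be divided out.
  have hwo : ∀ k, stiffMass G m (e k) o (u k) = 0 := by
    intro k
    have h1 := (hu k).2 o ho.mem
    rw [stiffEnergy_apply, gradForm_symm, gradForm_symm G.core_subset, ho.gradForm_left,
      ho.gradForm_left, mul_zero, add_zero] at h1
    rw [hsymm]
    exact (mul_eq_zero.1 h1.symm).resolve_left (hpos k).ne'
  obtain ⟨s, hs, g, hg, hg1, hconv, hgrad⟩ := G.exists_limit hm0 hm1 ho he he0
    (fun k => (hu k).1) hb (fun k => (hae k).le.trans (hC ⟨k, rfl⟩)) hwo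
  refine ⟨s, hs, g, ⟨hg, fun φ hφ => ?_⟩, ?_, ?_⟩
  · refine tendsto_nhds_unique (hgrad φ) ?_
    have h1 := (hμ.comp hs.tendsto_atTop).mul (tendsto_form_of_tendsto_sub (massForm_symm _)
      (massForm_nonneg _) hconv (G.ext φ))
    rw [G.massForm_ext] at h1
    refine h1.congr (fun k => ?_)
    -- Tested with an extension by zero, the equation loses its core terms and with them every
    -- singular factor in `ε`.
    have h2 := (hu (s k)).2 _ (G.ext_mem_H1 hφ)
    rw [stiffEnergy_apply, stiffMass_apply, G.gradForm_core_ext, G.massForm_core_ext, mul_zero,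
      mul_zero, add_zero, add_zero] at h2
    exact h2.symm
  · rw [← massForm_self subset_rfl]; exact hg1
  · refine hconv.congr (fun k => ?_)
    rw [massForm_self]
    refine integral_congr_ae ?_
    filter_upwards [ae_sub G.annulus_subset (Lp.coeFn_sub (u (s k)).1 (G.ext g).1),
      extendLp_ae_self G.measurableSet_annulus G.annulus_subset g.1] with x h1 h2
    rw [Prod.fst_sub, h1, Pi.sub_apply, Geometry.ext, extendPair_fst, h2]

end Convergence

end StiffNeumann

end

/-! ### The main theorem -/

open StiffNeumann in
theorem mainTheorem2 {d : ℕ} (G : Geometry d) (m : ℝ) (hm0 : 0 < m) (hm1 : m < 1 / 2) :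
    -- both problems have a discrete spectrum; index `n` of a sequence is its `(n+1)`-st member
    (∀ ε : ℝ, 0 < ε → ∃ lam : ℕ → ℝ,
      IsEigenvalueSequence (stiffEigenspace G m ε) lam ∧ lam 0 = 0 ∧ 0 < lam 1) ∧
    (∃ lam : ℕ → ℝ, IsEigenvalueSequence (mixedEigenspace G) lam ∧ 0 < lam 0) ∧
    ∀ (lamE : ℝ → ℕ → ℝ) (lam0 : ℕ → ℝ),
      (∀ ε : ℝ, 0 < ε → IsEigenvalueSequence (stiffEigenspace G m ε) (lamE ε)) →
      IsEigenvalueSequence (mixedEigenspace G) lam0 →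
      ∀ n : ℕ,
        -- the `n`-th positive eigenvalue converges
        Tendsto (fun ε => lamE ε (n + 1)) (𝓝[>] 0) (𝓝 (lam0 n)) ∧
        -- convergence of normalized eigenfunctions
        ∀ u : ℝ → PairL2 G.whole,
          (∀ ε : ℝ, 0 < ε → u ε ∈ stiffEigenspace G m ε (lamE ε (n + 1)) ∧
            stiffMass G m ε (u ε) (u ε) = 1) →
          -- the core component tends to zero in `H¹(Ω₀)`
          Tendsto (fun ε => ∫ x in G.core, (u ε).1 x ^ 2) (𝓝[>] 0) (𝓝 0) ∧
          Tendsto (fun ε => ∫ x in G.core, ‖(u ε).2 x‖ ^ 2) (𝓝[>] 0) (𝓝 0) ∧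
          -- strong convergence in `L²(Ω₁)`, up to subsequences
          ∀ e : ℕ → ℝ, (∀ k, 0 < e k) → Tendsto e atTop (𝓝 0) →
            ∃ s : ℕ → ℕ, StrictMono s ∧ ∃ g ∈ mixedEigenspace G (lam0 n),
              ∫ x in G.annulus, g.1 x ^ 2 = 1 ∧
              Tendsto (fun k => ∫ x in G.annulus, ((u (e (s k))).1 x - g.1 x) ^ 2)
                atTop (𝓝 0) := by
  obtain ⟨o, ho⟩ := G.whole_smooth.exists_isOne
  refine ⟨fun ε hε => ?_, ?_, fun lamE lam0 hE h0 n => ?_⟩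
  · have hp := G.isCompactFormPair_stiff m hε
    obtain ⟨u, lam, hu⟩ := hp.exists_isEigenbasis
    obtain ⟨h1, h2, -⟩ := G.stiff_gap hε ho hu
    exact ⟨lam, IsEigenbasis.isEigenvalueSequence hp hu, h1, h2⟩
  · have hp := G.isCompactFormPair_mixed
    obtain ⟨v, lam, hv⟩ := hp.exists_isEigenbasis
    exact ⟨lam, IsEigenbasis.isEigenvalueSequence hp hv, G.mixed_pos hv⟩
  · have hlam := tendsto_stiff_eigenvalue hm0 hm1 hE h0 n
    refine ⟨hlam, fun u hu => ⟨?_, ?_, fun e he he0 => ?_⟩⟩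
    · have hp0 : 0 < 2 * m := by positivity
      have h1 : Tendsto (fun ε : ℝ => ε ^ (2 * m)) (𝓝[>] 0) (𝓝 0) :=
        tendsto_rpow_zero hp0 (tendsto_id.mono_left nhdsWithin_le_nhds)
      refine squeeze_zero' (.of_forall fun ε => integral_nonneg fun x => sq_nonneg _) ?_ h1
      filter_upwards [self_mem_nhdsWithin] with ε hε
      rw [← massForm_self G.core_subset]
      exact massForm_core_le hε (hu ε hε).2
    -- A normalized eigenfunction has energy equal to its eigenvalue, so its core gradient energy is
    -- at most `ε` times a convergent quantity.
    · have h1 : Tendsto (fun ε : ℝ => ε * lamE ε (n + 1)) (𝓝[>] 0) (𝓝 0) := by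
        have := (tendsto_id (x := 𝓝 (0 : ℝ))).mono_left nhdsWithin_le_nhds |>.mul hlam
        simpa using this
      refine squeeze_zero' (.of_forall fun ε => integral_nonneg fun x => sq_nonneg _) ?_ h1
      filter_upwards [self_mem_nhdsWithin] with ε hε
      rw [← gradForm_self G.core_subset]
      refine gradForm_core_le hε (le_of_eq ?_)
      obtain ⟨h2, h3⟩ := hu ε hε
      rw [h2.2 _ h2.1, h3, mul_one]
    · have he' : Tendsto e atTop (𝓝[>] 0) :=
        tendsto_nhdsWithin_iff.2 ⟨he0, .of_forall he⟩
      have hpos : ∀ k, 0 < lamE (e k) (n + 1) := fun k => by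
        obtain ⟨w, hw⟩ := exists_stiff_eigenbasis (he k) (hE _ (he k))
        exact (G.stiff_gap (he k) ho hw).2.1.trans_le (hw.monotone (by omega))
      exact exists_eigenfunction_limit (u := fun k => u (e k)) (μ := fun k => lamE (e k) (n + 1))
        hm0 hm1 he he0 (hlam.comp he') hpos (fun k => (hu _ (he k)).1) (fun k => (hu _ (he k)).2)
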